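/- **Itô's formula for measure flows with Poissonian common noise.** Let $T>0$, $t\in[0,T]$, let $U$ be a compact subset of a Banach space $B$, let $(Z,\mathscr Z,\lambda)$ be a finite measure space, and let $N$ be a Poisson random measure on $(0,T]\times Z$ with intensity $ds\,\lambda(dz)$ on a probability space $(\Omega,\mathcal F,\mathbb P)$; let $\mathbb G$ be its completed natural filtration. *Spaces.* $\mathcal P_2(\mathbb R^n)$ carries the 2-Wasserstein metric $W_2$, and $\mathcal P_2(\mathbb R^n\times U)$ the Fortet–Mourier metric $\|\rho-\rho'\|_{FM}=\sup_f\int f\,d(\rho-\rho')$ over all $f:\mathbb R^n\times B\to\mathbb R$ with $|f|\le1$ that are 1-Lipschitz for $|x|+\|u\|$; $M_2(\rho)=(\int(|x|^2+\|u\|^2)\,d\rho)^{1/2}$. *Coefficients.* Let $b(x,\rho,u)\in\mathbb R^n$, $\sigma(x,\rho,u)\in\mathbb R^{n\times d}$, $\gamma(x,\rho,u,z)\in\mathbb R^n$ be defined for $x\in\mathbb R^n$, $\rho\in\mathcal P_2(\mathbb R^n\times U)$, $u\in U$, $z\in Z$, jointly continuous in $(x,\rho,u)$ ($\gamma$ for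 each $z$), with $\gamma$ measurable in $z$. Assume that $b$, $\sigma$ and, for each $z$, $\gamma(\cdot,z)$ are bounded in norm by a constant times $1+|x|+M_2(\rho)$, and that $\int_Z|\gamma(x,\rho,u,z)|^2\lambda(dz)\le K(1+|x|^2+M_2(\rho)^2)$ for some constant $K$. For $\mu\in\mathcal P_2(\mathbb R^n)$ and a transition kernel $\hat u$ from $\mathbb R^n$ to $U$ put $(\mu\cdot\hat u)(dx,du)=\mu(dx)\hat u(x,du)$ and $$\hat b(x,\mu,\hat u)=\int_U b(x,\mu\cdot\hat u,u)\,\hat u(x,du),\qquad \hat\sigma\hat\sigma^\top(x,\mu,\hat u)=\int_U\sigma\sigma^\top(x,\mu\cdot\hat u,u)\,\hat u(x,du),$$ $$\hat\gamma(x,\mu,\hat u,z)=\int_U\gamma(x,\mu\cdot\hat u,u,z)\,\hat u(x,du),\qquad \langle\hat\gamma,\lambda\rangle=\int_Z\hat\gamma(\cdot,z)\,\lambda(dz),$$ $$I^{\mu,\hat u,z}g(x)=\int_U g\bigl(x+\gamma(x,\mu\cdot\hat u,u,z)\bigr)\,\hat u(x,du),$$ and let $I^{\mu,\hat u,z,*}\nu$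 be the measure with $\langle g,I^{\mu,\hat u,z,*}\nu\rangle=\langle I^{\mu,\hat u,z}g,\nu\rangle$ for $g\in C_b(\mathbb R^n)$. *Flow.* Let $\hat\alpha=(\hat\alpha_s)_{s\in[t,T]}$ be a $\mathbb G$-adapted process of transition kernels from $\mathbb R^n$ to $U$ with measurable paths $(s,x)\mapsto\hat\alpha_s(x)$, and $(\mu_s)_{s\in[t,T]}$ a $\mathbb G$-adapted càdlàg process in $(\mathcal P_2(\mathbb R^n),W_2)$. At the atom times $s\in(t,T]$ of $N$ let $\hat\alpha_{s-}$ be a kernel such that $\mu_r\cdot\hat\alpha_r\to\mu_{s-}\cdot\hat\alpha_{s-}$ in Fortet–Mourier distance as $r\uparrow s$. Assume that $$d\mu_s=A_0^{\hat\alpha}\mu_s\,ds+\int_Z\bigl(I^{\mu_{s-},\hat\alpha_{s-},z,*}\mu_{s-}-\mu_{s-}\bigr)N(ds,dz)\quad\text{on }[t,T],$$ $$A_0^{\hat\alpha}\mu_s=-\partial_x\bigl((\hat b-\langle\hat\gamma,\lambda\rangle)(x,\mu_s,\hat\alpha_s)\,\mu_s\bigr)+\tfrac12\partial_{xx}\bigl(\hat\sigma\hat\sigma^\top(x,\mu_s,\hat\alpha_s)\,\mu_s\bigr),$$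 in the sense of distributions: almost surely, the integrated equation holds for all times $s\in[t,T]$ against all test functions in $C_c^\infty(\mathbb R^n)$. *Regularity.* Let $J\in C^{1;1,1}([0,T]\times\mathcal P_2(\mathbb R^n))$: $\partial_tJ$ exists; for each time, $J$ has a linear derivative $\frac{\delta J}{\delta\mu}$, i.e. a function continuous in $(\mu,x)$ with $J(m')-J(m)=\int_0^1\int\frac{\delta J}{\delta\mu}(m+l(m'-m))(x)\,(m'-m)(dx)\,dl$ and $|\frac{\delta J}{\delta\mu}(m)(x)|\le K(1+|x|^2)$, $K$ uniform on bounded sets of $m$; $\partial_\mu J=\partial_x\frac{\delta J}{\delta\mu}$ and $\partial_x\partial_\mu J$ exist; and $\partial_tJ(t,\mu)$, $\partial_\mu J(t,\mu)(x)$, $\partial_x\partial_\mu J(t,\mu)(x)$ are jointly continuous. Assume moreover that for every $R$ there is $K$ such that $|\partial_\mu J(s,m)(x)|\le K(1+|x|)$ and $|\partial_x\partial_\mu J(s,m)(x)|\le K$ whenever $s\in[0,T]$, $x\in\mathbb R^n$ and $\int|y|^2m(dy)\le R$. *Conclusion.* Almost surely, all integrals below converge absolutely, and for all $s\in[t,T]$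 $$\begin{aligned}J(s,\mu_s)=J(t,\mu_t)&+\int_t^s\Bigl[\partial_rJ(r,\mu_r)+\int_{\mathbb R^n}\Bigl((\hat b-\langle\hat\gamma,\lambda\rangle)(x,\mu_r,\hat\alpha_r)\cdot\partial_\mu J(r,\mu_r)(x)\\&\qquad+\tfrac12\operatorname{tr}\bigl(\hat\sigma\hat\sigma^\top(x,\mu_r,\hat\alpha_r)\,\partial_x\partial_\mu J(r,\mu_r)(x)\bigr)\Bigr)\mu_r(dx)\Bigr]dr\\&+\int_{(t,s]\times Z}\bigl(J(r,I^{\mu_{r-},\hat\alpha_{r-},z,*}\mu_{r-})-J(r,\mu_{r-})\bigr)\,N(dr,dz).\end{aligned}$$ -/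

import Mathlib

open MeasureTheory ProbabilityTheory Filter Set
open scoped Topology ENNReal Gradient

noncomputable section

namespace MFC

/-- `ℝⁿ` with its Euclidean norm. -/
abbrev Rn (n : ℕ) := EuclideanSpace ℝ (Fin n)

/-! ### Spaces of probability measures -/

/-- Membership in `𝒫₂(ℝⁿ)`. -/
def IsP2 {n : ℕ} (μ : Measure (Rn n)) : Prop :=
  IsProbabilityMeasure μ ∧ ∫⁻ x, ‖x‖ₑ ^ 2 ∂μ < ∞

/-- The 2-Wasserstein distance: the infimum of the quadratic transport cost over all couplings. -/
def W2 {n : ℕ} (μ ν : Measure (Rn n)) : ℝ≥0∞ :=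
  (⨅ (π : Measure (Rn n × Rn n)) (_ : π.map Prod.fst = μ) (_ : π.map Prod.snd = ν),
    ∫⁻ p, ‖p.1 - p.2‖ₑ ^ 2 ∂π) ^ (1 / 2 : ℝ)

section Joint

variable {n : ℕ} {B : Type*} [NormedAddCommGroup B] [NormedSpace ℝ B] [MeasurableSpace B]
  [BorelSpace B] {U : Set B}

/-- Membership in `𝒫₂(ℝⁿ × U)`. -/
def IsP2Joint (ρ : Measure (Rn n × U)) : Prop :=
  IsProbabilityMeasure ρ ∧ ∫⁻ p, (‖p.1‖ₑ ^ 2 + ‖(p.2 : B)‖ₑ ^ 2) ∂ρ < ∞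

/-- `M₂(ρ) = (∫ (|x|² + ‖u‖²) ρ(dx, du))^{1/2}`. -/
def M2 (ρ : Measure (Rn n × U)) : ℝ :=
  Real.sqrt (∫ p, (‖p.1‖ ^ 2 + ‖(p.2 : B)‖ ^ 2) ∂ρ)

/-- The Fortet-Mourier distance `‖ρ - ρ'‖_{K,FM}` on `𝒫₂(ℝⁿ × U)`, where `K = ℝⁿ × B` carries the
norm `|x| + ‖u‖`. -/
def fmDist (ρ ρ' : Measure (Rn n × U)) : ℝ :=
  sSup {r : ℝ | ∃ f : Rn n × B → ℝ,
    (∀ p q, |f p - f q| ≤ ‖p.1 - q.1‖ + ‖p.2 - q.2‖) ∧ (∀ p, |f p| ≤ 1) ∧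
    r = ∫ p, f (p.1, (p.2 : B)) ∂ρ - ∫ p, f (p.1, (p.2 : B)) ∂ρ'}

/-- Joint continuity on `ℝⁿ × 𝒫₂(ℝⁿ × U) × U`, the middle factor carrying the Fortet-Mourier
metric. -/
def CoefContinuous {Y : Type*} [TopologicalSpace Y]
    (φ : Rn n → Measure (Rn n × U) → U → Y) : Prop :=
  ∀ x ρ u, IsP2Joint ρ → ∀ V ∈ 𝓝 (φ x ρ u), ∃ δ > 0, ∀ x' ρ' u', IsP2Joint ρ' →
    dist x' x < δ → fmDist ρ' ρ < δ → dist u' u < δ → φ x' ρ' u' ∈ V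

end Joint

/-! ### Coefficients and the operators built from them -/

/-- The drift `b`, the diffusion `σ` and the jump coefficient `γ`; they matter only for joint laws
in `𝒫₂(ℝⁿ × U)`. -/
structure Coefficients (n d : ℕ) {B : Type*} [NormedAddCommGroup B] [NormedSpace ℝ B]
    [MeasurableSpace B] [BorelSpace B] (U : Set B) (Z : Type*) where
  b : Rn n → Measure (Rn n × U) → U → Rn n
  σ : Rn n → Measure (Rn n × U) → U → Matrix (Fin n) (Fin d) ℝ
  γ : Rn n → Measure (Rn n × U) → U → Z → Rn n

namespace Coefficients

variable {n d : ℕ} {B : Type*} [NormedAddCommGroup B] [NormedSpace ℝ B] [MeasurableSpace B]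
  [BorelSpace B] {U : Set B} {Z : Type*}

/-- Continuity, measurability in the mark and linear growth of the coefficients (the Frobenius norm
is used for `σ`). -/
structure Regular [MeasurableSpace Z] (C : Coefficients n d U Z) (lam : Measure Z) : Prop where
  continuous_b : CoefContinuous C.b
  continuous_σ : CoefContinuous C.σ
  continuous_γ : ∀ z, CoefContinuous (fun x ρ u => C.γ x ρ u z)
  measurable_γ : ∀ x ρ u, IsP2Joint ρ → Measurable (C.γ x ρ u)
  growth_b : ∃ K : ℝ, ∀ x ρ u, IsP2Joint ρ → ‖C.b x ρ u‖ ≤ K * (1 + ‖x‖ + M2 ρ)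
  growth_σ : ∃ K : ℝ, ∀ x ρ u, IsP2Joint ρ →
    Real.sqrt (∑ i, ∑ j, C.σ x ρ u i j ^ 2) ≤ K * (1 + ‖x‖ + M2 ρ)
  growth_γ : ∀ z, ∃ K : ℝ, ∀ x ρ u, IsP2Joint ρ → ‖C.γ x ρ u z‖ ≤ K * (1 + ‖x‖ + M2 ρ)
  growth_sq_γ : ∃ K : ℝ, ∀ x ρ u, IsP2Joint ρ →
    ∫⁻ z, ‖C.γ x ρ u z‖ₑ ^ 2 ∂lam ≤ ENNReal.ofReal (K * (1 + ‖x‖ ^ 2 + M2 ρ ^ 2))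

/-- `b̂(x, μ, û) = ∫ b(x, μ·û, u) û(x, du)`, with `μ·û(dx, du) = μ(dx) û(x, du)`. -/
def bHat (C : Coefficients n d U Z) (x : Rn n) (μ : Measure (Rn n)) (κ : Kernel (Rn n) U) :
    Rn n :=
  ∫ u, C.b x (μ ⊗ₘ κ) u ∂(κ x)

/-- `σ̂σ̂ᵀ(x, μ, û) = ∫ σσᵀ(x, μ·û, u) û(x, du)`. -/
def aHat (C : Coefficients n d U Z) (x : Rn n) (μ : Measure (Rn n)) (κ : Kernel (Rn n) U) :
    Matrix (Fin n) (Fin n) ℝ :=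
  Matrix.of fun i j =>
    ∫ u, (C.σ x (μ ⊗ₘ κ) u * (C.σ x (μ ⊗ₘ κ) u).transpose) i j ∂(κ x)

/-- `γ̂(x, μ, û, z) = ∫ γ(x, μ·û, u, z) û(x, du)`. -/
def γHat (C : Coefficients n d U Z) (x : Rn n) (μ : Measure (Rn n)) (κ : Kernel (Rn n) U)
    (z : Z) : Rn n :=
  ∫ u, C.γ x (μ ⊗ₘ κ) u z ∂(κ x)

/-- The operator `I^{μ,û,z}`: `g ↦ ∫ g(· + γ(·, μ·û, u, z)) û(·, du)`. -/
def jumpOp (C : Coefficients n d U Z) (μ : Measure (Rn n)) (κ : Kernel (Rn n) U) (z : Z)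
    (g : Rn n → ℝ) (x : Rn n) : ℝ :=
  ∫ u, g (x + C.γ x (μ ⊗ₘ κ) u z) ∂(κ x)

/-- The adjoint `I^{μ,û,z,*}`: the image of `ν·û` under `(x, u) ↦ x + γ(x, μ·û, u, z)`. The duality
`⟨g, I^{μ,û,z,*} ν⟩ = ⟨I^{μ,û,z} g, ν⟩` is `integral_jumpAdj`. -/
def jumpAdj (C : Coefficients n d U Z) (μ : Measure (Rn n)) (κ : Kernel (Rn n) U) (z : Z)
    (ν : Measure (Rn n)) : Measure (Rn n) :=
  (ν ⊗ₘ κ).map (fun p => p.1 + C.γ p.1 (μ ⊗ₘ κ) p.2 z)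

theorem integral_jumpAdj (C : Coefficients n d U Z) (μ ν : Measure (Rn n))
    [IsFiniteMeasure ν] (κ : Kernel (Rn n) U) [IsMarkovKernel κ] (z : Z)
    (hγ : Measurable fun p : Rn n × U => C.γ p.1 (μ ⊗ₘ κ) p.2 z)
    (g : BoundedContinuousFunction (Rn n) ℝ) :
    ∫ y, g y ∂(C.jumpAdj μ κ z ν) = ∫ x, C.jumpOp μ κ z g x ∂ν := by
  have hm : Measurable fun p : Rn n × U => p.1 + C.γ p.1 (μ ⊗ₘ κ) p.2 z :=
    measurable_fst.add hγ
  unfold jumpAdj jumpOp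
  rw [integral_map hm.aemeasurable g.continuous.aestronglyMeasurable]
  refine Measure.integral_compProd (f := fun p : Rn n × U => g (p.1 + C.γ p.1 (μ ⊗ₘ κ) p.2 z)) ?_
  refine Integrable.of_bound
    (g.continuous.measurable.comp hm).aestronglyMeasurable ‖g‖ ?_
  exact Eventually.of_forall fun p => g.norm_coe_le_norm _

/-- The matrix of a linear operator in the standard basis of `ℝⁿ`. -/
def opMatrix (L : Rn n →L[ℝ] Rn n) : Matrix (Fin n) (Fin n) ℝ :=
  Matrix.of fun i j => L (EuclideanSpace.single j 1) i

/-- The second order expression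
`(b̂ - ⟨γ̂, λ⟩)(x, μ, û) · p(x) + ½ tr(σ̂σ̂ᵀ(x, μ, û) H(x))`. -/
def drift [MeasurableSpace Z] (C : Coefficients n d U Z) (lam : Measure Z) (μ : Measure (Rn n))
    (κ : Kernel (Rn n) U) (p : Rn n → Rn n) (H : Rn n → Rn n →L[ℝ] Rn n) (x : Rn n) : ℝ :=
  inner ℝ (C.bHat x μ κ - ∫ z, C.γHat x μ κ z ∂lam) (p x)
    + 1 / 2 * (C.aHat x μ κ * opMatrix (H x)).trace

end Coefficients

/-! ### The Poissonian common noise -/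

section Noise

variable {Ω S Z : Type*} [MeasurableSpace Ω] [MeasurableSpace S] [MeasurableSpace Z]

/-- `N` is a Poisson random measure on `S` with intensity `ν`. -/
structure IsPoissonRandomMeasure (P : Measure Ω) (N : Ω → Measure S) (ν : Measure S) : Prop where
  measurable : ∀ A, MeasurableSet A → Measurable fun ω => N ω A
  counting : ∀ᵐ ω ∂P, ∀ A, MeasurableSet A → ∃ k : ℕ∞, N ω A = (k : ℝ≥0∞)
  law : ∀ A, MeasurableSet A → ν A ≠ ∞ →
    P.map (fun ω => N ω A) = (poissonMeasure (ν A).toNNReal).map (fun k : ℕ => (k : ℝ≥0∞))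
  law_top : ∀ A, MeasurableSet A → ν A = ∞ → ∀ᵐ ω ∂P, N ω A = ∞
  indep : ∀ (k : ℕ) (A : Fin k → Set S), (∀ i, MeasurableSet (A i)) →
    Pairwise (fun i j => Disjoint (A i) (A j)) → iIndepFun (fun i ω => N ω (A i)) P

/-- The filtration `𝔾`: the natural filtration of `N`, completed by the null sets. -/
@[reducible]
def noiseFiltration (P : Measure Ω) (N : Ω → Measure (ℝ × Z)) (s : ℝ) : MeasurableSpace Ω :=
  MeasurableSpace.generateFrom
    ({F | ∃ r ∈ Icc 0 s, ∃ A : Set Z, MeasurableSet A ∧ ∃ V : Set ℝ≥0∞, MeasurableSet V ∧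
        F = (fun ω => N ω (Ioc 0 r ×ˢ A)) ⁻¹' V} ∪ {F | P F = 0})

end Noise

/-! ### Relaxed controls and the stochastic Fokker-Planck equation -/

section FokkerPlanck

variable {n d : ℕ} {B : Type*} [NormedAddCommGroup B] [NormedSpace ℝ B] [MeasurableSpace B]
  [BorelSpace B] {U : Set B} {Z : Type*} [MeasurableSpace Z] {Ω : Type*} [MeasurableSpace Ω]

/-- `α` is a `𝔾`-adapted process on `[t, T]` of transition kernels from `ℝⁿ` to `U`, with
measurable paths. -/
structure IsRelaxedControl (P : Measure Ω) (N : Ω → Measure (ℝ × Z)) (T t : ℝ)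
    (α : ℝ → Ω → Kernel (Rn n) U) : Prop where
  markov : ∀ s ω, IsMarkovKernel (α s ω)
  adapted : ∀ s ∈ Icc t T, ∀ x, Measurable[noiseFiltration P N s] fun ω => α s ω x
  measurable_paths : ∀ᵐ ω ∂P, Measurable fun p : ℝ × Rn n => α p.1 ω p.2

/-- `μ` is a càdlàg `𝔾`-adapted process on `[t, T]` with values in `(𝒫₂(ℝⁿ), W₂)`, and
`μL s` is its left limit `μ_{s-}`. -/
structure IsCadlagFlow (P : Measure Ω) (N : Ω → Measure (ℝ × Z)) (T t : ℝ)
    (μ μL : ℝ → Ω → Measure (Rn n)) : Prop where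
  mem : ∀ᵐ ω ∂P, ∀ s ∈ Icc t T, IsP2 (μ s ω)
  adapted : ∀ s ∈ Icc t T, Measurable[noiseFiltration P N s] (μ s)
  right : ∀ᵐ ω ∂P, ∀ s ∈ Ico t T, Tendsto (fun r => W2 (μ r ω) (μ s ω)) (𝓝[>] s) (𝓝 0)
  left_mem : ∀ᵐ ω ∂P, ∀ s ∈ Ioc t T, IsP2 (μL s ω)
  left : ∀ᵐ ω ∂P, ∀ s ∈ Ioc t T, Tendsto (fun r => W2 (μ r ω) (μL s ω)) (𝓝[<] s) (𝓝 0)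

/-- `αL s` is the left limit `α_{s-}` of the control along the flow: the kernel for which
`μ_{s-}·α_{s-}` is the left limit of the joint laws `μ_r·α_r` as `r ↑ s`, at every time `s` at which
the noise has an atom (the only times that an integral against `N` sees). -/
def IsLeftLimitControl (P : Measure Ω) (N : Ω → Measure (ℝ × Z)) (T t : ℝ) (μ μL : ℝ → Ω → Measure (Rn n))
    (α αL : ℝ → Ω → Kernel (Rn n) U) : Prop :=
  ∀ᵐ ω ∂P, ∀ s ∈ Ioc t T, N ω ({s} ×ˢ univ) ≠ 0 → IsMarkovKernel (αL s ω) ∧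
    Tendsto (fun r => fmDist (μ r ω ⊗ₘ α r ω) (μL s ω ⊗ₘ αL s ω)) (𝓝[<] s) (𝓝 0)

/-- The equation `dμ_s = A₀ μ_s ds + ∫ A₁ μ_{s-} N(ds, dz)` on `[t, T]` in the sense of
distributions, i.e. tested against all `φ ∈ C_c^∞(ℝⁿ)`. -/
def SolvesFokkerPlanck (C : Coefficients n d U Z) (lam : Measure Z) (P : Measure Ω)
    (N : Ω → Measure (ℝ × Z)) (T t : ℝ) (α αL : ℝ → Ω → Kernel (Rn n) U)
    (μ μL : ℝ → Ω → Measure (Rn n)) : Prop :=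
  ∀ᵐ ω ∂P, ∀ φ : Rn n → ℝ, ContDiff ℝ (⊤ : ℕ∞) φ → HasCompactSupport φ → ∀ s ∈ Icc t T,
    ∫ x, φ x ∂(μ s ω) = ∫ x, φ x ∂(μ t ω)
      + (∫ r in t..s, ∫ x, C.drift lam (μ r ω) (α r ω) (∇ φ) (fderiv ℝ (∇ φ)) x ∂(μ r ω))
      + ∫ p in Ioc t s ×ˢ univ,
          (∫ x, (C.jumpOp (μL p.1 ω) (αL p.1 ω) p.2 φ x - φ x) ∂(μL p.1 ω)) ∂(N ω)

end FokkerPlanck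

/-! ### Differentiability on `[0, T] × 𝒫₂(ℝⁿ)` -/

section Smooth

variable {n : ℕ}

/-- `δh` is a linear derivative of `h : 𝒫₂(ℝⁿ) → ℝ`. -/
structure HasLinearDerivative (h : Measure (Rn n) → ℝ) (δh : Measure (Rn n) → Rn n → ℝ) :
    Prop where
  continuous : ∀ m x, IsP2 m → ∀ ε > 0, ∃ δ > 0, ∀ m' x', IsP2 m' →
    W2 m' m < ENNReal.ofReal δ → dist x' x < δ → |δh m' x' - δh m x| < ε
  growth : ∀ R : ℝ, ∃ K : ℝ, ∀ m, IsP2 m → ∫ x, ‖x‖ ^ 2 ∂m ≤ R →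
    ∀ x, |δh m x| ≤ K * (1 + ‖x‖ ^ 2)
  increment : ∀ m m', IsP2 m → IsP2 m' → h m' - h m =
    ∫ l in (0 : ℝ)..1,
      ((∫ x, δh (ENNReal.ofReal (1 - l) • m + ENNReal.ofReal l • m') x ∂m')
        - ∫ x, δh (ENNReal.ofReal (1 - l) • m + ENNReal.ofReal l • m') x ∂m)

/-- Joint continuity on `[0, T] × 𝒫₂(ℝⁿ) × ℝⁿ`, with the metric `W₂` on `𝒫₂(ℝⁿ)`. -/
def JointlyContinuous {Y : Type*} [PseudoMetricSpace Y] (T : ℝ)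
    (F : ℝ → Measure (Rn n) → Rn n → Y) : Prop :=
  ∀ s m x, s ∈ Icc 0 T → IsP2 m → ∀ ε > 0, ∃ δ > 0, ∀ s' m' x', s' ∈ Icc 0 T → IsP2 m' →
    |s' - s| < δ → W2 m' m < ENNReal.ofReal δ → dist x' x < δ →
      dist (F s' m' x') (F s m x) < ε

/-- `J ∈ C^{1;1,1}([0, T] × 𝒫₂(ℝⁿ))`, with time derivative `∂ₜJ = Jt`, linear derivative `δJ`,
L-derivative `∂_μ J = DJ = ∂ₓ δJ` and `∂ₓ∂_μ J = DDJ`. On every `W₂`-bounded set of measures,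
uniformly in time, `DJ` has linear growth and `DDJ` is bounded. -/
structure IsC111 (T : ℝ) (J Jt : ℝ → Measure (Rn n) → ℝ) (δJ : ℝ → Measure (Rn n) → Rn n → ℝ)
    (DJ : ℝ → Measure (Rn n) → Rn n → Rn n)
    (DDJ : ℝ → Measure (Rn n) → Rn n → Rn n →L[ℝ] Rn n) : Prop where
  time_deriv : ∀ s ∈ Icc 0 T, ∀ m, IsP2 m →
    HasDerivWithinAt (fun s => J s m) (Jt s m) (Icc 0 T) s
  linear_deriv : ∀ s ∈ Icc 0 T, HasLinearDerivative (J s) (δJ s)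
  L_deriv : ∀ s ∈ Icc 0 T, ∀ m, IsP2 m → ∀ x, HasGradientAt (δJ s m) (DJ s m x) x
  space_deriv : ∀ s ∈ Icc 0 T, ∀ m, IsP2 m → ∀ x, HasFDerivAt (DJ s m) (DDJ s m x) x
  continuous_Jt : JointlyContinuous T (fun s m _ => Jt s m)
  continuous_DJ : JointlyContinuous T DJ
  continuous_DDJ : JointlyContinuous T DDJ
  growth : ∀ R : ℝ, ∃ K : ℝ, ∀ s ∈ Icc 0 T, ∀ m, IsP2 m → ∫ x, ‖x‖ ^ 2 ∂m ≤ R →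
    ∀ x, ‖DJ s m x‖ ≤ K * (1 + ‖x‖) ∧ ‖DDJ s m x‖ ≤ K

end Smooth

end MFC

end

namespace MFC

/-! ### The Wasserstein distance -/

section Wasserstein

variable {n : ℕ} {m m' : Measure (Rn n)}

/-! The formula is proved path by path. Since `lam` is finite, almost every path of the noise,
restricted to `(0, T] × Z`, is a finite counting measure with at most one atom at each time
(`IsPoissonRandomMeasure.ae_isSimpleCounting`). Everything after that is deterministic.

Between atoms, the weak equation is first extended from test functions to `C²` functions of
quadratic growth, by cutoff and mollification with growth constants that do not depend on the
approximation (`IsQuadC2.exists_approx`, `IsFlow.integral_eq_of_isQuadC2`). At every measure on the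
segment from `m s` to `m s'`, the linear derivative of `J s` is such a function. Hence `J s (m s') -
J s (m s)` is an integral, over the segment and over time, of the generator applied to it. Since
`DJ` and `DDJ` are continuous and quadratic tails are uniformly small near a measure of `𝒫₂`, the
times and measures at which these derivatives are taken may be moved at small cost, uniformly over
all coefficients of a given growth (`IsC111.generator_continuous`). The coefficients, only
measurable in time, are therefore never frozen. Together with the expansion in time this gives the
increment of `J` to the right of `s` up to `ε * (s' - s)` (`IsFlow.chain_rule_right`).

At an atom, the mark need not be a point of `Z`, which carries no topology. However, the law of the
mark takes only the values 0 and 1, so measurable functions of it are almost everywhere constant; by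
continuity of `γ` in `(x, u)` one representative mark serves for all `(x, u)`
(`Coefficients.Regular.exists_ae_slice_γ_eq`). The adjoint image of the left limit is thus a single
measure, and test functions identify it with the value of the flow after the jump
(`IsFokkerPlanckPath.jump_eq`).

Consequently `J` along the flow, minus the two integrals, has right derivative zero on `[t, T)` and
is continuous on `[t, T]`, also across atoms, so it is constant (`IsFlow.ito`). The jump times are
never enumerated.

Measurability along the path is a separate matter, because the coefficients are only Fortet-Mourier
continuous in the joint law. Quantizing the law on finitely many points turns it into a parameter in
a simplex, where Carathéodory functions are jointly measurable (`CoefContinuous.measurable_along`).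
-/

theorem IsP2.integrable_sq (h : IsP2 m) : Integrable (fun x => ‖x‖ ^ 2) m := by
  refine ⟨by fun_prop, ?_⟩
  have : ∀ x : Rn n, ‖‖x‖ ^ 2‖ₑ = ‖x‖ₑ ^ 2 := fun x => by
    rw [enorm_pow, enorm_norm]
  simpa [HasFiniteIntegral, this] using h.2

theorem IsP2.of_integrable [IsProbabilityMeasure m] (h : Integrable (fun x => ‖x‖ ^ 2) m) :
    IsP2 m := by
  refine ⟨inferInstance, ?_⟩
  have := h.2
  simpa [HasFiniteIntegral, enorm_pow] using this

theorem lintegral_sq_eq_ofReal {X : Type*} [MeasurableSpace X] {μ : Measure X} {f : X → Rn n}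
    (h : Integrable (fun x => ‖f x‖ ^ 2) μ) :
    ∫⁻ x, ‖f x‖ₑ ^ 2 ∂μ = ENNReal.ofReal (∫ x, ‖f x‖ ^ 2 ∂μ) := by
  rw [ofReal_integral_eq_lintegral_ofReal h (Eventually.of_forall fun x => by positivity)]
  refine lintegral_congr fun x => ?_
  rw [ENNReal.ofReal_pow (norm_nonneg _), ofReal_norm]

theorem W2_le_of_coupling {π : Measure (Rn n × Rn n)} (h₁ : π.map Prod.fst = m')
    (h₂ : π.map Prod.snd = m) : W2 m' m ≤ (∫⁻ p, ‖p.1 - p.2‖ₑ ^ 2 ∂π) ^ (1 / 2 : ℝ) := by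
  unfold W2
  gcongr
  exact iInf_le_of_le π (iInf_le_of_le h₁ (iInf_le_of_le h₂ le_rfl))

theorem W2_le_ofReal {π : Measure (Rn n × Rn n)} (h₁ : π.map Prod.fst = m')
    (h₂ : π.map Prod.snd = m) {c : ℝ} (hc : ∫⁻ p, ‖p.1 - p.2‖ₑ ^ 2 ∂π ≤ ENNReal.ofReal c) :
    W2 m' m ≤ ENNReal.ofReal (Real.sqrt c) := by
  refine (W2_le_of_coupling h₁ h₂).trans ?_
  rcases le_total 0 c with h0 | h0
  · rw [Real.sqrt_eq_rpow, ← ENNReal.ofReal_rpow_of_nonneg h0 (by norm_num)]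
    gcongr
  · rw [ENNReal.ofReal_of_nonpos h0] at hc
    simp [nonpos_iff_eq_zero.mp hc]

theorem W2_self (m : Measure (Rn n)) : W2 m m = 0 := by
  have h : W2 m m ≤ ENNReal.ofReal (Real.sqrt 0) :=
    W2_le_ofReal (π := m.map fun x => (x, x))
      (by rw [Measure.map_map (by fun_prop) (by fun_prop)]; exact Measure.map_id)
      (by rw [Measure.map_map (by fun_prop) (by fun_prop)]; exact Measure.map_id)
      (by rw [lintegral_map (by fun_prop) (by fun_prop)]; simp)
  simpa using h

theorem W2_comm (m m' : Measure (Rn n)) : W2 m m' = W2 m' m := by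
  have key : ∀ m m' : Measure (Rn n), W2 m m' ≤ W2 m' m := by
    intro m m'
    unfold W2
    refine ENNReal.rpow_le_rpow (le_iInf fun π => le_iInf fun h₁ => le_iInf fun h₂ => ?_)
      (by norm_num)
    refine iInf_le_of_le (π.map Prod.swap) (iInf_le_of_le ?_ (iInf_le_of_le ?_ ?_))
    · rw [Measure.map_map (by fun_prop) (by fun_prop)]; exact h₂
    · rw [Measure.map_map (by fun_prop) (by fun_prop)]; exact h₁
    · rw [lintegral_map (by fun_prop) (by fun_prop)]
      refine le_of_eq (lintegral_congr fun p => ?_)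
      simp [enorm_sub_rev]
  exact le_antisymm (key _ _) (key _ _)

/-- `π` is a coupling of `m'` and `m` with finite quadratic cost. -/
structure IsCoupling (π : Measure (Rn n × Rn n)) (m' m : Measure (Rn n)) : Prop where
  fst : π.map Prod.fst = m'
  snd : π.map Prod.snd = m
  cost : Integrable (fun p => ‖p.1 - p.2‖ ^ 2) π

/-- A strict bound on the infimum is met by some competitor, so optimal couplings are not needed.
The `W₂` estimates below start from such a near-optimal coupling. -/
theorem exists_coupling {δ : ℝ} (h : W2 m' m < ENNReal.ofReal δ) :
    ∃ π, IsCoupling π m' m ∧ ∫ p, ‖p.1 - p.2‖ ^ 2 ∂π ≤ δ ^ 2 := by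
  have hδ : 0 < δ := by
    by_contra hn
    rw [ENNReal.ofReal_of_nonpos (not_lt.mp hn)] at h
    exact not_lt_zero h
  have h' : (⨅ (π : Measure (Rn n × Rn n)) (_ : π.map Prod.fst = m') (_ : π.map Prod.snd = m),
      ∫⁻ p, ‖p.1 - p.2‖ₑ ^ 2 ∂π) < ENNReal.ofReal (δ ^ 2) := by
    have : ENNReal.ofReal δ = ENNReal.ofReal (δ ^ 2) ^ (1 / 2 : ℝ) := by
      rw [ENNReal.ofReal_rpow_of_nonneg (by positivity) (by norm_num), ← Real.sqrt_eq_rpow,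
        Real.sqrt_sq hδ.le]
    rw [this] at h
    exact (ENNReal.rpow_lt_rpow_iff (by norm_num)).mp h
  simp only [iInf_lt_iff] at h'
  obtain ⟨π, h₁, h₂, hπ⟩ := h'
  have hi : Integrable (fun p : Rn n × Rn n => ‖p.1 - p.2‖ ^ 2) π := by
    refine ⟨by fun_prop, ?_⟩
    simp only [HasFiniteIntegral, enorm_pow, enorm_norm]
    exact hπ.trans ENNReal.ofReal_lt_top
  refine ⟨π, ⟨h₁, h₂, hi⟩, ?_⟩
  rw [lintegral_sq_eq_ofReal (f := fun p : Rn n × Rn n => p.1 - p.2) hi] at hπ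
  exact (ENNReal.ofReal_le_ofReal_iff (by positivity)).mp hπ.le

namespace IsCoupling

variable {π : Measure (Rn n × Rn n)}

theorem integrable_fst_iff (h : IsCoupling π m' m) {f : Rn n → ℝ} (hf : Measurable f) :
    Integrable (fun p => f p.1) π ↔ Integrable f m' := by
  rw [← h.fst, integrable_map_measure hf.aestronglyMeasurable (by fun_prop)]; rfl

theorem integrable_snd_iff (h : IsCoupling π m' m) {f : Rn n → ℝ} (hf : Measurable f) :
    Integrable (fun p => f p.2) π ↔ Integrable f m := by
  rw [← h.snd, integrable_map_measure hf.aestronglyMeasurable (by fun_prop)]; rfl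

theorem integral_fst (h : IsCoupling π m' m) {f : Rn n → ℝ} (hf : Measurable f) :
    ∫ p, f p.1 ∂π = ∫ x, f x ∂m' := by
  rw [← h.fst, integral_map (by fun_prop) hf.aestronglyMeasurable]

theorem integral_snd (h : IsCoupling π m' m) {f : Rn n → ℝ} (hf : Measurable f) :
    ∫ p, f p.2 ∂π = ∫ x, f x ∂m := by
  rw [← h.snd, integral_map (by fun_prop) hf.aestronglyMeasurable]

theorem isProbabilityMeasure (h : IsCoupling π m' m) (hm : IsP2 m) : IsProbabilityMeasure π := by
  have := hm.1
  refine ⟨?_⟩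
  have := congrArg (fun ν => ν univ) h.snd
  simpa [Measure.map_apply measurable_snd MeasurableSet.univ] using this

theorem prod (hm' : IsP2 m') (hm : IsP2 m) : IsCoupling (m'.prod m) m' m := by
  have := hm.1
  have := hm'.1
  refine ⟨by simp [Measure.map_fst_prod], by simp [Measure.map_snd_prod], ?_⟩
  have h1 : Integrable (fun p : Rn n × Rn n => 2 * ‖p.1‖ ^ 2 + 2 * ‖p.2‖ ^ 2) (m'.prod m) :=
    ((hm'.integrable_sq.comp_fst m).const_mul 2).add ((hm.integrable_sq.comp_snd m').const_mul 2)
  refine h1.mono' (by fun_prop) (Eventually.of_forall fun p => ?_)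
  rw [Real.norm_of_nonneg (by positivity)]
  nlinarith [norm_sub_le p.1 p.2, norm_nonneg (p.1 - p.2), sq_nonneg (‖p.1‖ - ‖p.2‖),
    norm_nonneg p.1, norm_nonneg p.2]

end IsCoupling

theorem moment_le_of_W2_lt (hm' : IsP2 m') (hm : IsP2 m) {δ : ℝ}
    (h : W2 m' m < ENNReal.ofReal δ) :
    ∫ x, ‖x‖ ^ 2 ∂m' ≤ 2 * ∫ x, ‖x‖ ^ 2 ∂m + 2 * δ ^ 2 := by
  obtain ⟨π, hπ, hc⟩ := exists_coupling h
  have h2 := (hπ.integrable_snd_iff (f := fun x => ‖x‖ ^ 2) (by fun_prop)).2 hm.integrable_sq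
  have h1 := (hπ.integrable_fst_iff (f := fun x => ‖x‖ ^ 2) (by fun_prop)).2 hm'.integrable_sq
  rw [← hπ.integral_fst (f := fun x => ‖x‖ ^ 2) (by fun_prop),
    ← hπ.integral_snd (f := fun x => ‖x‖ ^ 2) (by fun_prop)]
  calc ∫ p, ‖p.1‖ ^ 2 ∂π ≤ ∫ p, (2 * ‖p.2‖ ^ 2 + 2 * ‖p.1 - p.2‖ ^ 2) ∂π := by
        refine integral_mono h1 ((h2.const_mul 2).add (hπ.cost.const_mul 2)) fun p => ?_
        have : ‖p.1‖ ≤ ‖p.2‖ + ‖p.1 - p.2‖ := by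
          have := norm_add_le p.2 (p.1 - p.2); simpa using this
        dsimp only
        nlinarith [sq_nonneg (‖p.2‖ - ‖p.1 - p.2‖), norm_nonneg p.1]
    _ = 2 * ∫ p, ‖p.2‖ ^ 2 ∂π + 2 * ∫ p, ‖p.1 - p.2‖ ^ 2 ∂π := by
        rw [integral_add (h2.const_mul 2) (hπ.cost.const_mul 2), integral_const_mul,
          integral_const_mul]
    _ ≤ _ := by linarith

/-- Quadratic tails are uniformly small near a measure of `𝒫₂`. -/
theorem exists_tail_le (hm : IsP2 m) {η : ℝ} (hη : 0 < η) :
    ∃ ρ : ℝ, ∃ δ > 0, ∀ m', IsP2 m' → W2 m' m < ENNReal.ofReal δ →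
      ∫ x, {x : Rn n | ρ < ‖x‖}.indicator (fun x => 1 + ‖x‖ ^ 2) x ∂m' ≤ η := by
  have hlim : Tendsto (fun k : ℕ => ∫ x, {x : Rn n | (k : ℝ) < ‖x‖}.indicator
      (fun x => ‖x‖ ^ 2) x ∂m) atTop (𝓝 (∫ _, (0 : ℝ) ∂m)) := by
    refine tendsto_integral_of_dominated_convergence (fun x => ‖x‖ ^ 2) (fun k => ?_)
      hm.integrable_sq (fun k => Eventually.of_forall fun x => ?_)
      (Eventually.of_forall fun x => ?_)
    · exact ((by fun_prop : Measurable fun x : Rn n => ‖x‖ ^ 2).indicator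
        (measurableSet_lt measurable_const measurable_norm)).aestronglyMeasurable
    · refine (norm_indicator_le_norm_self _ _).trans ?_
      simp
    · obtain ⟨k₀, hk₀⟩ := exists_nat_ge ‖x‖
      refine tendsto_const_nhds.congr' ?_
      filter_upwards [eventually_ge_atTop k₀] with k hk
      rw [indicator_of_notMem]
      simp only [mem_ofPred_eq, not_lt]
      exact hk₀.trans (by exact_mod_cast hk)
  rw [integral_zero] at hlim
  obtain ⟨k, hk⟩ := (hlim.eventually (gt_mem_nhds (show (0 : ℝ) < η / 16 by positivity))).exists
  -- Let `(x, y)` be a coupled pair with `‖x‖ > 2k + 1`. Either `‖y‖ > k`, or `‖y‖ ≤ k` and then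
  -- `‖x‖ ≤ 2‖x - y‖`. In both cases `1 + ‖x‖²` is at most 8 times the sum of the tail of `‖y‖²`
  -- beyond `k` and of `‖x - y‖²`, and each of these integrates to at most `η / 16`.
  refine ⟨2 * k + 1, Real.sqrt (η / 16), by positivity, fun m' hm' hW => ?_⟩
  obtain ⟨π, hπ, hc⟩ := exists_coupling hW
  rw [Real.sq_sqrt (by positivity)] at hc
  have hmeas : Measurable ({x : Rn n | 2 * (k : ℝ) + 1 < ‖x‖}.indicator
      (fun x => 1 + ‖x‖ ^ 2)) :=
    (by fun_prop : Measurable fun x : Rn n => 1 + ‖x‖ ^ 2).indicator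
      (measurableSet_lt measurable_const measurable_norm)
  have hmeas2 : Measurable ({x : Rn n | (k : ℝ) < ‖x‖}.indicator (fun x => ‖x‖ ^ 2)) :=
    (by fun_prop : Measurable fun x : Rn n => ‖x‖ ^ 2).indicator
      (measurableSet_lt measurable_const measurable_norm)
  have := hm'.1
  have hi1 : Integrable ({x : Rn n | 2 * (k : ℝ) + 1 < ‖x‖}.indicator
      (fun x => 1 + ‖x‖ ^ 2)) m' :=
    ((integrable_const 1).add hm'.integrable_sq).indicator
      (measurableSet_lt measurable_const measurable_norm)
  have hi2 : Integrable ({x : Rn n | (k : ℝ) < ‖x‖}.indicator (fun x => ‖x‖ ^ 2)) m :=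
    hm.integrable_sq.indicator (measurableSet_lt measurable_const measurable_norm)
  have hi1' := (hπ.integrable_fst_iff hmeas).2 hi1
  have hi2' := (hπ.integrable_snd_iff hmeas2).2 hi2
  rw [← hπ.integral_fst hmeas]
  rw [← hπ.integral_snd hmeas2] at hk
  calc _ ≤ ∫ p : Rn n × Rn n, (8 * {x : Rn n | (k : ℝ) < ‖x‖}.indicator
        (fun x => ‖x‖ ^ 2) p.2 + 8 * ‖p.1 - p.2‖ ^ 2) ∂π := by
        refine integral_mono hi1' ((hi2'.const_mul 8).add (hπ.cost.const_mul 8)) fun p => ?_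
        have h1 : ‖p.1‖ ≤ ‖p.2‖ + ‖p.1 - p.2‖ := by
          have := norm_add_le p.2 (p.1 - p.2); simpa using this
        have h0 := norm_nonneg p.2
        have h0' := norm_nonneg (p.1 - p.2)
        have hk0 : (0 : ℝ) ≤ k := Nat.cast_nonneg k
        by_cases hx : 2 * (k : ℝ) + 1 < ‖p.1‖
        · have e1 : {x : Rn n | 2 * (k : ℝ) + 1 < ‖x‖}.indicator
              (fun x => 1 + ‖x‖ ^ 2) p.1 = 1 + ‖p.1‖ ^ 2 := indicator_of_mem (s := {x : Rn n | 2 * (k : ℝ) + 1 < ‖x‖}) hx _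
          dsimp only
          rw [e1]
          by_cases hy : (k : ℝ) < ‖p.2‖
          · have e2 : {x : Rn n | (k : ℝ) < ‖x‖}.indicator
              (fun x => ‖x‖ ^ 2) p.2 = ‖p.2‖ ^ 2 := indicator_of_mem (s := {x : Rn n | (k : ℝ) < ‖x‖}) hy _
            rw [e2]
            nlinarith [sq_nonneg (‖p.2‖ - ‖p.1 - p.2‖)]
          · have e2 : {x : Rn n | (k : ℝ) < ‖x‖}.indicator
              (fun x => ‖x‖ ^ 2) p.2 = 0 := indicator_of_notMem (s := {x : Rn n | (k : ℝ) < ‖x‖}) hy _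
            rw [e2]
            have : ‖p.1‖ ≤ 2 * ‖p.1 - p.2‖ := by linarith [not_lt.mp hy]
            nlinarith
        · have e1 : {x : Rn n | 2 * (k : ℝ) + 1 < ‖x‖}.indicator
              (fun x => 1 + ‖x‖ ^ 2) p.1 = 0 := indicator_of_notMem (s := {x : Rn n | 2 * (k : ℝ) + 1 < ‖x‖}) hx _
          dsimp only
          rw [e1]
          have : 0 ≤ {x : Rn n | (k : ℝ) < ‖x‖}.indicator (fun x => ‖x‖ ^ 2) p.2 :=
            indicator_nonneg (fun x _ => by positivity) _
          positivity
    _ = 8 * ∫ p : Rn n × Rn n, {x : Rn n | (k : ℝ) < ‖x‖}.indicator (fun x => ‖x‖ ^ 2) p.2 ∂π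
        + 8 * ∫ p, ‖p.1 - p.2‖ ^ 2 ∂π := by
        rw [integral_add (hi2'.const_mul 8) (hπ.cost.const_mul 8), integral_const_mul,
          integral_const_mul]
    _ ≤ η := by linarith

/-- The segment from `m` to `m'`. -/
noncomputable def mix (m m' : Measure (Rn n)) (l : ℝ) : Measure (Rn n) :=
  ENNReal.ofReal (1 - l) • m + ENNReal.ofReal l • m'

theorem integrable_mix {f : Rn n → ℝ} {l : ℝ} (h : Integrable f m) (h' : Integrable f m') :
    Integrable f (mix m m' l) :=
  (h.smul_measure ENNReal.ofReal_ne_top).add_measure (h'.smul_measure ENNReal.ofReal_ne_top)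

theorem integral_mix {f : Rn n → ℝ} {l : ℝ} (hl : l ∈ Icc (0 : ℝ) 1) (h : Integrable f m)
    (h' : Integrable f m') :
    ∫ x, f x ∂(mix m m' l) = (1 - l) * ∫ x, f x ∂m + l * ∫ x, f x ∂m' := by
  unfold mix
  rw [integral_add_measure (h.smul_measure ENNReal.ofReal_ne_top)
    (h'.smul_measure ENNReal.ofReal_ne_top), integral_smul_measure, integral_smul_measure,
    ENNReal.toReal_ofReal (by linarith [hl.2]), ENNReal.toReal_ofReal hl.1]
  rfl

theorem isP2_mix (hm : IsP2 m) (hm' : IsP2 m') {l : ℝ} (hl : l ∈ Icc (0 : ℝ) 1) :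
    IsP2 (mix m m' l) := by
  have := hm.1
  have := hm'.1
  have : IsProbabilityMeasure (mix m m' l) := by
    refine ⟨?_⟩
    simp only [mix, Measure.add_apply, Measure.smul_apply, measure_univ, smul_eq_mul, mul_one]
    rw [← ENNReal.ofReal_add (by linarith [hl.2]) hl.1]
    simp
  exact IsP2.of_integrable (integrable_mix hm.integrable_sq hm'.integrable_sq)

/-- The mass common to the two mixtures stays in place, and only the fraction `l' - l` is
transported, along `π`. -/
theorem W2_mix_le {π : Measure (Rn n × Rn n)} (hπ : IsCoupling π m' m) {l l' : ℝ} (hl : 0 ≤ l)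
    (hll : l ≤ l') (hl' : l' ≤ 1) :
    W2 (mix m m' l') (mix m m' l)
      ≤ ENNReal.ofReal (Real.sqrt ((l' - l) * ∫ p, ‖p.1 - p.2‖ ^ 2 ∂π)) := by
  have hd : Measurable fun x : Rn n => (x, x) := by fun_prop
  have e1 : ENNReal.ofReal (1 - l) = ENNReal.ofReal (1 - l') + ENNReal.ofReal (l' - l) := by
    rw [← ENNReal.ofReal_add (by linarith) (by linarith)]; congr 1; ring
  have e2 : ENNReal.ofReal l' = ENNReal.ofReal l + ENNReal.ofReal (l' - l) := by
    rw [← ENNReal.ofReal_add (by linarith) (by linarith)]; congr 1; ring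
  refine W2_le_ofReal (π := ENNReal.ofReal (1 - l') • m.map (fun x => (x, x))
    + ENNReal.ofReal l • m'.map (fun x => (x, x)) + ENNReal.ofReal (l' - l) • π) ?_ ?_ ?_
  · rw [Measure.map_add _ _ measurable_fst, Measure.map_add _ _ measurable_fst, Measure.map_smul,
      Measure.map_smul, Measure.map_smul, hπ.fst, Measure.map_map measurable_fst hd,
      Measure.map_map measurable_fst hd]
    have : (Prod.fst ∘ fun x : Rn n => (x, x)) = id := rfl
    rw [this, Measure.map_id, Measure.map_id, mix, e2, add_smul, add_assoc]
  · rw [Measure.map_add _ _ measurable_snd, Measure.map_add _ _ measurable_snd, Measure.map_smul,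
      Measure.map_smul, Measure.map_smul, hπ.snd, Measure.map_map measurable_snd hd,
      Measure.map_map measurable_snd hd]
    have : (Prod.snd ∘ fun x : Rn n => (x, x)) = id := rfl
    rw [this, Measure.map_id, Measure.map_id, mix, e1, add_smul, add_right_comm]
  · rw [lintegral_add_measure, lintegral_add_measure, lintegral_smul_measure,
      lintegral_smul_measure, lintegral_smul_measure, lintegral_map (by fun_prop) hd,
      lintegral_map (by fun_prop) hd,
      lintegral_sq_eq_ofReal (f := fun p : Rn n × Rn n => p.1 - p.2) hπ.cost]
    simp [ENNReal.ofReal_mul (show 0 ≤ l' - l by linarith)]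

theorem mix_zero : mix m m' 0 = m := by simp [mix]

/-- The coupling gives only `≤ δ`; the factor 2 restores a strict inequality, the form in which
closeness is used later. -/
theorem W2_mix_lt {δ : ℝ} (h : W2 m' m < ENNReal.ofReal δ) {l : ℝ} (hl : l ∈ Icc (0 : ℝ) 1) :
    W2 (mix m m' l) m < ENNReal.ofReal (2 * δ) := by
  obtain ⟨π, hπ, hc⟩ := exists_coupling h
  have hδ : 0 < δ := by
    by_contra hn
    rw [ENNReal.ofReal_of_nonpos (not_lt.mp hn)] at h
    exact not_lt_zero h
  have := W2_mix_le hπ le_rfl hl.1 hl.2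
  rw [mix_zero] at this
  refine this.trans_lt ?_
  rw [ENNReal.ofReal_lt_ofReal_iff (by positivity)]
  have h0 : 0 ≤ ∫ p : Rn n × Rn n, ‖p.1 - p.2‖ ^ 2 ∂π := integral_nonneg fun p => by positivity
  calc _ ≤ Real.sqrt (δ ^ 2) := Real.sqrt_le_sqrt (by nlinarith [hl.1, hl.2])
    _ = δ := Real.sqrt_sq hδ.le
    _ < _ := by linarith

/-- The product coupling suffices, since only finiteness of its cost matters. -/
theorem continuous_mix (hm : IsP2 m) (hm' : IsP2 m') {l : ℝ} (hl : l ∈ Icc (0 : ℝ) 1) :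
    Tendsto (fun l' => W2 (mix m m' l') (mix m m' l)) (𝓝[Icc 0 1] l) (𝓝 0) := by
  set c := ∫ p : Rn n × Rn n, ‖p.1 - p.2‖ ^ 2 ∂(m'.prod m)
  have h : Tendsto (fun l' => ENNReal.ofReal (Real.sqrt (|l' - l| * c))) (𝓝[Icc 0 1] l)
      (𝓝 0) := by
    have : Continuous fun l' => ENNReal.ofReal (Real.sqrt (|l' - l| * c)) :=
      ENNReal.continuous_ofReal.comp (by fun_prop)
    simpa using (this.tendsto l).mono_left nhdsWithin_le_nhds
  refine tendsto_of_tendsto_of_tendsto_of_le_of_le' tendsto_const_nhds h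
    (Eventually.of_forall fun _ => zero_le) ?_
  filter_upwards [self_mem_nhdsWithin] with l' hl'
  rcases le_total l l' with hll | hll
  · rw [abs_of_nonneg (sub_nonneg.2 hll)]
    exact W2_mix_le (IsCoupling.prod hm' hm) hl.1 hll hl'.2
  · rw [W2_comm, abs_sub_comm, abs_of_nonneg (sub_nonneg.2 hll)]
    exact W2_mix_le (IsCoupling.prod hm' hm) hl'.1 hll hl.2

/-- Integrals of Lipschitz functions are Lipschitz for `W₂`. -/
theorem abs_integral_sub_le_of_lipschitz (hm : IsP2 m) {f : Rn n → ℝ} {K δ : ℝ}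
    (hf : ∀ x y, |f x - f y| ≤ K * ‖x - y‖) (hfm : Measurable f) (hi' : Integrable f m')
    (hi : Integrable f m) (h : W2 m' m < ENNReal.ofReal δ) (hK : 0 ≤ K) :
    |∫ x, f x ∂m' - ∫ x, f x ∂m| ≤ K * δ := by
  obtain ⟨π, hπ, hc⟩ := exists_coupling h
  have := hπ.isProbabilityMeasure hm
  have hδ : 0 < δ := by
    by_contra hn
    rw [ENNReal.ofReal_of_nonpos (not_lt.mp hn)] at h
    exact not_lt_zero h
  rw [← hπ.integral_fst hfm, ← hπ.integral_snd hfm,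
    ← integral_sub ((hπ.integrable_fst_iff hfm).2 hi') ((hπ.integrable_snd_iff hfm).2 hi)]
  -- Young's inequality `d ≤ δ/2 + d²/(2δ)` takes the place of Cauchy-Schwarz; its right side
  -- integrates to at most `δ`.
  have hI : Integrable (fun p : Rn n × Rn n => K * (δ / 2 + ‖p.1 - p.2‖ ^ 2 / (2 * δ))) π :=
    ((integrable_const _).add (hπ.cost.div_const _)).const_mul K
  have := norm_integral_le_of_norm_le (μ := π) (f := fun p => f p.1 - f p.2) hI
    (Eventually.of_forall fun p => (hf p.1 p.2).trans (mul_le_mul_of_nonneg_left ?_ hK))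
  · refine this.trans ?_
    rw [integral_const_mul, integral_add (integrable_const _) (hπ.cost.div_const _),
      integral_div (2 * δ)]
    simp only [integral_const, probReal_univ, one_smul]
    refine mul_le_mul_of_nonneg_left ?_ hK
    rw [div_add_div _ _ (by norm_num) (by positivity), div_le_iff₀ (by positivity)]
    nlinarith
  · rw [div_add_div _ _ (by norm_num) (by positivity), le_div_iff₀ (by positivity)]
    nlinarith [sq_nonneg (‖p.1 - p.2‖ - δ)]

end Wasserstein

/-! ### Smooth approximation of functions of quadratic growth -/

section Approximation

variable {n : ℕ}

open scoped Convolution ContDiff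
open ContinuousLinearMap (lsmul)

/-- The derivative is placed on `g`, not on the mollifier. Gradient and Hessian of a mollified
function are then mollifications of the originals and inherit their bounds and limits. -/
theorem hasFDerivAt_normed_convolution {E : Type*} [NormedAddCommGroup E] [NormedSpace ℝ E]
    [CompleteSpace E]
    (χ : ContDiffBump (0 : Rn n)) {g : Rn n → E} {g' : Rn n → Rn n →L[ℝ] E}
    (hg : ∀ x, HasFDerivAt g (g' x) x) (hg' : Continuous g') (hc : HasCompactSupport g)
    (x : Rn n) :
    HasFDerivAt (χ.normed volume ⋆[lsmul ℝ ℝ, volume] g)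
      ((χ.normed volume ⋆[lsmul ℝ ℝ, volume] g') x) x := by
  have e : fderiv ℝ g = g' := funext fun x => (hg x).fderiv
  have hC : ContDiff ℝ 1 g := by
    rw [contDiff_one_iff_fderiv, e]
    exact ⟨fun x => (hg x).differentiableAt, hg'⟩
  have := hc.hasFDerivAt_convolution_right (lsmul ℝ ℝ)
    ((χ.continuous_normed (μ := volume)).locallyIntegrable (μ := volume)) hC x
  rw [e] at this
  exact this

theorem hasGradientAt_normed_convolution (χ : ContDiffBump (0 : Rn n)) {g : Rn n → ℝ}
    {p : Rn n → Rn n} (hg : ∀ x, HasGradientAt g (p x) x) (hp : Continuous p)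
    (hc : HasCompactSupport g) (x : Rn n) :
    HasGradientAt (χ.normed volume ⋆[lsmul ℝ ℝ, volume] g)
      ((χ.normed volume ⋆[lsmul ℝ ℝ, volume] p) x) x := by
  rw [hasGradientAt_iff_hasFDerivAt]
  have hp' : Continuous fun x => InnerProductSpace.toDual ℝ (Rn n) (p x) :=
    (InnerProductSpace.toDual ℝ (Rn n)).continuous.comp hp
  have h := hasFDerivAt_normed_convolution χ
    (fun x => (hasGradientAt_iff_hasFDerivAt.mp (hg x))) hp' hc x
  suffices key : InnerProductSpace.toDual ℝ (Rn n) ((χ.normed volume ⋆[lsmul ℝ ℝ, volume] p) x) =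
      (χ.normed volume ⋆[lsmul ℝ ℝ, volume]
        fun x => InnerProductSpace.toDual ℝ (Rn n) (p x)) x by
    rw [key]
    exact h
  ext v
  have i1 : Integrable fun t => χ.normed volume t • p (x - t) :=
    (χ.continuous_normed.smul (hp.comp (by fun_prop))).integrable_of_hasCompactSupport
      χ.hasCompactSupport_normed.smul_right
  have i2 : Integrable fun t => χ.normed volume t •
      (InnerProductSpace.toDual ℝ (Rn n) (p (x - t))) :=
    (χ.continuous_normed.smul (hp'.comp (by fun_prop : Continuous fun t => x - t)
      )).integrable_of_hasCompactSupport χ.hasCompactSupport_normed.smul_right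
  simp only [convolution_def, ContinuousLinearMap.lsmul_apply]
  rw [ContinuousLinearMap.integral_apply i2, InnerProductSpace.toDual_apply_apply,
    real_inner_comm, ← integral_inner i1]
  refine integral_congr_ae (Eventually.of_forall fun t => ?_)
  simp [inner_smul_right, real_inner_comm]

/-- The mollifier averages over a ball of radius at most 1, hence the enlargement of the radius by
1. -/
theorem norm_normed_convolution_le {E : Type*} [NormedAddCommGroup E] [NormedSpace ℝ E]
    [CompleteSpace E] [SecondCountableTopology E]
    (χ : ContDiffBump (0 : Rn n)) (hχ : χ.rOut ≤ 1) {g : Rn n → E} (hg : Continuous g)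
    (x : Rn n) {c : ℝ} (hc : 0 ≤ c) (h : ∀ y, ‖y‖ ≤ ‖x‖ + 1 → ‖g y‖ ≤ c) :
    ‖(χ.normed volume ⋆[lsmul ℝ ℝ, volume] g) x‖ ≤ c := by
  rw [← dist_zero_right]
  refine dist_convolution_le (R := χ.rOut) hc χ.support_normed_eq.subset χ.nonneg_normed
    χ.integral_normed hg.aestronglyMeasurable fun y hy => ?_
  rw [dist_zero_right]
  refine h y ?_
  have h1 := norm_add_le x (y - x)
  have h2 : ‖y - x‖ < χ.rOut := by simpa [dist_eq_norm] using hy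
  have h3 : x + (y - x) = y := by abel
  rw [h3] at h1
  linarith

/-- `ψ` is `C²` with gradient `p` and Hessian `H`, with at most quadratic growth. -/
structure IsQuadC2 (ψ : Rn n → ℝ) (p : Rn n → Rn n) (H : Rn n → Rn n →L[ℝ] Rn n) (K : ℝ) :
    Prop where
  grad : ∀ x, HasGradientAt ψ (p x) x
  deriv : ∀ x, HasFDerivAt p (H x) x
  cont : Continuous H
  bound : ∀ x, |ψ x| ≤ K * (1 + ‖x‖ ^ 2)
  bound_grad : ∀ x, ‖p x‖ ≤ K * (1 + ‖x‖)
  bound_deriv : ∀ x, ‖H x‖ ≤ K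

namespace IsQuadC2

variable {ψ : Rn n → ℝ} {p : Rn n → Rn n} {H : Rn n → Rn n →L[ℝ] Rn n} {K : ℝ}

theorem continuous_grad (h : IsQuadC2 ψ p H K) : Continuous p :=
  continuous_iff_continuousAt.2 fun x => (h.deriv x).continuousAt

theorem continuous (h : IsQuadC2 ψ p H K) : Continuous ψ :=
  continuous_iff_continuousAt.2 fun x =>
    (hasGradientAt_iff_hasFDerivAt.mp (h.grad x)).continuousAt

theorem nonneg (h : IsQuadC2 ψ p H K) : 0 ≤ K := (norm_nonneg _).trans (h.bound_deriv 0)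

theorem integrable (h : IsQuadC2 ψ p H K) {m : Measure (Rn n)} (hm : IsP2 m) :
    Integrable ψ m := by
  have := hm.1
  exact (((integrable_const 1).add hm.integrable_sq).const_mul K).mono'
    h.continuous.aestronglyMeasurable (Eventually.of_forall h.bound)

/-- Mollification. -/
theorem convolution (h : IsQuadC2 ψ p H K) (hc : HasCompactSupport ψ)
    (χ : ContDiffBump (0 : Rn n)) (hχ : χ.rOut ≤ 1) :
    ContDiff ℝ ∞ (χ.normed volume ⋆[lsmul ℝ ℝ, volume] ψ) ∧
    HasCompactSupport (χ.normed volume ⋆[lsmul ℝ ℝ, volume] ψ) ∧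
    IsQuadC2 (χ.normed volume ⋆[lsmul ℝ ℝ, volume] ψ) (χ.normed volume ⋆[lsmul ℝ ℝ, volume] p)
      (χ.normed volume ⋆[lsmul ℝ ℝ, volume] H) (3 * K) := by
  have hK := h.nonneg
  have hcp : HasCompactSupport p := by
    have : p = fun x => (InnerProductSpace.toDual ℝ (Rn n)).symm (fderiv ℝ ψ x) := by
      funext x
      rw [(hasGradientAt_iff_hasFDerivAt.mp (h.grad x)).fderiv]
      simp
    rw [this]
    exact (hc.fderiv (𝕜 := ℝ)).comp_left (g := (InnerProductSpace.toDual ℝ (Rn n)).symm)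
      (by simp)
  have hcH : HasCompactSupport H := by
    have : H = fderiv ℝ p := funext fun x => (h.deriv x).fderiv.symm
    rw [this]
    exact hcp.fderiv (𝕜 := ℝ)
  refine ⟨?_, ?_, fun x => hasGradientAt_normed_convolution χ h.grad h.continuous_grad hc x,
    fun x => hasFDerivAt_normed_convolution χ h.deriv h.cont hcp x, ?_, fun x => ?_, fun x => ?_,
    fun x => ?_⟩
  · exact χ.hasCompactSupport_normed.contDiff_convolution_left (lsmul ℝ ℝ) χ.contDiff_normed
      h.continuous.locallyIntegrable
  · exact χ.hasCompactSupport_normed.convolution (lsmul ℝ ℝ) hc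
  · refine hcH.continuous_convolution_right (lsmul ℝ ℝ)
      ((χ.continuous_normed (μ := volume)).locallyIntegrable (μ := volume)) h.cont
  -- The factor 3 absorbs the shift of the radius: `1 + (‖x‖ + 1)² ≤ 3 (1 + ‖x‖²)`.
  · refine norm_normed_convolution_le χ hχ h.continuous x (by positivity) fun y hy => (h.bound y).trans ?_
    have h0 := norm_nonneg y
    rw [mul_comm 3 K, mul_assoc]
    refine mul_le_mul_of_nonneg_left ?_ hK
    nlinarith [sq_nonneg (‖x‖ - 1), norm_nonneg x]
  · refine norm_normed_convolution_le χ hχ h.continuous_grad x (by positivity) fun y hy => (h.bound_grad y).trans ?_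
    rw [mul_comm 3 K, mul_assoc]
    refine mul_le_mul_of_nonneg_left ?_ hK
    linarith [norm_nonneg x]
  · refine norm_normed_convolution_le χ hχ h.cont x (by positivity) fun y hy => (h.bound_deriv y).trans ?_
    linarith

end IsQuadC2

end Approximation

/-! ### Cutoff at growing radii and the approximation of functions of quadratic growth -/

section Cutoff

variable {n : ℕ}

open scoped ContDiff

theorem hasFDerivAt_comp_smul {E : Type*} [NormedAddCommGroup E] [NormedSpace ℝ E]
    {g : Rn n → E} {g' : Rn n → Rn n →L[ℝ] E} (h : ∀ x, HasFDerivAt g (g' x) x) (c : ℝ)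
    (x : Rn n) : HasFDerivAt (fun x => g (c • x)) (c • g' (c • x)) x := by
  have h2 : HasFDerivAt (fun x : Rn n => c • x) (c • ContinuousLinearMap.id ℝ (Rn n)) x :=
    (hasFDerivAt_id x).const_smul c
  refine ((h (c • x)).comp x h2).congr_fderiv ?_
  ext v
  simp

theorem hasGradientAt_comp_smul {g : Rn n → ℝ} {p : Rn n → Rn n}
    (h : ∀ x, HasGradientAt g (p x) x) (c : ℝ) (x : Rn n) :
    HasGradientAt (fun x => g (c • x)) (c • p (c • x)) x := by
  rw [hasGradientAt_iff_hasFDerivAt]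
  refine (hasFDerivAt_comp_smul (fun x => hasGradientAt_iff_hasFDerivAt.mp (h x)) c
    x).congr_fderiv ?_
  simp

/-- A cutoff function which is `1` on the ball of radius `r`, with weighted `C²` bounds. -/
structure IsCutoff (C r : ℝ) (χ : Rn n → ℝ) (p : Rn n → Rn n) (H : Rn n → Rn n →L[ℝ] Rn n) :
    Prop where
  grad : ∀ x, HasGradientAt χ (p x) x
  deriv : ∀ x, HasFDerivAt p (H x) x
  cont : Continuous H
  compact : HasCompactSupport χ
  bound : ∀ x, |χ x| ≤ 1
  bound_grad : ∀ x, ‖p x‖ * (1 + ‖x‖) ≤ C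
  bound_deriv : ∀ x, ‖H x‖ * (1 + ‖x‖ ^ 2) ≤ C
  eq_one : ∀ x, ‖x‖ < r → χ x = 1

theorem IsCutoff.grad_eq_zero {C r : ℝ} {χ : Rn n → ℝ} {p : Rn n → Rn n}
    {H : Rn n → Rn n →L[ℝ] Rn n} (h : IsCutoff C r χ p H) {x : Rn n} (hx : ‖x‖ < r) :
    p x = 0 := by
  have : HasGradientAt χ (0 : Rn n) x := by
    refine HasGradientAt.congr_of_eventuallyEq (hasGradientAt_const x (1 : ℝ)) ?_
    filter_upwards [(isOpen_lt continuous_norm continuous_const).mem_nhds hx] with z hz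
      using h.eq_one z hz
  exact (h.grad x).unique this

theorem IsCutoff.deriv_eq_zero {C r : ℝ} {χ : Rn n → ℝ} {p : Rn n → Rn n}
    {H : Rn n → Rn n →L[ℝ] Rn n} (h : IsCutoff C r χ p H) {x : Rn n} (hx : ‖x‖ < r) :
    H x = 0 := by
  have : HasFDerivAt p (0 : Rn n →L[ℝ] Rn n) x := by
    refine HasFDerivAt.congr_of_eventuallyEq (hasFDerivAt_const (0 : Rn n) x) ?_
    filter_upwards [(isOpen_lt continuous_norm continuous_const).mem_nhds hx] with z hz
      using h.grad_eq_zero hz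
  exact (h.deriv x).unique this

/-- Scaling by `r` gains `r⁻¹` in the gradient and `r⁻²` in the Hessian, which pays for the weights
`1 + ‖x‖` and `1 + ‖x‖²`. Thus `C` does not depend on `r ≥ 1`. -/
theorem IsCutoff.comp_smul {C : ℝ} {χ : Rn n → ℝ} {p : Rn n → Rn n}
    {H : Rn n → Rn n →L[ℝ] Rn n} (h : IsCutoff C 1 χ p H) {r : ℝ} (hr : 1 ≤ r) :
    IsCutoff C r (fun x => χ (r⁻¹ • x)) (fun x => r⁻¹ • p (r⁻¹ • x))
      (fun x => r⁻¹ • (r⁻¹ • H (r⁻¹ • x))) := by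
  have r0 : 0 < r := by linarith
  have c0 : 0 < r⁻¹ := by positivity
  have c1 : r⁻¹ ≤ 1 := inv_le_one_of_one_le₀ hr
  refine ⟨fun x => hasGradientAt_comp_smul h.grad _ x,
    fun x => (hasFDerivAt_comp_smul h.deriv _ x).const_smul r⁻¹, ?_, ?_, fun x => h.bound _,
    fun x => ?_, fun x => ?_, fun x hx => h.eq_one _ ?_⟩
  · have := h.cont
    fun_prop
  · exact h.compact.comp_homeomorph (Homeomorph.smulOfNeZero r⁻¹ c0.ne')
  · refine le_trans ?_ (h.bound_grad (r⁻¹ • x))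
    rw [norm_smul, norm_smul, Real.norm_of_nonneg c0.le]
    nlinarith [mul_nonneg (norm_nonneg (p (r⁻¹ • x))) (sub_nonneg.2 c1)]
  · refine le_trans ?_ (h.bound_deriv (r⁻¹ • x))
    rw [norm_smul, norm_smul, norm_smul, Real.norm_of_nonneg c0.le]
    have : r⁻¹ ^ 2 ≤ 1 := pow_le_one₀ c0.le c1
    nlinarith [mul_nonneg (norm_nonneg (H (r⁻¹ • x))) (sub_nonneg.2 this)]
  · rw [norm_smul, Real.norm_of_nonneg c0.le, inv_mul_lt_iff₀ r0]
    linarith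

theorem exists_smooth_bump (n : ℕ) : ∃ b : Rn n → ℝ, ContDiff ℝ ∞ b ∧ HasCompactSupport b ∧
    (∀ x, |b x| ≤ 1) ∧ ∀ x, ‖x‖ < 1 → b x = 1 := by
  let b : ContDiffBump (0 : Rn n) := ⟨1, 2, by norm_num, by norm_num⟩
  refine ⟨fun x => b x, b.contDiff, b.hasCompactSupport, fun x => ?_, fun x hx =>
    b.one_of_mem_closedBall ?_⟩
  · rw [abs_of_nonneg b.nonneg]
    exact b.le_one
  · rw [mem_closedBall_zero_iff]
    exact hx.le

theorem contDiff_gradient {b : Rn n → ℝ} (hb : ContDiff ℝ ∞ b) : ContDiff ℝ ∞ (∇ b) :=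
  ((InnerProductSpace.toDual ℝ (Rn n)).symm.toContinuousLinearEquiv.contDiff).comp
    (contDiff_infty_iff_fderiv.mp hb).2

theorem hasCompactSupport_gradient {b : Rn n → ℝ} (hb : HasCompactSupport b) :
    HasCompactSupport (∇ b) :=
  (hb.fderiv (𝕜 := ℝ)).comp_left (g := (InnerProductSpace.toDual ℝ (Rn n)).symm) (by simp)

theorem exists_norm_mul_le {E : Type*} [NormedAddCommGroup E] [NormedSpace ℝ E] {g : Rn n → E}
    (hg : Continuous g) (hc : HasCompactSupport g) {w : Rn n → ℝ} (hw : Continuous w) :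
    ∃ C, ∀ x, ‖g x‖ * w x ≤ C := by
  obtain ⟨C, hC⟩ := (show HasCompactSupport fun y => w y • g y from
    hc.smul_left).exists_bound_of_continuous (by fun_prop)
  refine ⟨C, fun x => le_trans ?_ (hC x)⟩
  rw [norm_smul, mul_comm]
  gcongr
  exact le_abs_self _

theorem exists_isCutoff (n : ℕ) : ∃ (C : ℝ) (χ : Rn n → ℝ) (p : Rn n → Rn n)
    (H : Rn n → Rn n →L[ℝ] Rn n), IsCutoff C 1 χ p H := by
  obtain ⟨b, hb, cb, hb1, hb2⟩ := exists_smooth_bump n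
  have hg := contDiff_gradient hb
  have hH : Continuous (fderiv ℝ (∇ b)) := (contDiff_infty_iff_fderiv.mp hg).2.continuous
  have cg := hasCompactSupport_gradient cb
  obtain ⟨C₁, hC₁⟩ := exists_norm_mul_le hg.continuous cg (w := fun x => 1 + ‖x‖) (by fun_prop)
  obtain ⟨C₂, hC₂⟩ := exists_norm_mul_le hH (cg.fderiv (𝕜 := ℝ)) (w := fun x => 1 + ‖x‖ ^ 2)
    (by fun_prop)
  exact ⟨max C₁ C₂, b, ∇ b, fderiv ℝ (∇ b),
    fun x => (hb.differentiable (by simp) x).hasGradientAt,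
    fun x => (hg.differentiable (by simp) x).hasFDerivAt, hH, cb, hb1,
    fun x => le_max_of_le_left (hC₁ x), fun x => le_max_of_le_right (hC₂ x), hb2⟩

/-- In the product rule every derivative falling on the cutoff carries exactly the decay that
compensates the growth of `ψ` or `p`. The new constant involves the cutoff only through `C`, so it
is uniform in the radius. -/
theorem IsQuadC2.cutoff {ψ : Rn n → ℝ} {p : Rn n → Rn n} {H : Rn n → Rn n →L[ℝ] Rn n} {K : ℝ}
    (h : IsQuadC2 ψ p H K) {C r : ℝ} {χ : Rn n → ℝ} {q : Rn n → Rn n}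
    {G : Rn n → Rn n →L[ℝ] Rn n} (hχ : IsCutoff C r χ q G) :
    IsQuadC2 (fun x => χ x * ψ x) (fun x => χ x • p x + ψ x • q x)
      (fun x => χ x • H x + (InnerProductSpace.toDual ℝ (Rn n) (q x)).smulRight (p x)
        + (ψ x • G x + (InnerProductSpace.toDual ℝ (Rn n) (p x)).smulRight (q x)))
      (K * (1 + 4 * C)) := by
  have hK := h.nonneg
  have hC : 0 ≤ C := le_trans (by positivity) (hχ.bound_grad 0)
  have hψ := h.continuous
  have hp := h.continuous_grad
  have hχc : Continuous χ := continuous_iff_continuousAt.2 fun x =>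
    (hasGradientAt_iff_hasFDerivAt.mp (hχ.grad x)).continuousAt
  have hq : Continuous q := continuous_iff_continuousAt.2 fun x => (hχ.deriv x).continuousAt
  have dψ := fun x => hasGradientAt_iff_hasFDerivAt.mp (h.grad x)
  have dχ := fun x => hasGradientAt_iff_hasFDerivAt.mp (hχ.grad x)
  have hHc := h.cont
  have hGc := hχ.cont
  refine ⟨fun x => ?_, fun x => ?_, ?_, fun x => ?_, fun x => ?_, fun x => ?_⟩
  · rw [hasGradientAt_iff_hasFDerivAt]
    refine ((dχ x).mul (dψ x)).congr_fderiv ?_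
    simp
  · exact ((dχ x).smul (h.deriv x)).add ((dψ x).smul (hχ.deriv x))
  · have e1 : Continuous fun x => (InnerProductSpace.toDual ℝ (Rn n) (q x)).smulRight (p x) := by
      refine continuous_clm_apply.2 fun v => ?_
      simp only [ContinuousLinearMap.smulRight_apply, InnerProductSpace.toDual_apply_apply]
      fun_prop
    have e2 : Continuous fun x => (InnerProductSpace.toDual ℝ (Rn n) (p x)).smulRight (q x) := by
      refine continuous_clm_apply.2 fun v => ?_
      simp only [ContinuousLinearMap.smulRight_apply, InnerProductSpace.toDual_apply_apply]
      fun_prop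
    exact ((hχc.smul hHc).add e1).add ((hψ.smul hGc).add e2)
  · have h1 := h.bound x
    have h2 := hχ.bound x
    rw [abs_mul]
    calc |χ x| * |ψ x| ≤ 1 * (K * (1 + ‖x‖ ^ 2)) := by gcongr
      _ ≤ _ := by
        have : 0 ≤ K * C * (1 + ‖x‖ ^ 2) := by positivity
        nlinarith
  · have h1 := h.bound x
    have h2 := hχ.bound x
    have h3 := hχ.bound_grad x
    have h4 := h.bound_grad x
    have e1 : ‖χ x • p x‖ ≤ K * (1 + ‖x‖) := by
      rw [norm_smul, Real.norm_eq_abs]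
      calc |χ x| * ‖p x‖ ≤ 1 * (K * (1 + ‖x‖)) := by gcongr
        _ = _ := one_mul _
    have e2 : ‖ψ x • q x‖ ≤ K * C * (1 + ‖x‖) := by
      rw [norm_smul, Real.norm_eq_abs]
      calc |ψ x| * ‖q x‖ ≤ (K * (1 + ‖x‖ ^ 2)) * ‖q x‖ := by gcongr
        _ ≤ (K * (1 + ‖x‖) ^ 2) * ‖q x‖ := by
          gcongr
          nlinarith [norm_nonneg x]
        _ = K * (1 + ‖x‖) * (‖q x‖ * (1 + ‖x‖)) := by ring
        _ ≤ K * (1 + ‖x‖) * C := by gcongr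
        _ = _ := by ring
    have : 0 ≤ K * C * (1 + ‖x‖) := by positivity
    calc _ ≤ ‖χ x • p x‖ + ‖ψ x • q x‖ := norm_add_le _ _
      _ ≤ _ := by nlinarith
  · have h1 := h.bound x
    have h2 := hχ.bound x
    have h3 := hχ.bound_grad x
    have h4 := h.bound_grad x
    have h5 := hχ.bound_deriv x
    have h6 := h.bound_deriv x
    have e1 : ‖χ x • H x‖ ≤ K := by
      rw [norm_smul, Real.norm_eq_abs]
      calc |χ x| * ‖H x‖ ≤ 1 * K := by gcongr
        _ = _ := one_mul _
    have e2 : ‖p x‖ * ‖q x‖ ≤ K * C := by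
      calc ‖p x‖ * ‖q x‖ ≤ (K * (1 + ‖x‖)) * ‖q x‖ := by gcongr
        _ = K * (‖q x‖ * (1 + ‖x‖)) := by ring
        _ ≤ K * C := by gcongr
    have e3 : ‖ψ x • G x‖ ≤ K * C := by
      rw [norm_smul, Real.norm_eq_abs]
      calc |ψ x| * ‖G x‖ ≤ (K * (1 + ‖x‖ ^ 2)) * ‖G x‖ := by gcongr
        _ = K * (‖G x‖ * (1 + ‖x‖ ^ 2)) := by ring
        _ ≤ K * C := by gcongr
    have e4 : ‖(InnerProductSpace.toDual ℝ (Rn n) (q x)).smulRight (p x)‖ ≤ K * C := by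
      rw [ContinuousLinearMap.norm_smulRight_apply, LinearIsometryEquiv.norm_map, mul_comm]
      exact e2
    have e5 : ‖(InnerProductSpace.toDual ℝ (Rn n) (p x)).smulRight (q x)‖ ≤ K * C := by
      rw [ContinuousLinearMap.norm_smulRight_apply, LinearIsometryEquiv.norm_map]
      exact e2
    have : 0 ≤ K * C := by positivity
    refine (norm_add_le _ _).trans ?_
    refine (add_le_add (norm_add_le _ _) (norm_add_le _ _)).trans ?_
    nlinarith

open scoped Convolution
open ContinuousLinearMap (lsmul)

/-- The mollified function may change with `k`: near a fixed `x` it agrees with `f` as soon as `k`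
exceeds `‖x‖ + 1`. This allows cutoff and mollification to be done simultaneously. -/
theorem tendsto_normed_convolution {E : Type*} [NormedAddCommGroup E] [NormedSpace ℝ E]
    [CompleteSpace E] [SecondCountableTopology E] {χ : ℕ → ContDiffBump (0 : Rn n)}
    (hχ : Tendsto (fun k => (χ k).rOut) atTop (𝓝 0)) {g : ℕ → Rn n → E} {f : Rn n → E}
    (hg : ∀ k, Continuous (g k)) (hf : Continuous f)
    (hgf : ∀ k : ℕ, ∀ x, ‖x‖ < k → g k x = f x) (x : Rn n) :
    Tendsto (fun k => ((χ k).normed volume ⋆[lsmul ℝ ℝ, volume] g k) x) atTop (𝓝 (f x)) := by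
  refine ContDiffBump.convolution_tendsto_right hχ
    (Eventually.of_forall fun k => (hg k).aestronglyMeasurable) ?_ tendsto_const_nhds
  have h1 : Tendsto (fun q : ℕ × Rn n => f q.2) (atTop ×ˢ 𝓝 x) (𝓝 (f x)) :=
    (hf.tendsto x).comp tendsto_snd
  refine h1.congr' ?_
  obtain ⟨k₀, hk₀⟩ := exists_nat_gt (‖x‖ + 1)
  have hN : {y : Rn n | ‖y‖ < ‖x‖ + 1} ∈ 𝓝 x :=
    (isOpen_lt continuous_norm continuous_const).mem_nhds (by simp)
  filter_upwards [prod_mem_prod (eventually_ge_atTop k₀) hN] with q hq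
  refine (hgf q.1 q.2 ?_).symm
  have h2 : (k₀ : ℝ) ≤ q.1 := by exact_mod_cast hq.1
  have h3 : ‖q.2‖ < ‖x‖ + 1 := hq.2
  linarith

/-- Approximation by test functions in `C²`, with uniform growth bounds. -/
theorem IsQuadC2.exists_approx {ψ : Rn n → ℝ} {p : Rn n → Rn n} {H : Rn n → Rn n →L[ℝ] Rn n}
    {K : ℝ} (h : IsQuadC2 ψ p H K) : ∃ (K' : ℝ) (φ : ℕ → Rn n → ℝ), (∀ k, ContDiff ℝ ∞ (φ k) ∧
      HasCompactSupport (φ k) ∧ IsQuadC2 (φ k) (∇ (φ k)) (fderiv ℝ (∇ (φ k))) K') ∧ ∀ x,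
      Tendsto (fun k => φ k x) atTop (𝓝 (ψ x)) ∧ Tendsto (fun k => ∇ (φ k) x) atTop (𝓝 (p x)) ∧
      Tendsto (fun k => fderiv ℝ (∇ (φ k)) x) atTop (𝓝 (H x)) := by
  obtain ⟨C, χ, q, G, hχ⟩ := exists_isCutoff n
  -- The radius is `k + 1` because the scaling bound needs a radius of at least 1.
  have hcut := fun k : ℕ => hχ.comp_smul (r := (k : ℝ) + 1) (by
    linarith [Nat.cast_nonneg (α := ℝ) k])
  have hq := fun k : ℕ => h.cutoff (hcut k)
  have hcs : ∀ k : ℕ, HasCompactSupport fun x => χ (((k : ℝ) + 1)⁻¹ • x) * ψ x :=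
    fun k => (hcut k).compact.mul_right
  set ρ : ℕ → ContDiffBump (0 : Rn n) := fun k =>
    ⟨((k : ℝ) + 1)⁻¹ / 2, ((k : ℝ) + 1)⁻¹, by positivity, half_lt_self (by positivity)⟩ with hρ
  have hρ1 : ∀ k, (ρ k).rOut ≤ 1 := fun k =>
    inv_le_one_of_one_le₀ (by linarith [Nat.cast_nonneg (α := ℝ) k])
  have hρ0 : Tendsto (fun k => (ρ k).rOut) atTop (𝓝 0) := by
    simpa [hρ, one_div] using tendsto_one_div_add_atTop_nhds_zero_nat (𝕜 := ℝ)
  have hconv := fun k => (hq k).convolution (hcs k) (ρ k) (hρ1 k)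
  -- Both sides are filled in by unification: these equations identify the gradient and the Hessian
  -- of the mollified functions with the mollified gradient and Hessian.
  have hgr : ∀ k, _ = _ := fun k => funext fun x => ((hconv k).2.2.grad x).gradient
  have hfd : ∀ k, _ = _ := fun k => funext fun x => ((hconv k).2.2.deriv x).fderiv
  refine ⟨3 * (K * (1 + 4 * C)), fun k => (ρ k).normed volume ⋆[lsmul ℝ ℝ, volume]
    fun x => χ (((k : ℝ) + 1)⁻¹ • x) * ψ x, fun k => ⟨(hconv k).1, (hconv k).2.1, ?_⟩,
    fun x => ⟨?_, ?_, ?_⟩⟩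
  · rw [hgr k, hfd k]
    exact (hconv k).2.2
  · refine tendsto_normed_convolution hρ0 (fun k => (hq k).continuous) h.continuous
      (fun k x hx => ?_) x
    simp [(hcut k).eq_one x (by linarith)]
  · simp only [hgr]
    refine tendsto_normed_convolution hρ0 (fun k => (hq k).continuous_grad) h.continuous_grad
      (fun k x hx => ?_) x
    have hx' : ‖x‖ < (k : ℝ) + 1 := by linarith
    have e1 := (hcut k).eq_one x hx'
    have e2 := (hcut k).grad_eq_zero hx'
    beta_reduce at e1 e2 ⊢
    rw [e1, e2]
    simp
  · simp only [hgr, hfd]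
    refine tendsto_normed_convolution hρ0 (fun k => (hq k).cont) h.cont
      (fun k x hx => ?_) x
    have hx' : ‖x‖ < (k : ℝ) + 1 := by linarith
    have e1 := (hcut k).eq_one x hx'
    have e2 := (hcut k).grad_eq_zero hx'
    have e3 := (hcut k).deriv_eq_zero hx'
    beta_reduce at e1 e2 e3 ⊢
    rw [e1, e2, e3]
    ext v
    simp

end Cutoff

/-! ### Smooth compactly supported functions determine finite measures -/

section Uniqueness

variable {n : ℕ}

open scoped Convolution ContDiff
open ContinuousLinearMap (lsmul)

/-- Finite measures are determined by test functions. -/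
theorem ext_of_forall_integral_contDiff {m m' : Measure (Rn n)} [IsFiniteMeasure m]
    [IsFiniteMeasure m']
    (h : ∀ φ : Rn n → ℝ, ContDiff ℝ ∞ φ → HasCompactSupport φ → ∫ x, φ x ∂m = ∫ x, φ x ∂m') :
    m = m' := by
  refine Measure.ext_of_integral_eq_on_compactlySupported fun f => ?_
  obtain ⟨C, hC⟩ := f.hasCompactSupport.exists_bound_of_continuous f.continuous
  have hC0 : 0 ≤ C := (norm_nonneg _).trans (hC 0)
  set ρ : ℕ → ContDiffBump (0 : Rn n) := fun k =>
    ⟨((k : ℝ) + 1)⁻¹ / 2, ((k : ℝ) + 1)⁻¹, by positivity, half_lt_self (by positivity)⟩ with hρ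
  have hρ1 : ∀ k, (ρ k).rOut ≤ 1 := fun k =>
    inv_le_one_of_one_le₀ (by linarith [Nat.cast_nonneg (α := ℝ) k])
  have hρ0 : Tendsto (fun k => (ρ k).rOut) atTop (𝓝 0) := by
    simpa [hρ, one_div] using tendsto_one_div_add_atTop_nhds_zero_nat (𝕜 := ℝ)
  set g : ℕ → Rn n → ℝ := fun k => (ρ k).normed volume ⋆[lsmul ℝ ℝ, volume] f
  have hg1 : ∀ k, ContDiff ℝ ∞ (g k) := fun k =>
    (ρ k).hasCompactSupport_normed.contDiff_convolution_left (lsmul ℝ ℝ) (ρ k).contDiff_normed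
      f.continuous.locallyIntegrable
  have hg2 : ∀ k, HasCompactSupport (g k) := fun k =>
    (ρ k).hasCompactSupport_normed.convolution (lsmul ℝ ℝ) f.hasCompactSupport
  have hlim : ∀ (ν : Measure (Rn n)) [IsFiniteMeasure ν],
      Tendsto (fun k => ∫ x, g k x ∂ν) atTop (𝓝 (∫ x, f x ∂ν)) := by
    intro ν _
    refine tendsto_integral_of_dominated_convergence (fun _ => C)
      (fun k => (hg1 k).continuous.aestronglyMeasurable) (integrable_const C)
      (fun k => Eventually.of_forall fun x => ?_) (Eventually.of_forall fun x => ?_)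
    · exact norm_normed_convolution_le (ρ k) (hρ1 k) f.continuous x hC0 fun y _ => hC y
    · exact tendsto_normed_convolution hρ0 (fun _ => f.continuous) f.continuous
        (fun _ _ _ => rfl) x
  refine tendsto_nhds_unique (hlim m) ((hlim m').congr fun k => ?_)
  exact (h (g k) (hg1 k) (hg2 k)).symm

end Uniqueness

/-! ### Second order operators -/

section SecondOrder

variable {n : ℕ}

/-- The second order expression `β · p + ½ tr(a H)`. -/
noncomputable def secondOrder (β : Rn n → Rn n) (a : Rn n → Matrix (Fin n) (Fin n) ℝ)
    (p : Rn n → Rn n) (H : Rn n → Rn n →L[ℝ] Rn n) (x : Rn n) : ℝ :=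
  inner ℝ (β x) (p x) + 1 / 2 * (a x * Coefficients.opMatrix (H x)).trace

theorem trace_mul_opMatrix (a : Matrix (Fin n) (Fin n) ℝ) (L : Rn n →L[ℝ] Rn n) :
    (a * Coefficients.opMatrix L).trace
      = ∑ i, ∑ j, a i j * L (EuclideanSpace.single i 1) j := by
  simp [Matrix.trace, Matrix.mul_apply, Coefficients.opMatrix]

theorem secondOrder_eq (β : Rn n → Rn n) (a : Rn n → Matrix (Fin n) (Fin n) ℝ)
    (p : Rn n → Rn n) (H : Rn n → Rn n →L[ℝ] Rn n) (x : Rn n) :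
    secondOrder β a p H x = inner ℝ (β x) (p x)
      + 1 / 2 * ∑ i, ∑ j, a x i j * H x (EuclideanSpace.single i 1) j := by
  rw [secondOrder, trace_mul_opMatrix]

/-- Linearity in the test function with the coefficients held fixed; this is why comparing
generators requires no continuity of `β` and `a`. -/
theorem secondOrder_sub (β : Rn n → Rn n) (a : Rn n → Matrix (Fin n) (Fin n) ℝ)
    (p p' : Rn n → Rn n) (H H' : Rn n → Rn n →L[ℝ] Rn n) (x : Rn n) :
    secondOrder β a p H x - secondOrder β a p' H' x
      = secondOrder β a (p - p') (H - H') x := by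
  simp only [secondOrder_eq, Pi.sub_apply, inner_sub_right, _root_.sub_apply,
    PiLp.sub_apply, mul_sub, Finset.sum_sub_distrib]
  ring

/-- Linear growth of the first order and quadratic growth of the second order coefficient. -/
structure CoefGrowth (β : Rn n → Rn n) (a : Rn n → Matrix (Fin n) (Fin n) ℝ) (K : ℝ) : Prop where
  meas_β : Measurable β
  meas_a : ∀ i j, Measurable fun x => a x i j
  growth_β : ∀ x, ‖β x‖ ≤ K * (1 + ‖x‖)
  growth_a : ∀ x i j, |a x i j| ≤ K * (1 + ‖x‖ ^ 2)

variable {β : Rn n → Rn n} {a : Rn n → Matrix (Fin n) (Fin n) ℝ} {K : ℝ}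

theorem CoefGrowth.nonneg (h : CoefGrowth β a K) : 0 ≤ K := by
  have := (norm_nonneg _).trans (h.growth_β 0)
  simpa using this

theorem CoefGrowth.measurable_secondOrder (h : CoefGrowth β a K) {p : Rn n → Rn n}
    {H : Rn n → Rn n →L[ℝ] Rn n} (hp : Continuous p) (hH : Continuous H) :
    Measurable (secondOrder β a p H) := by
  have e : secondOrder β a p H = fun x => inner ℝ (β x) (p x)
      + 1 / 2 * ∑ i, ∑ j, a x i j * H x (EuclideanSpace.single i 1) j :=
    funext fun x => secondOrder_eq β a p H x
  rw [e]
  refine (h.meas_β.inner hp.measurable).add (Measurable.const_mul ?_ _)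
  refine Finset.measurable_sum _ fun i _ => Finset.measurable_sum _ fun j _ => ?_
  refine (h.meas_a i j).mul (Continuous.measurable ?_)
  fun_prop

/-- The 2 comes from `(1 + ‖x‖)² ≤ 2 (1 + ‖x‖²)` in the drift term, and `n²` counts the matrix
entries in the trace. -/
theorem CoefGrowth.abs_secondOrder_le (h : CoefGrowth β a K) {p : Rn n → Rn n}
    {H : Rn n → Rn n →L[ℝ] Rn n} {x : Rn n} {c : ℝ} (hp : ‖p x‖ ≤ c * (1 + ‖x‖))
    (hH : ‖H x‖ ≤ c) :
    |secondOrder β a p H x| ≤ K * c * (2 + (n : ℝ) ^ 2) * (1 + ‖x‖ ^ 2) := by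
  have hK := h.nonneg
  have hc : 0 ≤ c := (norm_nonneg _).trans hH
  rw [secondOrder_eq]
  have e1 : |inner ℝ (β x) (p x)| ≤ K * c * (2 * (1 + ‖x‖ ^ 2)) := by
    calc |inner ℝ (β x) (p x)| ≤ ‖β x‖ * ‖p x‖ := abs_real_inner_le_norm _ _
      _ ≤ (K * (1 + ‖x‖)) * (c * (1 + ‖x‖)) := by
        gcongr
        exact h.growth_β x
      _ = K * c * (1 + ‖x‖) ^ 2 := by ring
      _ ≤ _ := by
        gcongr
        nlinarith [sq_nonneg (‖x‖ - 1)]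
  have e2 : |∑ i, ∑ j, a x i j * H x (EuclideanSpace.single i 1) j|
      ≤ (n : ℝ) ^ 2 * (K * (1 + ‖x‖ ^ 2) * c) := by
    calc _ ≤ ∑ i, ∑ j, |a x i j * H x (EuclideanSpace.single i 1) j| :=
          (Finset.abs_sum_le_sum_abs _ _).trans
            (Finset.sum_le_sum fun i _ => Finset.abs_sum_le_sum_abs _ _)
      _ ≤ ∑ _i : Fin n, ∑ _j : Fin n, K * (1 + ‖x‖ ^ 2) * c := by
        refine Finset.sum_le_sum fun i _ => Finset.sum_le_sum fun j _ => ?_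
        rw [abs_mul]
        have h1 : |H x (EuclideanSpace.single i 1) j| ≤ c := by
          calc |H x (EuclideanSpace.single i 1) j| ≤ ‖H x (EuclideanSpace.single i 1)‖ :=
                PiLp.norm_apply_le (H x (EuclideanSpace.single i 1)) j
            _ ≤ ‖H x‖ * ‖(EuclideanSpace.single i 1 : Rn n)‖ := (H x).le_opNorm _
            _ ≤ c := by simpa using hH
        have h2 := h.growth_a x i j
        gcongr
      _ = _ := by
        simp [Finset.sum_const]
        ring
  calc _ ≤ |inner ℝ (β x) (p x)|
        + |1 / 2 * ∑ i, ∑ j, a x i j * H x (EuclideanSpace.single i 1) j| := abs_add_le _ _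
    _ ≤ K * c * (2 * (1 + ‖x‖ ^ 2)) + (n : ℝ) ^ 2 * (K * (1 + ‖x‖ ^ 2) * c) := by
      refine add_le_add e1 ?_
      rw [abs_mul, abs_of_nonneg (by norm_num : (0 : ℝ) ≤ 1 / 2)]
      have : 0 ≤ (n : ℝ) ^ 2 * (K * (1 + ‖x‖ ^ 2) * c) := by positivity
      linarith
    _ = _ := by ring

theorem CoefGrowth.integrable_secondOrder (h : CoefGrowth β a K) {p : Rn n → Rn n}
    {H : Rn n → Rn n →L[ℝ] Rn n} (hpc : Continuous p) (hHc : Continuous H) {c : ℝ}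
    (hp : ∀ x, ‖p x‖ ≤ c * (1 + ‖x‖)) (hH : ∀ x, ‖H x‖ ≤ c) {m : Measure (Rn n)} (hm : IsP2 m) :
    Integrable (secondOrder β a p H) m := by
  have := hm.1
  exact (((integrable_const 1).add hm.integrable_sq).const_mul _).mono'
    (h.measurable_secondOrder hpc hHc).aestronglyMeasurable
    (Eventually.of_forall fun x => h.abs_secondOrder_le (hp x) (hH x))

theorem CoefGrowth.abs_integral_secondOrder_le (h : CoefGrowth β a K) {p : Rn n → Rn n}
    {H : Rn n → Rn n →L[ℝ] Rn n} {c : ℝ}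
    (hp : ∀ x, ‖p x‖ ≤ c * (1 + ‖x‖)) (hH : ∀ x, ‖H x‖ ≤ c) {m : Measure (Rn n)} (hm : IsP2 m)
    {R : ℝ} (hR : ∫ x, ‖x‖ ^ 2 ∂m ≤ R) :
    |∫ x, secondOrder β a p H x ∂m| ≤ K * c * (2 + (n : ℝ) ^ 2) * (1 + R) := by
  have := hm.1
  have hc : 0 ≤ c := (norm_nonneg _).trans (hH 0)
  have hK := h.nonneg
  have i1 : Integrable (fun x : Rn n => 1 + ‖x‖ ^ 2) m :=
    (integrable_const 1).add hm.integrable_sq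
  refine (norm_integral_le_of_norm_le (f := secondOrder β a p H) (i1.const_mul (K * c * (2 + (n : ℝ) ^ 2)))
    (Eventually.of_forall fun x => h.abs_secondOrder_le (hp x) (hH x))).trans ?_
  rw [integral_const_mul, integral_add (integrable_const 1) hm.integrable_sq]
  simp only [integral_const, probReal_univ, one_smul]
  gcongr

/-- A flow of measures with measurable coefficients of at most linear growth. -/
structure IsFlow (m : Kernel ℝ (Rn n)) (β : ℝ → Rn n → Rn n)
    (a : ℝ → Rn n → Matrix (Fin n) (Fin n) ℝ) (R K : ℝ) : Prop where
  p2 : ∀ r, IsP2 (m r)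
  moment : ∀ r, ∫ x, ‖x‖ ^ 2 ∂(m r) ≤ R
  meas_β : Measurable fun q : ℝ × Rn n => β q.1 q.2
  meas_a : ∀ i j, Measurable fun q : ℝ × Rn n => a q.1 q.2 i j
  growth_β : ∀ r x, ‖β r x‖ ≤ K * (1 + ‖x‖)
  growth_a : ∀ r x i j, |a r x i j| ≤ K * (1 + ‖x‖ ^ 2)
  right : ∀ s, Tendsto (fun r => W2 (m r) (m s)) (𝓝[>] s) (𝓝 0)

namespace IsFlow

variable {m : Kernel ℝ (Rn n)} {β : ℝ → Rn n → Rn n}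
  {a : ℝ → Rn n → Matrix (Fin n) (Fin n) ℝ} {R : ℝ}

theorem coefGrowth (h : IsFlow m β a R K) (r : ℝ) : CoefGrowth (β r) (a r) K :=
  ⟨h.meas_β.comp (by fun_prop : Measurable fun x : Rn n => (r, x)),
    fun i j => (h.meas_a i j).comp (by fun_prop : Measurable fun x : Rn n => (r, x)),
    h.growth_β r, h.growth_a r⟩

theorem isMarkovKernel (h : IsFlow m β a R K) : IsMarkovKernel m := ⟨fun r => (h.p2 r).1⟩

theorem measurable_integral_secondOrder (h : IsFlow m β a R K) {p : ℝ → Rn n → Rn n}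
    {H : ℝ → Rn n → Rn n →L[ℝ] Rn n} (hp : Measurable fun q : ℝ × Rn n => p q.1 q.2)
    (hH : Measurable fun q : ℝ × Rn n => H q.1 q.2) :
    Measurable fun r => ∫ x, secondOrder (β r) (a r) (p r) (H r) x ∂(m r) := by
  have := h.isMarkovKernel
  refine (StronglyMeasurable.integral_kernel_prod_right (κ := m)
    (f := fun r x => secondOrder (β r) (a r) (p r) (H r) x) ?_).measurable
  refine Measurable.stronglyMeasurable ?_
  simp only [Function.uncurry_def, secondOrder_eq]
  refine (h.meas_β.inner hp).add (Measurable.const_mul ?_ _)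
  refine Finset.measurable_sum _ fun i _ => Finset.measurable_sum _ fun j _ => ?_
  refine (h.meas_a i j).mul ?_
  have : Continuous fun L : Rn n →L[ℝ] Rn n => L (EuclideanSpace.single i 1) j := by fun_prop
  exact this.measurable.comp hH

/-- The weak equation extends from test functions to `C²` functions of quadratic growth. -/
theorem integral_eq_of_isQuadC2 (h : IsFlow m β a R K) {s s' : ℝ}
    (heq : ∀ φ : Rn n → ℝ, ContDiff ℝ (⊤ : ℕ∞) φ → HasCompactSupport φ →
      ∫ x, φ x ∂(m s') = ∫ x, φ x ∂(m s)
        + ∫ r in s..s', ∫ x, secondOrder (β r) (a r) (∇ φ) (fderiv ℝ (∇ φ)) x ∂(m r))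
    {ψ : Rn n → ℝ} {p : Rn n → Rn n} {H : Rn n → Rn n →L[ℝ] Rn n} {c : ℝ}
    (hψ : IsQuadC2 ψ p H c) :
    ∫ x, ψ x ∂(m s') = ∫ x, ψ x ∂(m s)
        + ∫ r in s..s', ∫ x, secondOrder (β r) (a r) p H x ∂(m r) := by
  obtain ⟨c', φ, hφ, hlim⟩ := hψ.exists_approx
  have l1 : ∀ r, Tendsto (fun k => ∫ x, φ k x ∂(m r)) atTop (𝓝 (∫ x, ψ x ∂(m r))) := by
    intro r
    have := (h.p2 r).1
    exact tendsto_integral_of_dominated_convergence (fun x => c' * (1 + ‖x‖ ^ 2))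
      (fun k => (hφ k).2.2.continuous.aestronglyMeasurable)
      (((integrable_const 1).add (h.p2 r).integrable_sq).const_mul _)
      (fun k => Eventually.of_forall fun x => (hφ k).2.2.bound x)
      (Eventually.of_forall fun x => (hlim x).1)
  have l2 : ∀ r, Tendsto (fun k => ∫ x, secondOrder (β r) (a r) (∇ (φ k))
      (fderiv ℝ (∇ (φ k))) x ∂(m r)) atTop (𝓝 (∫ x, secondOrder (β r) (a r) p H x ∂(m r))) := by
    intro r
    have := (h.p2 r).1
    refine tendsto_integral_of_dominated_convergence
      (fun x => K * c' * (2 + (n : ℝ) ^ 2) * (1 + ‖x‖ ^ 2))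
      (fun k => ((h.coefGrowth r).measurable_secondOrder (hφ k).2.2.continuous_grad
        (hφ k).2.2.cont).aestronglyMeasurable)
      (((integrable_const 1).add (h.p2 r).integrable_sq).const_mul _)
      (fun k => Eventually.of_forall fun x => (h.coefGrowth r).abs_secondOrder_le
        ((hφ k).2.2.bound_grad x) ((hφ k).2.2.bound_deriv x))
      (Eventually.of_forall fun x => ?_)
    simp only [secondOrder_eq]
    refine (tendsto_const_nhds.inner (hlim x).2.1).add (Tendsto.const_mul _ ?_)
    refine tendsto_finsetSum _ fun i _ => tendsto_finsetSum _ fun j _ => Tendsto.const_mul _ ?_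
    have : Continuous fun L : Rn n →L[ℝ] Rn n => L (EuclideanSpace.single i 1) j := by fun_prop
    exact (this.tendsto _).comp (hlim x).2.2
  have l3 : Tendsto (fun k => ∫ r in s..s', ∫ x, secondOrder (β r) (a r) (∇ (φ k))
      (fderiv ℝ (∇ (φ k))) x ∂(m r)) atTop
      (𝓝 (∫ r in s..s', ∫ x, secondOrder (β r) (a r) p H x ∂(m r))) := by
    -- The dominating function is constant in time: `R` bounds the second moments at all times and
    -- `c'` does not depend on `k`.
    refine intervalIntegral.tendsto_integral_filter_of_dominated_convergence
      (fun _ => K * c' * (2 + (n : ℝ) ^ 2) * (1 + R)) (Eventually.of_forall fun k => ?_)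
      (Eventually.of_forall fun k => Eventually.of_forall fun r _ => ?_)
      intervalIntegrable_const (Eventually.of_forall fun r _ => l2 r)
    · exact (h.measurable_integral_secondOrder (p := fun _ => ∇ (φ k))
        (H := fun _ => fderiv ℝ (∇ (φ k)))
        ((hφ k).2.2.continuous_grad.measurable.comp measurable_snd)
        ((hφ k).2.2.cont.measurable.comp measurable_snd)).aestronglyMeasurable
    · exact (h.coefGrowth r).abs_integral_secondOrder_le (hφ k).2.2.bound_grad
        (hφ k).2.2.bound_deriv (h.p2 r) (h.moment r)
  refine tendsto_nhds_unique (l1 s') (((l1 s).add l3).congr fun k => ?_)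
  exact (heq (φ k) (hφ k).1 (hφ k).2.1).symm

end IsFlow

end SecondOrder

/-! ### The chain rule between jumps -/

section ChainRule

variable {n : ℕ} {T : ℝ}

theorem JointlyContinuous.continuous {Y : Type*} [PseudoMetricSpace Y]
    {F : ℝ → Measure (Rn n) → Rn n → Y} (hF : JointlyContinuous T F) {s : ℝ} (hs : s ∈ Icc 0 T)
    {m : Measure (Rn n)} (hm : IsP2 m) : Continuous (F s m) := by
  rw [Metric.continuous_iff]
  intro x ε hε
  obtain ⟨δ, hδ, h⟩ := hF s m x hs hm ε hε
  refine ⟨δ, hδ, fun y hy => h s m y hs hm (by simpa using hδ) ?_ hy⟩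
  rw [W2_self]
  exact ENNReal.ofReal_pos.2 hδ

/-- Joint continuity is uniform over compact sets in the space variable. -/
theorem JointlyContinuous.uniform {Y : Type*} [PseudoMetricSpace Y]
    {F : ℝ → Measure (Rn n) → Rn n → Y} (hF : JointlyContinuous T F) {s : ℝ} (hs : s ∈ Icc 0 T)
    {m : Measure (Rn n)} (hm : IsP2 m) {S : Set (Rn n)} (hS : IsCompact S) {ε : ℝ} (hε : 0 < ε) :
    ∃ δ > 0, ∀ x ∈ S, ∀ s' m', s' ∈ Icc 0 T → IsP2 m' → |s' - s| < δ →
      W2 m' m < ENNReal.ofReal δ → dist (F s' m' x) (F s m x) < ε := by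
  refine hS.induction_on (p := fun S => ∃ δ > 0, ∀ x ∈ S, ∀ s' m', s' ∈ Icc 0 T → IsP2 m' →
    |s' - s| < δ → W2 m' m < ENNReal.ofReal δ → dist (F s' m' x) (F s m x) < ε)
    ⟨1, one_pos, by simp⟩ ?_ ?_ ?_
  · rintro S₁ S₂ hsub ⟨δ, hδ, h⟩
    exact ⟨δ, hδ, fun x hx => h x (hsub hx)⟩
  · rintro S₁ S₂ ⟨δ₁, hδ₁, h₁⟩ ⟨δ₂, hδ₂, h₂⟩
    refine ⟨min δ₁ δ₂, lt_min hδ₁ hδ₂, fun x hx s' m' hs' hm' hd hW => ?_⟩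
    rcases hx with hx | hx
    · exact h₁ x hx s' m' hs' hm' (hd.trans_le (min_le_left _ _))
        (hW.trans_le (ENNReal.ofReal_le_ofReal (min_le_left _ _)))
    · exact h₂ x hx s' m' hs' hm' (hd.trans_le (min_le_right _ _))
        (hW.trans_le (ENNReal.ofReal_le_ofReal (min_le_right _ _)))
  · intro x _
    obtain ⟨δ, hδ, h⟩ := hF s m x hs hm (ε / 2) (half_pos hε)
    refine ⟨Metric.ball x δ, mem_nhdsWithin_of_mem_nhds (Metric.ball_mem_nhds x hδ), δ, hδ,
      fun y hy s' m' hs' hm' hd hW => ?_⟩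
    have h1 := h s' m' y hs' hm' hd hW hy
    have h2 := h s m y hs hm (by simpa using hδ)
      (by rw [W2_self]; exact ENNReal.ofReal_pos.2 hδ) hy
    rw [dist_comm] at h2
    have h3 := dist_triangle (F s' m' y) (F s m x) (F s m y)
    linarith

variable {J Jt : ℝ → Measure (Rn n) → ℝ} {δJ : ℝ → Measure (Rn n) → Rn n → ℝ}
  {DJ : ℝ → Measure (Rn n) → Rn n → Rn n} {DDJ : ℝ → Measure (Rn n) → Rn n → Rn n →L[ℝ] Rn n}

/-- The constant depends on the time `s`, because the growth of the linear derivative is assumed for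
each time separately. It is uniform over measures of bounded second moment, hence along segments,
and it is used only at a fixed `s`. -/
theorem IsC111.isQuadC2 (hJ : IsC111 T J Jt δJ DJ DDJ) (R : ℝ) {s : ℝ} (hs : s ∈ Icc 0 T) :
    ∃ c, ∀ m, IsP2 m → ∫ x, ‖x‖ ^ 2 ∂m ≤ R →
      IsQuadC2 (δJ s m) (DJ s m) (DDJ s m) c := by
  obtain ⟨K₁, h₁⟩ := (hJ.linear_deriv s hs).growth R
  obtain ⟨K₂, h₂⟩ := hJ.growth R
  refine ⟨max K₁ K₂, fun m hm hR => ⟨hJ.L_deriv s hs m hm, hJ.space_deriv s hs m hm,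
    hJ.continuous_DDJ.continuous hs hm, fun x => (h₁ m hm hR x).trans ?_,
    fun x => (h₂ s hs m hm hR x).1.trans ?_, fun x => (h₂ s hs m hm hR x).2.trans
      (le_max_right _ _)⟩⟩
  · gcongr
    exact le_max_left _ _
  · gcongr
    exact le_max_right _ _

/-- Mean value inequality on a centred ball containing both points. -/
theorem IsQuadC2.abs_sub_le {ψ : Rn n → ℝ} {p : Rn n → Rn n} {H : Rn n → Rn n →L[ℝ] Rn n} {c : ℝ}
    (h : IsQuadC2 ψ p H c) (x y : Rn n) :
    |ψ x - ψ y| ≤ c * (1 + ‖x‖ + ‖y‖) * ‖x - y‖ := by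
  have hc := h.nonneg
  refine Convex.norm_image_sub_le_of_norm_hasFDerivWithin_le (𝕜 := ℝ)
    (s := Metric.closedBall 0 (max ‖x‖ ‖y‖)) (f' := fun z => InnerProductSpace.toDual ℝ (Rn n) (p z))
    (fun z _ => (hasGradientAt_iff_hasFDerivAt.mp (h.grad z)).hasFDerivWithinAt)
    (fun z hz => ?_) (convex_closedBall _ _) (by simp) (by simp)
  rw [LinearIsometryEquiv.norm_map]
  refine (h.bound_grad z).trans ?_
  have hz' : ‖z‖ ≤ max ‖x‖ ‖y‖ := by simpa using hz
  have : max ‖x‖ ‖y‖ ≤ ‖x‖ + ‖y‖ :=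
    max_le (by linarith [norm_nonneg y]) (by linarith [norm_nonneg x])
  refine mul_le_mul_of_nonneg_left ?_ hc
  linarith

theorem IsQuadC2.abs_integral_sub_le {ψ : Rn n → ℝ} {p : Rn n → Rn n}
    {H : Rn n → Rn n →L[ℝ] Rn n} {c : ℝ} (h : IsQuadC2 ψ p H c) {m m' : Measure (Rn n)}
    (hm : IsP2 m) (hm' : IsP2 m') {R δ : ℝ} (hδ : 0 < δ) (hR : ∫ x, ‖x‖ ^ 2 ∂m ≤ R)
    (hR' : ∫ x, ‖x‖ ^ 2 ∂m' ≤ R) (hW : W2 m' m < ENNReal.ofReal δ) :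
    |∫ x, ψ x ∂m' - ∫ x, ψ x ∂m| ≤ c * (4 + 6 * R) * δ := by
  obtain ⟨π, hπ, hcost⟩ := exists_coupling hW
  have := hπ.isProbabilityMeasure hm
  have hc := h.nonneg
  have hψ := h.continuous.measurable
  have h2 := (hπ.integrable_snd_iff (f := fun x => ‖x‖ ^ 2) (by fun_prop)).2 hm.integrable_sq
  have h1 := (hπ.integrable_fst_iff (f := fun x => ‖x‖ ^ 2) (by fun_prop)).2 hm'.integrable_sq
  rw [← hπ.integral_fst hψ, ← hπ.integral_snd hψ,
    ← integral_sub ((hπ.integrable_fst_iff hψ).2 (h.integrable hm'))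
      ((hπ.integrable_snd_iff hψ).2 (h.integrable hm))]
  rw [← hπ.integral_fst (f := fun x => ‖x‖ ^ 2) (by fun_prop)] at hR'
  rw [← hπ.integral_snd (f := fun x => ‖x‖ ^ 2) (by fun_prop)] at hR
  have h12 : Integrable (fun q : Rn n × Rn n => ‖q.1‖ ^ 2 + ‖q.2‖ ^ 2) π := h1.add h2
  have i1 : Integrable (fun q : Rn n × Rn n => 3 * δ * (1 + (‖q.1‖ ^ 2 + ‖q.2‖ ^ 2))) π :=
    ((integrable_const 1).add h12).const_mul (3 * δ)
  have i2 : Integrable (fun q : Rn n × Rn n => ‖q.1 - q.2‖ ^ 2 / δ) π := hπ.cost.div_const δ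
  refine (norm_integral_le_of_norm_le (f := fun q : Rn n × Rn n => ψ q.1 - ψ q.2)
    ((i1.add i2).const_mul c) (Eventually.of_forall fun q => ?_)).trans ?_
  · refine (h.abs_sub_le q.1 q.2).trans ?_
    rw [mul_assoc]
    refine mul_le_mul_of_nonneg_left ?_ hc
    -- Young's inequality weighted by `δ`. The first term integrates to at most `3δ(1 + 2R)` and the
    -- second to at most `δ`, which together give `(4 + 6R) δ`.
    have e : (1 + ‖q.1‖ + ‖q.2‖) * ‖q.1 - q.2‖
        ≤ δ * (1 + ‖q.1‖ + ‖q.2‖) ^ 2 + ‖q.1 - q.2‖ ^ 2 / δ := by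
      rw [← sub_nonneg]
      have : δ * (1 + ‖q.1‖ + ‖q.2‖) ^ 2 + ‖q.1 - q.2‖ ^ 2 / δ
          - (1 + ‖q.1‖ + ‖q.2‖) * ‖q.1 - q.2‖
          = ((δ * (1 + ‖q.1‖ + ‖q.2‖) - ‖q.1 - q.2‖) ^ 2
            + δ * (1 + ‖q.1‖ + ‖q.2‖) * ‖q.1 - q.2‖) / δ := by
        field_simp
        ring
      rw [this]
      positivity
    have e' : (1 + ‖q.1‖ + ‖q.2‖) ^ 2 ≤ 3 * (1 + (‖q.1‖ ^ 2 + ‖q.2‖ ^ 2)) := by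
      nlinarith [sq_nonneg (‖q.1‖ - 1), sq_nonneg (‖q.2‖ - 1), sq_nonneg (‖q.1‖ - ‖q.2‖)]
    calc _ ≤ _ := e
      _ ≤ δ * (3 * (1 + (‖q.1‖ ^ 2 + ‖q.2‖ ^ 2))) + ‖q.1 - q.2‖ ^ 2 / δ := by gcongr
      _ = 3 * δ * (1 + (‖q.1‖ ^ 2 + ‖q.2‖ ^ 2)) + ‖q.1 - q.2‖ ^ 2 / δ := by ring
  · simp only [Pi.add_apply]
    rw [integral_const_mul, integral_add i1 i2, integral_const_mul,
      integral_add (integrable_const 1) h12, integral_add h1 h2, integral_div, mul_assoc c (4 + 6 * R)]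
    simp only [integral_const, probReal_univ, one_smul]
    refine mul_le_mul_of_nonneg_left ?_ hc
    have : (∫ q : Rn n × Rn n, ‖q.1 - q.2‖ ^ 2 ∂π) / δ ≤ δ := by
      rw [div_le_iff₀ hδ]
      nlinarith
    nlinarith

theorem moment_mix_le {m m' : Measure (Rn n)} (hm : IsP2 m) (hm' : IsP2 m') {R l : ℝ}
    (hl : l ∈ Icc (0 : ℝ) 1) (hR : ∫ x, ‖x‖ ^ 2 ∂m ≤ R) (hR' : ∫ x, ‖x‖ ^ 2 ∂m' ≤ R) :
    ∫ x, ‖x‖ ^ 2 ∂(mix m m' l) ≤ R := by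
  rw [integral_mix hl hm.integrable_sq hm'.integrable_sq]
  nlinarith [hl.1, hl.2]

theorem IsC111.increment (hJ : IsC111 T J Jt δJ DJ DDJ) {s : ℝ} (hs : s ∈ Icc 0 T)
    {m m' : Measure (Rn n)} (hm : IsP2 m) (hm' : IsP2 m') :
    J s m' - J s m = ∫ l in (0 : ℝ)..1,
      ((∫ x, δJ s (mix m m' l) x ∂m') - ∫ x, δJ s (mix m m' l) x ∂m) :=
  (hJ.linear_deriv s hs).increment m m' hm hm'

/-- Continuity of `J(s, ·)` for `W₂`. -/
theorem IsC111.continuous_measure (hJ : IsC111 T J Jt δJ DJ DDJ) {s : ℝ} (hs : s ∈ Icc 0 T)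
    {m : Measure (Rn n)} (hm : IsP2 m) {ε : ℝ} (hε : 0 < ε) :
    ∃ δ > 0, ∀ m', IsP2 m' → W2 m' m < ENNReal.ofReal δ → |J s m' - J s m| < ε := by
  -- Bounds the second moment of every measure of `𝒫₂` at `W₂`-distance less than 1 from `m`.
  set R := 2 * ∫ x, ‖x‖ ^ 2 ∂m + 2 with hR
  have h0 : 0 ≤ ∫ x, ‖x‖ ^ 2 ∂m := integral_nonneg fun x => by positivity
  obtain ⟨c, hc⟩ := hJ.isQuadC2 R hs
  have hmR : ∫ x, ‖x‖ ^ 2 ∂m ≤ R := by linarith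
  have hc0 := (hc m hm hmR).nonneg
  have hA : 0 ≤ c * (4 + 6 * R) := by positivity
  refine ⟨min 1 (ε / (2 * (c * (4 + 6 * R) + 1))), by positivity, fun m' hm' hW => ?_⟩
  set δ := min 1 (ε / (2 * (c * (4 + 6 * R) + 1))) with hδ
  have hδ0 : 0 < δ := by positivity
  have hδ1 : δ ≤ 1 := min_le_left _ _
  have hm'R : ∫ x, ‖x‖ ^ 2 ∂m' ≤ R := by
    have := moment_le_of_W2_lt hm' hm hW
    have : δ ^ 2 ≤ 1 := pow_le_one₀ hδ0.le hδ1
    linarith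
  rw [hJ.increment hs hm hm']
  have : ‖∫ l in (0 : ℝ)..1,
      ((∫ x, δJ s (mix m m' l) x ∂m') - ∫ x, δJ s (mix m m' l) x ∂m)‖
      ≤ c * (4 + 6 * R) * δ * |1 - 0| := by
    refine intervalIntegral.norm_integral_le_of_norm_le_const fun l hl => ?_
    rw [uIoc_of_le zero_le_one] at hl
    have hl' : l ∈ Icc (0 : ℝ) 1 := Ioc_subset_Icc_self hl
    exact (hc _ (isP2_mix hm hm' hl') (moment_mix_le hm hm' hl' hmR hm'R)).abs_integral_sub_le
      hm hm' hδ0 hmR hm'R hW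
  rw [Real.norm_eq_abs] at this
  refine this.trans_lt ?_
  simp only [sub_zero, abs_one, mul_one]
  calc c * (4 + 6 * R) * δ ≤ (c * (4 + 6 * R) + 1) * (ε / (2 * (c * (4 + 6 * R) + 1))) := by
        gcongr
        · linarith
        · exact min_le_right _ _
    _ = ε / 2 := by field_simp
    _ < ε := by linarith

/-- Split at radius `ρ`. Inside, the derivatives of the two test functions differ by at most `η`;
outside, both are bounded by their growth and the quadratic tail `τ` is small. The coefficients
enter through `K` alone. -/
theorem CoefGrowth.abs_integral_sub_le {β : Rn n → Rn n} {a : Rn n → Matrix (Fin n) (Fin n) ℝ}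
    {K : ℝ} (hβ : CoefGrowth β a K) {p p' : Rn n → Rn n} {H H' : Rn n → Rn n →L[ℝ] Rn n}
    (hp : Continuous p) (hp' : Continuous p') (hH : Continuous H) (hH' : Continuous H') {c : ℝ}
    (g : ∀ x, ‖p x‖ ≤ c * (1 + ‖x‖) ∧ ‖H x‖ ≤ c)
    (g' : ∀ x, ‖p' x‖ ≤ c * (1 + ‖x‖) ∧ ‖H' x‖ ≤ c) {η ρ τ R : ℝ} (hη : 0 ≤ η)
    (hpp : ∀ x, ‖x‖ ≤ ρ → ‖p x - p' x‖ ≤ η) (hHH : ∀ x, ‖x‖ ≤ ρ → ‖H x - H' x‖ ≤ η)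
    {m : Measure (Rn n)} (hm : IsP2 m) (hR : ∫ x, ‖x‖ ^ 2 ∂m ≤ R)
    (hτ : ∫ x, {x : Rn n | ρ < ‖x‖}.indicator (fun x => 1 + ‖x‖ ^ 2) x ∂m ≤ τ) :
    |∫ x, secondOrder β a p H x ∂m - ∫ x, secondOrder β a p' H' x ∂m|
      ≤ K * η * (2 + (n : ℝ) ^ 2) * (1 + R) + K * (2 * c) * (2 + (n : ℝ) ^ 2) * τ := by
  have := hm.1
  have hK := hβ.nonneg
  have hc : 0 ≤ c := (norm_nonneg _).trans (g 0).2
  rw [← integral_sub (hβ.integrable_secondOrder hp hH (fun x => (g x).1) (fun x => (g x).2) hm)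
    (hβ.integrable_secondOrder hp' hH' (fun x => (g' x).1) (fun x => (g' x).2) hm)]
  simp only [secondOrder_sub]
  have i1 : Integrable (fun x : Rn n => 1 + ‖x‖ ^ 2) m :=
    (integrable_const 1).add hm.integrable_sq
  have i2 : Integrable ({x : Rn n | ρ < ‖x‖}.indicator (fun x => 1 + ‖x‖ ^ 2)) m :=
    i1.indicator (measurableSet_lt measurable_const measurable_norm)
  have hb : ∀ x, ‖secondOrder β a (p - p') (H - H') x‖
      ≤ K * η * (2 + (n : ℝ) ^ 2) * (1 + ‖x‖ ^ 2) + K * (2 * c) * (2 + (n : ℝ) ^ 2)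
        * {x : Rn n | ρ < ‖x‖}.indicator (fun x => 1 + ‖x‖ ^ 2) x := by
    intro x
    rw [Real.norm_eq_abs]
    by_cases hx : ρ < ‖x‖
    · rw [indicator_of_mem (s := {x : Rn n | ρ < ‖x‖}) hx]
      have : 0 ≤ K * η * (2 + (n : ℝ) ^ 2) * (1 + ‖x‖ ^ 2) := by positivity
      refine (hβ.abs_secondOrder_le (c := 2 * c) ?_ ?_).trans (le_add_of_nonneg_left this)
      · refine (norm_sub_le _ _).trans ?_
        linarith [(g x).1, (g' x).1]
      · refine (norm_sub_le _ _).trans ?_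
        linarith [(g x).2, (g' x).2]
    · rw [indicator_of_notMem (s := {x : Rn n | ρ < ‖x‖}) hx, mul_zero, add_zero]
      refine hβ.abs_secondOrder_le ((hpp x (not_lt.mp hx)).trans ?_) (hHH x (not_lt.mp hx))
      refine le_mul_of_one_le_right hη ?_
      linarith [norm_nonneg x]
  refine (norm_integral_le_of_norm_le ((i1.const_mul _).add (i2.const_mul _))
    (Eventually.of_forall hb)).trans ?_
  simp only [Pi.add_apply]
  rw [integral_add (i1.const_mul _) (i2.const_mul _), integral_const_mul, integral_const_mul,
    integral_add (integrable_const 1) hm.integrable_sq]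
  simp only [integral_const, probReal_univ, one_smul]
  gcongr

/-- Continuity of the generator part along measures and times. -/
theorem IsC111.generator_continuous (hJ : IsC111 T J Jt δJ DJ DDJ) {s : ℝ} (hs : s ∈ Icc 0 T)
    {m : Measure (Rn n)} (hm : IsP2 m) {K : ℝ} (hK : 0 ≤ K) {ε : ℝ} (hε : 0 < ε) :
    ∃ δ > 0, ∀ (m' : Measure (Rn n)) (β : Rn n → Rn n) (a : Rn n → Matrix (Fin n) (Fin n) ℝ),
      IsP2 m' → W2 m' m < ENNReal.ofReal δ → CoefGrowth β a K →
      ∀ s' ν, s' ∈ Icc 0 T → IsP2 ν → |s' - s| < δ → W2 ν m < ENNReal.ofReal δ →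
      |∫ x, secondOrder β a (DJ s' ν) (DDJ s' ν) x ∂m'
        - ∫ x, secondOrder β a (DJ s m) (DDJ s m) x ∂m'| ≤ ε := by
  set R := 2 * ∫ x, ‖x‖ ^ 2 ∂m + 2 with hR
  have h0 : 0 ≤ ∫ x, ‖x‖ ^ 2 ∂m := integral_nonneg fun x => by positivity
  obtain ⟨c', hc'⟩ := hJ.growth R
  set c := max c' 0 with hcdef
  have hc0 : 0 ≤ c := le_max_right _ _
  have hgr : ∀ s ∈ Icc 0 T, ∀ m, IsP2 m → ∫ x, ‖x‖ ^ 2 ∂m ≤ R →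
      ∀ x, ‖DJ s m x‖ ≤ c * (1 + ‖x‖) ∧ ‖DDJ s m x‖ ≤ c := fun s hs m hm h x =>
    ⟨(hc' s hs m hm h x).1.trans (by gcongr; exact le_max_left _ _),
      (hc' s hs m hm h x).2.trans (le_max_left _ _)⟩
  set A := K * (2 + (n : ℝ) ^ 2) * (1 + R) with hA
  have hA0 : 0 ≤ A := by positivity
  set D := K * (2 * c) * (2 + (n : ℝ) ^ 2) with hD
  have hD0 : 0 ≤ D := by positivity
  set η := ε / (2 * (A + 1)) with hη
  have hη0 : 0 < η := by positivity
  -- The radius `ρ` is fixed first, to make the tails small near `m`; then `δ₁` and `δ₂` come from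
  -- uniform continuity on the ball of that radius. None of these choices sees `β` or `a`.
  obtain ⟨ρ, δ₀, hδ₀, htail⟩ := exists_tail_le hm (η := ε / (2 * (D + 1))) (by positivity)
  obtain ⟨δ₁, hδ₁, h₁⟩ := hJ.continuous_DJ.uniform hs hm (isCompact_closedBall (0 : Rn n) ρ) hη0
  obtain ⟨δ₂, hδ₂, h₂⟩ := hJ.continuous_DDJ.uniform hs hm (isCompact_closedBall (0 : Rn n) ρ) hη0
  refine ⟨min (min δ₀ 1) (min δ₁ δ₂), by positivity,
    fun m' β a hm' hW hβ s' ν hs' hν hd hWν => ?_⟩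
  have := hm'.1
  have hle0 : min (min δ₀ 1) (min δ₁ δ₂) ≤ δ₀ := (min_le_left _ _).trans (min_le_left _ _)
  have hle1 : min (min δ₀ 1) (min δ₁ δ₂) ≤ 1 := (min_le_left _ _).trans (min_le_right _ _)
  have hle2 : min (min δ₀ 1) (min δ₁ δ₂) ≤ δ₁ := (min_le_right _ _).trans (min_le_left _ _)
  have hle3 : min (min δ₀ 1) (min δ₁ δ₂) ≤ δ₂ := (min_le_right _ _).trans (min_le_right _ _)
  have hmom : ∀ ν, IsP2 ν → W2 ν m < ENNReal.ofReal (min (min δ₀ 1) (min δ₁ δ₂)) →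
      ∫ x, ‖x‖ ^ 2 ∂ν ≤ R := fun ν hν h => by
    have := moment_le_of_W2_lt hν hm (h.trans_le (ENNReal.ofReal_le_ofReal hle1))
    linarith
  have g1 := hgr s' hs' ν hν (hmom ν hν hWν)
  have g2 := hgr s hs m hm (by linarith)
  have cD1 := hJ.continuous_DJ.continuous hs' hν
  have cD2 := hJ.continuous_DJ.continuous hs hm
  have cH1 := hJ.continuous_DDJ.continuous hs' hν
  have cH2 := hJ.continuous_DDJ.continuous hs hm
  have hx1 : ∀ x, ‖x‖ ≤ ρ → ‖DJ s' ν x - DJ s m x‖ ≤ η := fun x hx => by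
    rw [← dist_eq_norm]
    exact (h₁ x (by simpa using hx) s' ν hs' hν (hd.trans_le hle2)
      (hWν.trans_le (ENNReal.ofReal_le_ofReal hle2))).le
  have hx2 : ∀ x, ‖x‖ ≤ ρ → ‖DDJ s' ν x - DDJ s m x‖ ≤ η := fun x hx => by
    rw [← dist_eq_norm]
    exact (h₂ x (by simpa using hx) s' ν hs' hν (hd.trans_le hle3)
      (hWν.trans_le (ENNReal.ofReal_le_ofReal hle3))).le
  refine (hβ.abs_integral_sub_le cD1 cD2 cH1 cH2 g1 g2 hη0.le hx1 hx2 hm' (hmom m' hm' hW)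
    (htail m' hm' (hW.trans_le (ENNReal.ofReal_le_ofReal hle0)))).trans ?_
  calc _ = A * η + D * (ε / (2 * (D + 1))) := by rw [hA]; ring
    _ ≤ (A + 1) * η + (D + 1) * (ε / (2 * (D + 1))) := by
      gcongr <;> linarith
    _ = ε := by
      rw [hη]
      field_simp
      norm_num

end ChainRule

/-! ### Joint measurability of right-continuous families -/

section RightGrid

/-- The right end point of the dyadic-type cell of length `1 / (k + 1)` around `r`. -/
noncomputable def rightGrid (k : ℕ) (r : ℝ) : ℝ := (⌊r * (k + 1)⌋ + 1) / ((k : ℝ) + 1)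

/-- The `+ 1` puts the grid point strictly to the right of `r`, so that only right limits of a
family are evaluated. -/
theorem tendsto_rightGrid (r : ℝ) : Tendsto (fun k => rightGrid k r) atTop (𝓝[>] r) := by
  have hlt : ∀ k, r < rightGrid k r := fun k => by
    rw [rightGrid, lt_div_iff₀ (by positivity)]
    exact Int.lt_floor_add_one _
  have hle : ∀ k : ℕ, rightGrid k r ≤ r + 1 / ((k : ℝ) + 1) := fun k => by
    have h0 : (0 : ℝ) < k + 1 := by positivity
    rw [rightGrid, div_le_iff₀ h0, add_mul, div_mul_cancel₀ _ h0.ne']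
    linarith [Int.floor_le (r * (k + 1))]
  refine tendsto_nhdsWithin_iff.2 ⟨?_, Eventually.of_forall hlt⟩
  refine tendsto_of_tendsto_of_tendsto_of_le_of_le tendsto_const_nhds ?_ (fun k => (hlt k).le) hle
  simpa using (tendsto_one_div_add_atTop_nhds_zero_nat (𝕜 := ℝ)).const_add r

/-- Right-continuous families of measurable functions are jointly measurable. -/
theorem measurable_of_tendsto_right {X Y : Type*} [MeasurableSpace X] [TopologicalSpace Y]
    [TopologicalSpace.PseudoMetrizableSpace Y] [MeasurableSpace Y] [BorelSpace Y]
    {f : ℝ → X → Y} (hf : ∀ r, Measurable (f r))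
    (hr : ∀ r x, Tendsto (fun q => f q x) (𝓝[>] r) (𝓝 (f r x))) :
    Measurable fun q : ℝ × X => f q.1 q.2 := by
  refine measurable_of_tendsto_metrizable (f := fun k (q : ℝ × X) => f (rightGrid k q.1) q.2)
    (fun k => ?_) (tendsto_pi_nhds.2 fun q => (hr q.1 q.2).comp (tendsto_rightGrid q.1))
  -- The grid has countably many points, so joint measurability at grid times reduces to
  -- measurability at each of them.
  have h1 : Measurable fun q : ℤ × X => f ((q.1 + 1) / ((k : ℝ) + 1)) q.2 :=
    measurable_from_prod_countable_right fun j => hf ((j + 1) / ((k : ℝ) + 1))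
  have h2 : Measurable fun q : ℝ × X => (⌊q.1 * ((k : ℝ) + 1)⌋, q.2) :=
    (Int.measurable_floor.comp (measurable_fst.mul_const _)).prodMk measurable_snd
  exact h1.comp h2

end RightGrid

/-! ### The chain rule on the right of a time -/

section ChainRule

variable {n : ℕ} {T : ℝ}

/-- The projection of the real line to `[0, T]`. -/
noncomputable def clamp (a b r : ℝ) : ℝ := max a (min b r)

theorem clamp_mem {a b : ℝ} (h : a ≤ b) (r : ℝ) : clamp a b r ∈ Icc a b :=
  ⟨le_max_left _ _, max_le h (min_le_left _ _)⟩

theorem clamp_of_mem {a b r : ℝ} (h : r ∈ Icc a b) : clamp a b r = r := by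
  rw [clamp, min_eq_right h.2, max_eq_right h.1]

theorem continuous_clamp (a b : ℝ) : Continuous (clamp a b) := by
  unfold clamp
  fun_prop

theorem JointlyContinuous.tendsto {Y ι : Type*} [PseudoMetricSpace Y]
    {F : ℝ → Measure (Rn n) → Rn n → Y} (hF : JointlyContinuous T F) {l : Filter ι} {s : ℝ}
    (hs : s ∈ Icc 0 T) {m : Measure (Rn n)} (hm : IsP2 m) {u : ι → ℝ} {v : ι → Measure (Rn n)}
    (hu : ∀ᶠ i in l, u i ∈ Icc 0 T) (hv : ∀ᶠ i in l, IsP2 (v i)) (hul : Tendsto u l (𝓝 s))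
    (hvl : Tendsto (fun i => W2 (v i) m) l (𝓝 0)) (x : Rn n) :
    Tendsto (fun i => F (u i) (v i) x) l (𝓝 (F s m x)) := by
  rw [Metric.tendsto_nhds]
  intro ε hε
  obtain ⟨δ, hδ, h⟩ := hF s m x hs hm ε hε
  filter_upwards [hu, hv, Metric.tendsto_nhds.1 hul δ hδ,
    hvl.eventually (gt_mem_nhds (ENNReal.ofReal_pos.2 hδ))] with i h1 h2 h3 h4
  exact h _ _ _ h1 h2 h3 h4 (by simpa using hδ)

/-- Continuity in time is known on `[0, T]` only; clamping the time yields a function that is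
right-continuous, hence measurable, on the whole line. -/
theorem JointlyContinuous.measurable_along {Y : Type*} [PseudoMetricSpace Y] [MeasurableSpace Y]
    [BorelSpace Y] {F : ℝ → Measure (Rn n) → Rn n → Y} (hF : JointlyContinuous T F) (hT : 0 ≤ T)
    {m : ℝ → Measure (Rn n)} (hm : ∀ r, IsP2 (m r))
    (hr : ∀ s, Tendsto (fun r => W2 (m r) (m s)) (𝓝[>] s) (𝓝 0)) :
    Measurable fun q : ℝ × Rn n => F (clamp 0 T q.1) (m q.1) q.2 := by
  refine measurable_of_tendsto_right (f := fun r x => F (clamp 0 T r) (m r) x)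
    (fun r => (hF.continuous (clamp_mem hT r) (hm r)).measurable) fun r x => ?_
  exact hF.tendsto (clamp_mem hT r) (hm r) (Eventually.of_forall fun q => clamp_mem hT q)
    (Eventually.of_forall hm)
    (((continuous_clamp 0 T).tendsto r).mono_left nhdsWithin_le_nhds) (hr r) x

variable {J Jt : ℝ → Measure (Rn n) → ℝ} {δJ : ℝ → Measure (Rn n) → Rn n → ℝ}
  {DJ : ℝ → Measure (Rn n) → Rn n → Rn n} {DDJ : ℝ → Measure (Rn n) → Rn n → Rn n →L[ℝ] Rn n}
  {m : Kernel ℝ (Rn n)} {β : ℝ → Rn n → Rn n}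
  {a : ℝ → Rn n → Matrix (Fin n) (Fin n) ℝ} {R K : ℝ}

theorem IsFlow.intervalIntegrable_generator (h : IsFlow m β a R K)
    (hJ : IsC111 T J Jt δJ DJ DDJ) {s s' : ℝ} (h0 : 0 ≤ s) (hss : s ≤ s') (hT : s' ≤ T) :
    IntervalIntegrable
      (fun r => ∫ x, secondOrder (β r) (a r) (DJ r (m r)) (DDJ r (m r)) x ∂(m r)) volume s s' := by
  have hT0 : 0 ≤ T := h0.trans (hss.trans hT)
  obtain ⟨c, hc⟩ := hJ.growth R
  have hmeas : Measurable fun r => ∫ x, secondOrder (β r) (a r) (DJ (clamp 0 T r) (m r))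
      (DDJ (clamp 0 T r) (m r)) x ∂(m r) :=
    h.measurable_integral_secondOrder (hJ.continuous_DJ.measurable_along hT0 h.p2 h.right)
      (hJ.continuous_DDJ.measurable_along hT0 h.p2 h.right)
  have hint : IntervalIntegrable (fun r => ∫ x, secondOrder (β r) (a r) (DJ (clamp 0 T r) (m r))
      (DDJ (clamp 0 T r) (m r)) x ∂(m r)) volume s s' := by
    refine (intervalIntegrable_const (c := K * c * (2 + (n : ℝ) ^ 2) * (1 + R))).mono_fun'
      hmeas.aestronglyMeasurable (Eventually.of_forall fun r => ?_)
    have hg := hc _ (clamp_mem hT0 r) (m r) (h.p2 r) (h.moment r)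
    exact (h.coefGrowth r).abs_integral_secondOrder_le (fun x => (hg x).1) (fun x => (hg x).2)
      (h.p2 r) (h.moment r)
  refine hint.congr fun r hr => ?_
  rw [uIoc_of_le hss] at hr
  rw [clamp_of_mem ⟨h0.trans hr.1.le, hr.2.trans hT⟩]

/-- Provides integrability in `l` of the integrand in the increment formula, so that the time
integral can be subtracted under the `l`-integral. The segment has bounded second moments, so one
quadratic bound dominates. -/
theorem IsC111.continuousOn_increment (hJ : IsC111 T J Jt δJ DJ DDJ) {s : ℝ} (hs : s ∈ Icc 0 T)
    {μ μ' : Measure (Rn n)} (hμ : IsP2 μ) (hμ' : IsP2 μ') :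
    ContinuousOn (fun l => (∫ x, δJ s (mix μ μ' l) x ∂μ') - ∫ x, δJ s (mix μ μ' l) x ∂μ)
      (Icc 0 1) := by
  set R := max (∫ x, ‖x‖ ^ 2 ∂μ) (∫ x, ‖x‖ ^ 2 ∂μ')
  obtain ⟨c, hc⟩ := hJ.isQuadC2 R hs
  have hq : ∀ l ∈ Icc (0 : ℝ) 1, IsQuadC2 (δJ s (mix μ μ' l)) (DJ s (mix μ μ' l))
      (DDJ s (mix μ μ' l)) c := fun l hl => hc _ (isP2_mix hμ hμ' hl)
    (moment_mix_le hμ hμ' hl (le_max_left _ _) (le_max_right _ _))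
  have key : ∀ ν : Measure (Rn n), IsP2 ν →
      ContinuousOn (fun l => ∫ x, δJ s (mix μ μ' l) x ∂ν) (Icc 0 1) := by
    intro ν hν
    have := hν.1
    refine continuousOn_of_dominated (bound := fun x => c * (1 + ‖x‖ ^ 2))
      (fun l hl => (hq l hl).continuous.aestronglyMeasurable)
      (fun l hl => Eventually.of_forall (hq l hl).bound)
      (((integrable_const 1).add hν.integrable_sq).const_mul c)
      (Eventually.of_forall fun x l hl => ?_)
    rw [ContinuousWithinAt, Metric.tendsto_nhds]
    intro ε hε
    obtain ⟨δ, hδ, h⟩ := (hJ.linear_deriv s hs).continuous _ x (isP2_mix hμ hμ' hl) ε hε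
    filter_upwards [self_mem_nhdsWithin, (continuous_mix hμ hμ' hl).eventually
      (gt_mem_nhds (ENNReal.ofReal_pos.2 hδ))] with l' h1 h2
    exact h _ x (isP2_mix hμ hμ' h1) h2 (by simpa using hδ)
  exact (key μ' hμ').sub (key μ hμ)

/-- First order expansion of `J` in time. -/
theorem IsC111.time_expansion (hJ : IsC111 T J Jt δJ DJ DDJ) {s : ℝ} (hs : s ∈ Icc 0 T)
    {μ : Measure (Rn n)} (hμ : IsP2 μ) {ε : ℝ} (hε : 0 < ε) :
    ∃ δ > 0, ∀ μ', IsP2 μ' → W2 μ' μ < ENNReal.ofReal δ → ∀ s' ∈ Icc 0 T, |s' - s| < δ →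
      |Jt s' μ' - Jt s μ| ≤ ε ∧ |J s' μ' - J s μ' - (s' - s) * Jt s μ| ≤ ε * |s' - s| := by
  obtain ⟨δ, hδ, h⟩ := hJ.continuous_Jt s μ 0 hs hμ ε hε
  refine ⟨δ, hδ, fun μ' hμ' hW s' hs' hd => ⟨?_, ?_⟩⟩
  · exact (h s' μ' 0 hs' hμ' hd hW (by simpa using hδ)).le
  · have hsub : uIcc s s' ⊆ Icc 0 T := uIcc_subset_Icc hs hs'
    -- Mean value inequality at the fixed measure `μ'`, after subtracting the linear function of
    -- slope `Jt s μ`; joint continuity of `Jt` keeps the derivative small uniformly over `μ'` near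
    -- `μ`.
    have hder : ∀ r ∈ uIcc s s', HasDerivWithinAt (fun r => J r μ' - r * Jt s μ)
        (Jt r μ' - Jt s μ) (uIcc s s') r := fun r hr => by
      have h1 := (hJ.time_deriv r (hsub hr) μ' hμ').mono hsub
      have h2 := ((hasDerivWithinAt_id r (uIcc s s')).mul_const (Jt s μ))
      rw [one_mul] at h2
      exact h1.sub h2
    have hbd : ∀ r ∈ uIcc s s', ‖Jt r μ' - Jt s μ‖ ≤ ε := fun r hr => by
      refine (h r μ' 0 (hsub hr) hμ' ?_ hW (by simpa using hδ)).le
      exact (abs_sub_left_of_mem_uIcc hr).trans_lt hd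
    have := Convex.norm_image_sub_le_of_norm_hasDerivWithin_le hder hbd (convex_uIcc s s')
      left_mem_uIcc right_mem_uIcc
    rw [Real.norm_eq_abs, Real.norm_eq_abs] at this
    refine le_trans (le_of_eq ?_) this
    congr 1
    ring

/-- The chain rule to the right of a time after which there is no jump. -/
theorem IsFlow.chain_rule_right (h : IsFlow m β a R K) (hJ : IsC111 T J Jt δJ DJ DDJ) {s : ℝ}
    (hs : s ∈ Ico 0 T)
    (hJt : ∀ s' ∈ Icc s T, IntervalIntegrable (fun r => Jt r (m r)) volume s s')
    (heq : ∀ᶠ s' in 𝓝[>] s, ∀ φ : Rn n → ℝ, ContDiff ℝ (⊤ : ℕ∞) φ → HasCompactSupport φ →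
      ∫ x, φ x ∂(m s') = ∫ x, φ x ∂(m s)
        + ∫ r in s..s', ∫ x, secondOrder (β r) (a r) (∇ φ) (fderiv ℝ (∇ φ)) x ∂(m r))
    {ε : ℝ} (hε : 0 < ε) :
    ∀ᶠ s' in 𝓝[>] s, |J s' (m s') - J s (m s) - ∫ r in s..s', (Jt r (m r)
      + ∫ x, secondOrder (β r) (a r) (DJ r (m r)) (DDJ r (m r)) x ∂(m r))| ≤ ε * (s' - s) := by
  have hsI : s ∈ Icc 0 T := ⟨hs.1, hs.2.le⟩
  obtain ⟨δ₁, hδ₁, h₁⟩ := hJ.time_expansion hsI (h.p2 s) (ε := ε / 4) (by positivity)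
  obtain ⟨δ₂, hδ₂, h₂⟩ := hJ.generator_continuous hsI (h.p2 s) (h.coefGrowth s).nonneg
    (ε := ε / 4) (by positivity)
  obtain ⟨c, hc⟩ := hJ.isQuadC2 R hsI
  -- The half of `δ₂` leaves room for the mixtures, which are only known to be within twice the
  -- distance of their end point.
  have hW := (h.right s).eventually (gt_mem_nhds (ENNReal.ofReal_pos.2
    (show 0 < min δ₁ (δ₂ / 2) by positivity)))
  rw [eventually_nhdsWithin_iff, Metric.eventually_nhds_iff] at hW
  obtain ⟨δ₃, hδ₃, h₃⟩ := hW
  have hnear : ∀ᶠ s' in 𝓝[>] s, s' ∈ Ioo s (s + min (min δ₁ δ₂) (min δ₃ (T - s))) :=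
    Ioo_mem_nhdsGT (lt_add_of_pos_right _ (by
      have : 0 < T - s := sub_pos.2 hs.2
      positivity))
  filter_upwards [heq, hnear] with s' hFP hs'
  have hd : s' - s < min (min δ₁ δ₂) (min δ₃ (T - s)) := by linarith [hs'.2]
  have hd1 : s' - s < δ₁ := hd.trans_le ((min_le_left _ _).trans (min_le_left _ _))
  have hd2 : s' - s < δ₂ := hd.trans_le ((min_le_left _ _).trans (min_le_right _ _))
  have hd3 : s' - s < δ₃ := hd.trans_le ((min_le_right _ _).trans (min_le_left _ _))
  have hd4 : s' - s < T - s := hd.trans_le ((min_le_right _ _).trans (min_le_right _ _))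
  have hss : s < s' := hs'.1
  have hs'I : s' ∈ Icc 0 T := ⟨by linarith [hs.1], by linarith⟩
  have hclose : ∀ r ∈ Ioc s s', r ∈ Icc 0 T ∧ |r - s| < δ₁ ∧ |r - s| < δ₂ ∧
      W2 (m r) (m s) < ENNReal.ofReal δ₁ ∧ W2 (m r) (m s) < ENNReal.ofReal (δ₂ / 2) ∧
      W2 (m r) (m s) < ENNReal.ofReal δ₂ := by
    intro r hr
    have e : |r - s| = r - s := abs_of_pos (sub_pos.2 hr.1)
    have hw := h₃ (y := r) (by rw [Real.dist_eq, e]; linarith [hr.2]) hr.1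
    refine ⟨⟨by linarith [hs.1, hr.1], by linarith [hr.2, hs'I.2]⟩, by rw [e]; linarith [hr.2],
      by rw [e]; linarith [hr.2], hw.trans_le (ENNReal.ofReal_le_ofReal (min_le_left _ _)),
      hw.trans_le (ENNReal.ofReal_le_ofReal (min_le_right _ _)),
      hw.trans_le (ENNReal.ofReal_le_ofReal ((min_le_right _ _).trans (by linarith)))⟩
  set g : ℝ → ℝ := fun r =>
    ∫ x, secondOrder (β r) (a r) (DJ r (m r)) (DDJ r (m r)) x ∂(m r) with hg
  have ig : IntervalIntegrable g volume s s' :=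
    h.intervalIntegrable_generator hJ hs.1 hss.le hs'I.2
  have it := hJt s' ⟨hss.le, hs'I.2⟩
  have hs'c := hclose s' (right_mem_Ioc.2 hss)
  have hsp : |s' - s| = s' - s := abs_of_pos (sub_pos.2 hss)
  -- the time part
  have e1 : |J s' (m s') - J s (m s') - (s' - s) * Jt s (m s)| ≤ ε / 4 * (s' - s) := by
    have := (h₁ (m s') (h.p2 s') hs'c.2.2.2.1 s' hs'I hs'c.2.1).2
    rwa [hsp] at this
  have e2 : |(∫ r in s..s', Jt r (m r)) - (s' - s) * Jt s (m s)| ≤ ε / 4 * (s' - s) := by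
    have e : (∫ r in s..s', Jt r (m r)) - (s' - s) * Jt s (m s)
        = ∫ r in s..s', (Jt r (m r) - Jt s (m s)) := by
      rw [intervalIntegral.integral_sub it intervalIntegrable_const,
        intervalIntegral.integral_const, smul_eq_mul]
    rw [e, ← hsp]
    refine intervalIntegral.norm_integral_le_of_norm_le_const
      (f := fun r => Jt r (m r) - Jt s (m s)) fun r hr => ?_
    rw [uIoc_of_le hss.le] at hr
    have hcr := hclose r hr
    exact (h₁ (m r) (h.p2 r) hcr.2.2.2.1 r hcr.1 hcr.2.1).1
  -- the measure part
  have e3 : |J s (m s') - J s (m s) - ∫ r in s..s', g r| ≤ ε / 2 * (s' - s) := by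
    rw [hJ.increment hsI (h.p2 s) (h.p2 s')]
    have hcont := (hJ.continuousOn_increment hsI (h.p2 s) (h.p2 s')).intervalIntegrable_of_Icc
      (μ := volume) zero_le_one
    have e : (∫ l in (0 : ℝ)..1, ((∫ x, δJ s (mix (m s) (m s') l) x ∂(m s'))
        - ∫ x, δJ s (mix (m s) (m s') l) x ∂(m s))) - ∫ r in s..s', g r
        = ∫ l in (0 : ℝ)..1, (((∫ x, δJ s (mix (m s) (m s') l) x ∂(m s'))
        - ∫ x, δJ s (mix (m s) (m s') l) x ∂(m s)) - ∫ r in s..s', g r) := by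
      rw [intervalIntegral.integral_sub hcont intervalIntegrable_const,
        intervalIntegral.integral_const]
      simp
    rw [e]
    have hbound : ∀ l ∈ uIoc (0 : ℝ) 1, ‖((∫ x, δJ s (mix (m s) (m s') l) x ∂(m s'))
        - ∫ x, δJ s (mix (m s) (m s') l) x ∂(m s)) - ∫ r in s..s', g r‖
        ≤ ε / 2 * (s' - s) := by
      intro l hl
      rw [uIoc_of_le zero_le_one] at hl
      have hl' : l ∈ Icc (0 : ℝ) 1 := Ioc_subset_Icc_self hl
      have hmix := isP2_mix (h.p2 s) (h.p2 s') hl'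
      have hmom := moment_mix_le (h.p2 s) (h.p2 s') hl' (h.moment s) (h.moment s')
      have hq := hc _ hmix hmom
      -- For fixed `l` the linear derivative at the mixture is one function of `x`, independent of
      -- the running time, so the extended weak equation applies and turns the increment into a time
      -- integral.
      rw [h.integral_eq_of_isQuadC2 hFP hq, add_sub_cancel_left]
      have il : IntervalIntegrable (fun r => ∫ x, secondOrder (β r) (a r)
          (DJ s (mix (m s) (m s') l)) (DDJ s (mix (m s) (m s') l)) x ∂(m r)) volume s s' := by
        refine (intervalIntegrable_const (c := K * c * (2 + (n : ℝ) ^ 2) * (1 + R))).mono_fun'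
          (h.measurable_integral_secondOrder (p := fun _ => DJ s (mix (m s) (m s') l))
            (H := fun _ => DDJ s (mix (m s) (m s') l))
            (hq.continuous_grad.measurable.comp measurable_snd)
            (hq.cont.measurable.comp measurable_snd)).aestronglyMeasurable
          (Eventually.of_forall fun r => (h.coefGrowth r).abs_integral_secondOrder_le
            hq.bound_grad hq.bound_deriv (h.p2 r) (h.moment r))
      rw [← intervalIntegral.integral_sub il ig, ← hsp]
      refine intervalIntegral.norm_integral_le_of_norm_le_const fun r hr => ?_
      rw [uIoc_of_le hss.le] at hr
      have hcr := hclose r hr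
      have hWmix : W2 (mix (m s) (m s') l) (m s) < ENNReal.ofReal δ₂ := by
        have := W2_mix_lt hs'c.2.2.2.2.1 hl'
        rwa [mul_div_cancel₀ _ (by norm_num : (2 : ℝ) ≠ 0)] at this
      -- Both generators, the one with derivatives at the mixture at time `s` and the one with
      -- derivatives at `(r, m r)`, are compared with derivatives at `(s, m s)`. The integrating
      -- measure `m r` and the coefficients at time `r` stay the same throughout; the total error is
      -- `ε / 4 + ε / 4`.
      have b1 := h₂ (m r) (β r) (a r) (h.p2 r) hcr.2.2.2.2.2 (h.coefGrowth r) s _ hsI hmix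
        (by simpa using hδ₂) hWmix
      have b2 := h₂ (m r) (β r) (a r) (h.p2 r) hcr.2.2.2.2.2 (h.coefGrowth r) r (m r) hcr.1
        (h.p2 r) hcr.2.2.1 hcr.2.2.2.2.2
      rw [Real.norm_eq_abs]
      rw [abs_le] at b1 b2 ⊢
      constructor <;> simp only [hg] <;> linarith [b1.1, b1.2, b2.1, b2.2]
    have := intervalIntegral.norm_integral_le_of_norm_le_const hbound
    simpa using this
  rw [intervalIntegral.integral_add it ig]
  rw [abs_le] at e1 e2 e3 ⊢
  constructor <;> linarith [e1.1, e1.2, e2.1, e2.2, e3.1, e3.2]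

end ChainRule

/-! ### Measurability of the coefficients along a flow of joint laws -/

section Quantization

set_option linter.unusedSectionVars false

variable {n : ℕ} {B : Type*} [NormedAddCommGroup B] [NormedSpace ℝ B] [MeasurableSpace B]
  [BorelSpace B] {U : Set B}

theorem fmDist_le {ρ ρ' : Measure (Rn n × U)} {c : ℝ} (hc : 0 ≤ c)
    (h : ∀ f : Rn n × U → ℝ, (∀ p q, |f p - f q| ≤ ‖p.1 - q.1‖ + ‖(p.2 : B) - q.2‖) →
      (∀ p, |f p| ≤ 1) → ∫ p, f p ∂ρ - ∫ p, f p ∂ρ' ≤ c) : fmDist ρ ρ' ≤ c := by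
  refine Real.sSup_le ?_ hc
  rintro r ⟨f, h1, h2, rfl⟩
  exact h (fun p => f (p.1, p.2)) (fun p q => h1 _ _) fun p => h2 _

theorem continuous_of_abs_sub_le {f : Rn n × U → ℝ}
    (h : ∀ p q, |f p - f q| ≤ ‖p.1 - q.1‖ + ‖(p.2 : B) - q.2‖) : Continuous f := by
  refine (LipschitzWith.of_dist_le_mul (K := 2) fun p q => ?_).continuous
  rw [Real.dist_eq]
  refine (h p q).trans ?_
  have h1 : ‖p.1 - q.1‖ ≤ dist p q := by
    rw [← dist_eq_norm]
    exact le_max_left _ _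
  have h2 : ‖(p.2 : B) - q.2‖ ≤ dist p q := by
    rw [← dist_eq_norm, ← Subtype.dist_eq]
    exact le_max_right _ _
  push_cast
  linarith

/-- The discrete measure with weights `w` at the points `e`. -/
noncomputable def discreteMeasure {X : Type*} [MeasurableSpace X] {N : ℕ} (e : Fin N → X)
    (w : Fin N → ℝ) : Measure X :=
  (∑ i, ENNReal.ofReal (w i) • Measure.dirac i).map e

theorem integral_discreteMeasure {N : ℕ} (e : Fin N → Rn n × U)
    {w : Fin N → ℝ} (hw : ∀ i, 0 ≤ w i) {f : Rn n × U → ℝ} (hf : Measurable f) :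
    ∫ p, f p ∂(discreteMeasure e w) = ∑ i, w i * f (e i) := by
  rw [discreteMeasure, integral_map (measurable_of_finite e).aemeasurable hf.aestronglyMeasurable,
    integral_finsetSum_measure fun i _ => Integrable.smul_measure (by
      exact integrable_dirac (by simp)) ENNReal.ofReal_ne_top]
  refine Finset.sum_congr rfl fun i _ => ?_
  rw [integral_smul_measure, integral_dirac, ENNReal.toReal_ofReal (hw i), smul_eq_mul]

variable [CompactSpace U]

theorem isP2Joint_discreteMeasure {N : ℕ} (e : Fin N → Rn n × U) {w : Fin N → ℝ}
    (hw : w ∈ stdSimplex ℝ (Fin N)) : IsP2Joint (discreteMeasure e w) := by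
  refine ⟨⟨?_⟩, ?_⟩
  · rw [discreteMeasure, Measure.map_apply (measurable_of_finite e) MeasurableSet.univ]
    simp only [preimage_univ, Measure.finsetSum_apply, Measure.smul_apply, measure_univ, smul_eq_mul, mul_one]
    rw [← ENNReal.ofReal_sum_of_nonneg fun i _ => hw.1 i, hw.2, ENNReal.ofReal_one]
  · rw [discreteMeasure, lintegral_map (by fun_prop) (measurable_of_finite e),
      lintegral_finsetSum_measure]
    refine ENNReal.sum_lt_top.2 fun i _ => ?_
    rw [lintegral_smul_measure, lintegral_dirac, smul_eq_mul]
    refine ENNReal.mul_lt_top ENNReal.ofReal_lt_top ?_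
    simp [ENNReal.add_lt_top]

theorem fmDist_discreteMeasure_le {N : ℕ} (e : Fin N → Rn n × U) {w w' : Fin N → ℝ}
    (hw : ∀ i, 0 ≤ w i) (hw' : ∀ i, 0 ≤ w' i) :
    fmDist (discreteMeasure e w) (discreteMeasure e w') ≤ ∑ i, |w i - w' i| := by
  refine fmDist_le (Finset.sum_nonneg fun i _ => abs_nonneg _) fun f h1 h2 => ?_
  have hf := (continuous_of_abs_sub_le h1).measurable
  rw [integral_discreteMeasure e hw hf, integral_discreteMeasure e hw' hf,
    ← Finset.sum_sub_distrib]
  refine Finset.sum_le_sum fun i _ => ?_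
  rw [← sub_mul]
  refine (le_abs_self _).trans ?_
  rw [abs_mul]
  exact mul_le_of_le_one_right (abs_nonneg _) (h2 _)

/-- The Fortet-Mourier distance of two measures on the same points is at most the `ℓ¹` distance of
their weights. The coefficient becomes a continuous function of finitely many real parameters. -/
theorem continuous_discreteMeasure {Y : Type*} [TopologicalSpace Y]
    {φ : Rn n → Measure (Rn n × U) → U → Y} (hφ : CoefContinuous φ) {N : ℕ}
    (e : Fin N → Rn n × U) :
    Continuous fun q : Rn n × stdSimplex ℝ (Fin N) × U =>
      φ q.1 (discreteMeasure e q.2.1.1) q.2.2 := by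
  rw [continuous_iff_continuousAt]
  rintro ⟨x, w, u⟩
  rw [ContinuousAt, tendsto_def]
  intro V hV
  obtain ⟨δ, hδ, h⟩ := hφ x _ u (isP2Joint_discreteMeasure e w.2) V hV
  have h1 : ∀ᶠ q : Rn n × stdSimplex ℝ (Fin N) × U in 𝓝 (x, w, u), dist q.1 x < δ :=
    (continuous_fst.tendsto (x, w, u)).eventually (Metric.ball_mem_nhds x hδ)
  have h2 : ∀ᶠ q : Rn n × stdSimplex ℝ (Fin N) × U in 𝓝 (x, w, u), dist q.2.2 u < δ :=
    ((continuous_snd.comp continuous_snd).tendsto (x, w, u)).eventually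
      (Metric.ball_mem_nhds u hδ)
  have h3 : ∀ᶠ q : Rn n × stdSimplex ℝ (Fin N) × U in 𝓝 (x, w, u),
      ∑ i, |q.2.1.1 i - w.1 i| < δ := by
    have hc : Continuous fun q : Rn n × stdSimplex ℝ (Fin N) × U =>
        ∑ i, |q.2.1.1 i - w.1 i| := by
      refine continuous_finsetSum _ fun i _ => (Continuous.sub ?_ continuous_const).abs
      exact (continuous_apply i).comp
        (continuous_subtype_val.comp (continuous_fst.comp continuous_snd))
    refine (hc.tendsto (x, w, u)).eventually (gt_mem_nhds ?_)
    simpa using hδ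
  filter_upwards [h1, h2, h3] with q hq1 hq2 hq3
  exact h _ _ _ (isP2Joint_discreteMeasure e q.2.1.2) hq1
    ((fmDist_discreteMeasure_le e (fun i => q.2.1.2.1 i) (fun i => w.2.1 i)).trans_lt hq3) hq2

/-- The index of the quantization cell of a point. -/
noncomputable def cellIndex {X : Type*} [PseudoEMetricSpace X] [MeasurableSpace X]
    [OpensMeasurableSpace X] (e : ℕ → X) (N : ℕ) (p : X) : Fin (N + 1) :=
  ⟨SimpleFunc.nearestPtInd e N p, Nat.lt_succ_of_le (SimpleFunc.nearestPtInd_le e N p)⟩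

theorem measurable_cellIndex {X : Type*} [PseudoEMetricSpace X] [MeasurableSpace X]
    [OpensMeasurableSpace X] (e : ℕ → X) (N : ℕ) : Measurable (cellIndex e N) := by
  refine measurable_to_countable' fun i => ?_
  have : cellIndex e N ⁻¹' {i} = SimpleFunc.nearestPtInd e N ⁻¹' {(i : ℕ)} := by
    ext p
    simp [cellIndex, Fin.ext_iff]
  rw [this]
  exact (SimpleFunc.nearestPtInd e N).measurableSet_preimage _

/-- The weights of the quantization cells. -/
noncomputable def cellWeight {X : Type*} [PseudoEMetricSpace X] [MeasurableSpace X]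
    [OpensMeasurableSpace X] (e : ℕ → X) (N : ℕ) (ρ : Measure X) (i : Fin (N + 1)) : ℝ :=
  ρ.real (cellIndex e N ⁻¹' {i})

theorem cellWeight_mem {X : Type*} [PseudoEMetricSpace X] [MeasurableSpace X]
    [OpensMeasurableSpace X] (e : ℕ → X) (N : ℕ) (ρ : Measure X) [IsProbabilityMeasure ρ] :
    cellWeight e N ρ ∈ stdSimplex ℝ (Fin (N + 1)) := by
  refine ⟨fun i => measureReal_nonneg, ?_⟩
  have := sum_measureReal_preimage_singleton (μ := ρ) (f := cellIndex e N) Finset.univ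
    fun i _ => measurable_cellIndex e N (measurableSet_singleton i)
  simpa [cellWeight] using this

/-- Two views of the quantized law: the weights are measurable in `ρ`, while the push-forward along
the nearest-point map shows closeness to `ρ`. -/
theorem discreteMeasure_cellWeight {X : Type*} [PseudoEMetricSpace X] [MeasurableSpace X]
    [OpensMeasurableSpace X] (e : ℕ → X) (N : ℕ) (ρ : Measure X) [IsProbabilityMeasure ρ] :
    discreteMeasure (fun i : Fin (N + 1) => e i) (cellWeight e N ρ)
      = ρ.map (SimpleFunc.nearestPt e N) := by
  have e1 : ∑ i, ENNReal.ofReal (cellWeight e N ρ i) • Measure.dirac i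
      = ρ.map (cellIndex e N) := by
    rw [← Measure.sum_smul_dirac (ρ.map (cellIndex e N)), Measure.sum_fintype]
    refine Finset.sum_congr rfl fun i _ => ?_
    rw [Measure.map_apply (measurable_cellIndex e N) (measurableSet_singleton i), cellWeight,
      ofReal_measureReal]
  rw [discreteMeasure, e1, Measure.map_map (measurable_of_finite _) (measurable_cellIndex e N)]
  rfl

/-- A Fortet-Mourier test function changes by at most `min 2 (2 * dist)` when a point moves to its
nearest neighbour, uniformly over such functions. Dominated convergence concludes without any moment
condition. -/
theorem tendsto_fmDist_quantization {e : ℕ → Rn n × U} (he : DenseRange e)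
    (ρ : Measure (Rn n × U)) [IsProbabilityMeasure ρ] :
    Tendsto (fun N => fmDist (ρ.map (SimpleFunc.nearestPt e N)) ρ) atTop (𝓝 0) := by
  set g : ℕ → Rn n × U → ℝ := fun N p => min 2 (2 * dist (SimpleFunc.nearestPt e N p) p) with hg
  have hgm : ∀ N, Measurable (g N) := fun N =>
    measurable_const.min (((SimpleFunc.measurable _).dist measurable_id).const_mul 2)
  have hg2 : ∀ N p, ‖g N p‖ ≤ 2 := fun N p => by
    rw [Real.norm_of_nonneg (le_min (by norm_num) (by positivity))]
    exact min_le_left _ _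
  have hlim : Tendsto (fun N => ∫ p, g N p ∂ρ) atTop (𝓝 (∫ _, (0 : ℝ) ∂ρ)) := by
    refine tendsto_integral_of_dominated_convergence (fun _ => 2)
      (fun N => (hgm N).aestronglyMeasurable) (integrable_const 2)
      (fun N => Eventually.of_forall (hg2 N)) (Eventually.of_forall fun p => ?_)
    have h1 := tendsto_iff_dist_tendsto_zero.1 (SimpleFunc.tendsto_nearestPt (he p))
    have h2 := (tendsto_const_nhds (x := (2 : ℝ))).min (h1.const_mul 2)
    simpa using h2
  rw [integral_zero] at hlim
  have hnn : ∀ N, 0 ≤ fmDist (ρ.map (SimpleFunc.nearestPt e N)) ρ := fun N => by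
    refine Real.sSup_nonneg' ⟨0, ⟨fun _ => 0, by
      intro p q
      simp only [sub_self, abs_zero]
      positivity, by simp, by simp⟩, le_rfl⟩
  refine tendsto_of_tendsto_of_tendsto_of_le_of_le tendsto_const_nhds hlim hnn fun N => ?_
  refine fmDist_le (integral_nonneg fun p => le_min (by norm_num) (by positivity))
    fun f h1 h2 => ?_
  have hf := continuous_of_abs_sub_le h1
  have hq := SimpleFunc.measurable (SimpleFunc.nearestPt e N)
  have hb : ∀ p, ‖f p‖ ≤ 1 := h2
  have i1 : Integrable (fun p => f (SimpleFunc.nearestPt e N p)) ρ :=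
    Integrable.of_bound (hf.measurable.comp hq).aestronglyMeasurable 1
      (Eventually.of_forall fun p => hb _)
  have i2 : Integrable f ρ :=
    Integrable.of_bound hf.aestronglyMeasurable 1 (Eventually.of_forall hb)
  rw [integral_map hq.aemeasurable hf.aestronglyMeasurable, ← integral_sub i1 i2]
  refine integral_mono (i1.sub i2) (Integrable.of_bound (hgm N).aestronglyMeasurable 2
    (Eventually.of_forall (hg2 N))) fun p => le_min ?_ ?_
  · have e1 := abs_le.1 (h2 (SimpleFunc.nearestPt e N p))
    have e2 := abs_le.1 (h2 p)
    linarith [e1.2, e2.1]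
  · refine (le_abs_self _).trans ((h1 _ _).trans ?_)
    rw [← dist_eq_norm, ← dist_eq_norm, ← Subtype.dist_eq]
    have e1 : dist (SimpleFunc.nearestPt e N p).1 p.1 ≤ dist (SimpleFunc.nearestPt e N p) p :=
      le_max_left _ _
    have e2 : dist (SimpleFunc.nearestPt e N p).2 p.2 ≤ dist (SimpleFunc.nearestPt e N p) p :=
      le_max_right _ _
    linarith

/-- A coefficient that is continuous in `(x, ρ, u)` and measurable in the mark is jointly
measurable along a measurable family of joint laws. -/
theorem CoefContinuous.measurable_along {S Z Y : Type*} [MeasurableSpace S] [MeasurableSpace Z]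
    [TopologicalSpace Y] [TopologicalSpace.PseudoMetrizableSpace Y] [MeasurableSpace Y]
    [BorelSpace Y] {φ : Rn n → Measure (Rn n × U) → U → Z → Y}
    (hφ : ∀ z, CoefContinuous fun x ρ u => φ x ρ u z)
    (hφm : ∀ x ρ u, IsP2Joint ρ → Measurable (φ x ρ u)) (ρ : Kernel S (Rn n × U))
    (hρ : ∀ s, IsP2Joint (ρ s)) :
    Measurable fun q : S × Rn n × U × Z => φ q.2.1 (ρ q.1) q.2.2.1 q.2.2.2 := by
  have hprob : ∀ s, IsProbabilityMeasure (ρ s) := fun s => (hρ s).1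
  rcases isEmpty_or_nonempty (Rn n × U) with hX | hX
  · have : IsEmpty (S × Rn n × U × Z) :=
      ⟨fun q => hX.false (q.2.1, q.2.2.1)⟩
    exact measurable_of_empty _
  set e := TopologicalSpace.denseSeq (Rn n × U) with he
  refine measurable_of_tendsto_metrizable
    (f := fun N (q : S × Rn n × U × Z) => φ q.2.1
      (discreteMeasure (fun i : Fin (N + 1) => e i) (cellWeight e N (ρ q.1))) q.2.2.1 q.2.2.2)
    (fun N => ?_) (tendsto_pi_nhds.2 fun q => ?_)
  -- A Carathéodory function: continuous in `(x, w, u)` and measurable in the mark.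
  · have h1 : Measurable (Function.uncurry fun (c : Rn n × stdSimplex ℝ (Fin (N + 1)) × U) z =>
        φ c.1 (discreteMeasure (fun i : Fin (N + 1) => e i) c.2.1.1) c.2.2 z) :=
      measurable_uncurry_of_continuous_of_measurable
        (fun z => continuous_discreteMeasure (hφ z) fun i : Fin (N + 1) => e i)
        fun c => hφm _ _ _ (isP2Joint_discreteMeasure _ c.2.1.2)
    have hw : Measurable fun s => (⟨cellWeight e N (ρ s), cellWeight_mem e N (ρ s)⟩ :
        stdSimplex ℝ (Fin (N + 1))) := by
      refine Measurable.subtype_mk (measurable_pi_iff.2 fun i => ?_)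
      exact (ρ.measurable_coe (measurable_cellIndex e N (measurableSet_singleton i))).ennreal_toReal
    have h2 : Measurable fun q : S × Rn n × U × Z =>
        (((q.2.1, ⟨cellWeight e N (ρ q.1), cellWeight_mem e N (ρ q.1)⟩, q.2.2.1), q.2.2.2) :
          (Rn n × stdSimplex ℝ (Fin (N + 1)) × U) × Z) :=
      (((measurable_fst.comp measurable_snd).prodMk ((hw.comp measurable_fst).prodMk
        (measurable_fst.comp (measurable_snd.comp measurable_snd)))).prodMk
        (measurable_snd.comp (measurable_snd.comp measurable_snd)))
    exact h1.comp h2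
  · rw [tendsto_def]
    intro V hV
    obtain ⟨δ, hδ, h⟩ := hφ q.2.2.2 q.2.1 (ρ q.1) q.2.2.1 (hρ q.1) V hV
    filter_upwards [(tendsto_fmDist_quantization (TopologicalSpace.denseRange_denseSeq _)
      (ρ q.1)).eventually (gt_mem_nhds hδ)] with N hN
    refine h _ _ _ (isP2Joint_discreteMeasure _ (cellWeight_mem e N (ρ q.1))) (by simpa using hδ)
      ?_ (by simpa using hδ)
    rw [discreteMeasure_cellWeight]
    exact hN

end Quantization

/-! ### The averaged coefficients -/

section Averaged

variable {n d : ℕ} {B : Type*} [NormedAddCommGroup B] [NormedSpace ℝ B] [MeasurableSpace B]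
  [BorelSpace B] {U : Set B} {Z : Type*} [MeasurableSpace Z]

set_option linter.unusedSectionVars false

theorem CoefContinuous.comp_continuous {Y Y' : Type*} [TopologicalSpace Y] [TopologicalSpace Y']
    {φ : Rn n → Measure (Rn n × U) → U → Y} (h : CoefContinuous φ) {g : Y → Y'}
    (hg : Continuous g) : CoefContinuous fun x ρ u => g (φ x ρ u) := by
  intro x ρ u hρ V hV
  obtain ⟨δ, hδ, h'⟩ := h x ρ u hρ (g ⁻¹' V) (hg.continuousAt hV)
  exact ⟨δ, hδ, h'⟩

theorem fmDist_self (ρ : Measure (Rn n × U)) : fmDist ρ ρ ≤ 0 :=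
  fmDist_le le_rfl fun f _ _ => by simp

theorem CoefContinuous.continuous {Y : Type*} [TopologicalSpace Y]
    {φ : Rn n → Measure (Rn n × U) → U → Y} (h : CoefContinuous φ) {ρ : Measure (Rn n × U)}
    (hρ : IsP2Joint ρ) : Continuous fun q : Rn n × U => φ q.1 ρ q.2 := by
  rw [continuous_iff_continuousAt]
  intro q
  rw [ContinuousAt, tendsto_def]
  intro V hV
  obtain ⟨δ, hδ, h'⟩ := h q.1 ρ q.2 hρ V hV
  filter_upwards [(continuous_fst.tendsto q).eventually (Metric.ball_mem_nhds _ hδ),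
    (continuous_snd.tendsto q).eventually (Metric.ball_mem_nhds _ hδ)] with q' h1 h2
  exact h' _ _ _ hρ h1 ((fmDist_self ρ).trans_lt hδ) h2

variable [CompactSpace U]

theorem exists_norm_coe_le (U : Set B) [CompactSpace U] : ∃ c, 0 ≤ c ∧ ∀ u : U, ‖(u : B)‖ ≤ c := by
  obtain ⟨c, hc⟩ := (isCompact_univ (X := U)).exists_bound_of_continuousOn
    (f := fun u : U => (u : B)) continuous_subtype_val.continuousOn
  exact ⟨max c 0, le_max_right _ _, fun u => (hc u trivial).trans (le_max_left _ _)⟩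

theorem isP2Joint_compProd {m : Measure (Rn n)} (hm : IsP2 m) (κ : Kernel (Rn n) U)
    [IsMarkovKernel κ] : IsP2Joint (m ⊗ₘ κ) := by
  have := hm.1
  obtain ⟨c, hc0, hc⟩ := exists_norm_coe_le U
  refine ⟨inferInstance, ?_⟩
  have e : ∫⁻ p, ‖p.1‖ₑ ^ 2 ∂(m ⊗ₘ κ) = ∫⁻ x, ‖x‖ₑ ^ 2 ∂m := by
    conv_rhs => rw [← Measure.fst_compProd m κ]
    rw [Measure.fst, lintegral_map (by fun_prop) measurable_fst]
  calc _ ≤ ∫⁻ p, (‖p.1‖ₑ ^ 2 + ENNReal.ofReal c ^ 2) ∂(m ⊗ₘ κ) := by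
        refine lintegral_mono fun p => ?_
        gcongr
        rw [← ofReal_norm]
        exact ENNReal.ofReal_le_ofReal (hc _)
    _ = ∫⁻ x, ‖x‖ₑ ^ 2 ∂m + ENNReal.ofReal c ^ 2 := by
        rw [lintegral_add_right _ measurable_const, e]
        simp
    _ < ∞ := ENNReal.add_lt_top.2 ⟨hm.2, by finiteness⟩

/-- Since `U` is bounded, the control adds at most a constant to the second moment, whatever the
kernel. -/
theorem exists_M2_compProd_le (U : Set B) [CompactSpace U] (R : ℝ) : ∃ M, 0 ≤ M ∧
    ∀ (m : Measure (Rn n)) (κ : Kernel (Rn n) U), IsP2 m → IsMarkovKernel κ →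
      ∫ x, ‖x‖ ^ 2 ∂m ≤ R → M2 (m ⊗ₘ κ) ≤ M := by
  obtain ⟨c, hc0, hc⟩ := exists_norm_coe_le U
  refine ⟨Real.sqrt (R + c ^ 2), Real.sqrt_nonneg _, fun m κ hm _ hR => Real.sqrt_le_sqrt ?_⟩
  have := hm.1
  have hfst : (m ⊗ₘ κ).map Prod.fst = m := Measure.fst_compProd m κ
  have i1 : Integrable (fun p : Rn n × U => ‖p.1‖ ^ 2) (m ⊗ₘ κ) := by
    have := hm.integrable_sq
    rw [← hfst] at this
    exact this.comp_measurable measurable_fst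
  have e : ∫ p, ‖p.1‖ ^ 2 ∂(m ⊗ₘ κ) = ∫ x, ‖x‖ ^ 2 ∂m := by
    conv_rhs => rw [← hfst]
    rw [integral_map (by fun_prop) (by fun_prop)]
  calc _ ≤ ∫ p, (‖p.1‖ ^ 2 + c ^ 2) ∂(m ⊗ₘ κ) := by
        refine integral_mono_of_nonneg (Eventually.of_forall fun p => by positivity)
          (i1.add (integrable_const _)) (Eventually.of_forall fun p => ?_)
        dsimp only
        gcongr
        exact hc _
    _ = ∫ x, ‖x‖ ^ 2 ∂m + c ^ 2 := by
        rw [integral_add i1 (integrable_const _), e]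
        simp
    _ ≤ _ := by gcongr

variable {C : Coefficients n d U Z} {lam : Measure Z} [IsFiniteMeasure lam]

/-- Integrate `‖f‖ ≤ c + ‖f‖² / c`. With `c` of linear growth, a quadratic bound on the second
moment of `γ` under the finite measure `lam` becomes a linear bound on its first moment. -/
theorem lintegral_enorm_le {f : Z → Rn n} {c K : ℝ} (hc : 0 < c) (hK : 0 ≤ K)
    (h : ∫⁻ z, ‖f z‖ₑ ^ 2 ∂lam ≤ ENNReal.ofReal (K * c ^ 2)) :
    ∫⁻ z, ‖f z‖ₑ ∂lam ≤ ENNReal.ofReal ((lam.real univ + K) * c) := by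
  have key : ∀ z, ‖f z‖ₑ ≤ ENNReal.ofReal c + ENNReal.ofReal c⁻¹ * ‖f z‖ₑ ^ 2 := fun z => by
    rw [← ofReal_norm, ← ENNReal.ofReal_pow (norm_nonneg _), ← ENNReal.ofReal_mul (by positivity),
      ← ENNReal.ofReal_add hc.le (by positivity)]
    refine ENNReal.ofReal_le_ofReal ?_
    have : c + c⁻¹ * ‖f z‖ ^ 2 - ‖f z‖ = ((c - ‖f z‖) ^ 2 + c * ‖f z‖) / c := by
      field_simp
      ring
    have h2 : 0 ≤ ((c - ‖f z‖) ^ 2 + c * ‖f z‖) / c := by positivity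
    linarith
  calc _ ≤ ∫⁻ z, (ENNReal.ofReal c + ENNReal.ofReal c⁻¹ * ‖f z‖ₑ ^ 2) ∂lam := lintegral_mono key
    _ = ENNReal.ofReal c * lam univ + ENNReal.ofReal c⁻¹ * ∫⁻ z, ‖f z‖ₑ ^ 2 ∂lam := by
      rw [lintegral_add_left measurable_const, lintegral_const_mul' _ _ ENNReal.ofReal_ne_top,
        lintegral_const]
    _ ≤ ENNReal.ofReal c * ENNReal.ofReal (lam.real univ)
        + ENNReal.ofReal c⁻¹ * ENNReal.ofReal (K * c ^ 2) := by
      rw [ofReal_measureReal]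
      gcongr
    _ = _ := by
      rw [← ENNReal.ofReal_mul hc.le, ← ENNReal.ofReal_mul (by positivity),
        ← ENNReal.ofReal_add (by positivity) (by positivity)]
      congr 1
      field_simp

theorem Coefficients.Regular.measurable_γ_section (hC : C.Regular lam) {ρ : Measure (Rn n × U)}
    (hρ : IsP2Joint ρ) (x : Rn n) : Measurable fun q : U × Z => C.γ x ρ q.1 q.2 :=
  measurable_uncurry_of_continuous_of_measurable
    (fun z => ((hC.continuous_γ z).continuous hρ).comp (by fun_prop : Continuous fun u : U => (x, u)))
    fun u => hC.measurable_γ x ρ u hρ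

/-- The linear growth constant of `γ` may vary with the mark, so the bound comes from the
square-integral growth condition, after Tonelli has brought the integral over marks inside. -/
theorem Coefficients.Regular.norm_integral_γHat_le (hC : C.Regular lam) : ∃ K, 0 ≤ K ∧
    ∀ (m : Measure (Rn n)) (κ : Kernel (Rn n) U), IsP2 m → IsMarkovKernel κ → ∀ x,
      ‖∫ z, C.γHat x m κ z ∂lam‖ ≤ K * (1 + ‖x‖ + M2 (m ⊗ₘ κ)) := by
  obtain ⟨K', hK'⟩ := hC.growth_sq_γ
  set K := max K' 0
  have hK0 : 0 ≤ K := le_max_right _ _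
  refine ⟨lam.real univ + K, by positivity, fun m κ hm hκ x => ?_⟩
  have hρ := isP2Joint_compProd hm κ
  have hM : 0 ≤ M2 (m ⊗ₘ κ) := Real.sqrt_nonneg _
  have hc : 0 < 1 + ‖x‖ + M2 (m ⊗ₘ κ) := by positivity
  have hmeas := hC.measurable_γ_section hρ x
  rw [← ENNReal.ofReal_le_ofReal_iff (by positivity), ofReal_norm]
  calc _ ≤ ∫⁻ z, ‖C.γHat x m κ z‖ₑ ∂lam := enorm_integral_le_lintegral_enorm _
    _ ≤ ∫⁻ z, ∫⁻ u, ‖C.γ x (m ⊗ₘ κ) u z‖ₑ ∂(κ x) ∂lam :=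
      lintegral_mono fun z => enorm_integral_le_lintegral_enorm _
    _ = ∫⁻ u, ∫⁻ z, ‖C.γ x (m ⊗ₘ κ) u z‖ₑ ∂lam ∂(κ x) := by
      rw [lintegral_lintegral_swap]
      exact (hmeas.comp measurable_swap).enorm.aemeasurable
    _ ≤ ∫⁻ _u, ENNReal.ofReal ((lam.real univ + K) * (1 + ‖x‖ + M2 (m ⊗ₘ κ))) ∂(κ x) := by
      refine lintegral_mono fun u => lintegral_enorm_le hc hK0 ?_
      refine (hK' x _ u hρ).trans (ENNReal.ofReal_le_ofReal ?_)
      calc K' * (1 + ‖x‖ ^ 2 + M2 (m ⊗ₘ κ) ^ 2) ≤ K * (1 + ‖x‖ ^ 2 + M2 (m ⊗ₘ κ) ^ 2) := by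
            gcongr
            exact le_max_left _ _
        _ ≤ _ := by
          gcongr
          nlinarith [norm_nonneg x, mul_nonneg (norm_nonneg x) hM]
    _ = _ := by simp

theorem Coefficients.Regular.exists_growth (hC : C.Regular lam) (R : ℝ) : ∃ K, 0 ≤ K ∧
    ∀ (m : Measure (Rn n)) (κ : Kernel (Rn n) U), IsP2 m → ∫ x, ‖x‖ ^ 2 ∂m ≤ R →
      IsMarkovKernel κ → ∀ x,
      ‖C.bHat x m κ - ∫ z, C.γHat x m κ z ∂lam‖ ≤ K * (1 + ‖x‖) ∧
      ∀ i j, |C.aHat x m κ i j| ≤ K * (1 + ‖x‖ ^ 2) := by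
  obtain ⟨M, hM0, hM⟩ := exists_M2_compProd_le (n := n) U R
  obtain ⟨K₁', h₁⟩ := hC.growth_b
  obtain ⟨K₂', h₂⟩ := hC.growth_σ
  obtain ⟨K₃, hK₃, h₃⟩ := hC.norm_integral_γHat_le
  set K₁ := max K₁' 0
  set K₂ := max K₂' 0
  have hK₁ : 0 ≤ K₁ := le_max_right _ _
  have hK₂ : 0 ≤ K₂ := le_max_right _ _
  refine ⟨max ((K₁ + K₃) * (1 + M)) (2 * K₂ ^ 2 * (1 + M) ^ 2), by positivity,
    fun m κ hm hR hκ x => ?_⟩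
  have hρ := isP2Joint_compProd hm κ
  have hMρ := hM m κ hm hκ hR
  have hlin : 1 + ‖x‖ + M2 (m ⊗ₘ κ) ≤ (1 + M) * (1 + ‖x‖) := by
    nlinarith [norm_nonneg x, mul_nonneg hM0 (norm_nonneg x)]
  constructor
  · have e1 : ‖C.bHat x m κ‖ ≤ K₁ * (1 + ‖x‖ + M2 (m ⊗ₘ κ)) := by
      have := norm_integral_le_of_norm_le_const (μ := κ x)
        (f := fun u => C.b x (m ⊗ₘ κ) u) (C := K₁ * (1 + ‖x‖ + M2 (m ⊗ₘ κ)))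
        (Eventually.of_forall fun u => (h₁ x _ u hρ).trans (by
          have : 0 ≤ M2 (m ⊗ₘ κ) := Real.sqrt_nonneg _
          gcongr
          exact le_max_left _ _))
      simpa [Coefficients.bHat] using this
    calc _ ≤ ‖C.bHat x m κ‖ + ‖∫ z, C.γHat x m κ z ∂lam‖ := norm_sub_le _ _
      _ ≤ K₁ * (1 + ‖x‖ + M2 (m ⊗ₘ κ)) + K₃ * (1 + ‖x‖ + M2 (m ⊗ₘ κ)) :=
        add_le_add e1 (h₃ m κ hm hκ x)
      _ = (K₁ + K₃) * (1 + ‖x‖ + M2 (m ⊗ₘ κ)) := by ring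
      _ ≤ (K₁ + K₃) * ((1 + M) * (1 + ‖x‖)) := by gcongr
      _ = (K₁ + K₃) * (1 + M) * (1 + ‖x‖) := by ring
      _ ≤ _ := by
        gcongr
        exact le_max_left _ _
  · intro i j
    have hσ : ∀ u, |(C.σ x (m ⊗ₘ κ) u * (C.σ x (m ⊗ₘ κ) u).transpose) i j|
        ≤ (K₂ * (1 + ‖x‖ + M2 (m ⊗ₘ κ))) ^ 2 := by
      intro u
      set A := C.σ x (m ⊗ₘ κ) u
      have hrow : ∀ i, ∑ k, A i k ^ 2 ≤ ∑ i, ∑ k, A i k ^ 2 := fun i =>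
        Finset.single_le_sum (f := fun i => ∑ k, A i k ^ 2)
          (fun i _ => Finset.sum_nonneg fun k _ => sq_nonneg _) (Finset.mem_univ i)
      have hfro : ∑ i, ∑ k, A i k ^ 2 ≤ (K₂ * (1 + ‖x‖ + M2 (m ⊗ₘ κ))) ^ 2 := by
        have h0 : 0 ≤ ∑ i, ∑ k, A i k ^ 2 :=
          Finset.sum_nonneg fun i _ => Finset.sum_nonneg fun k _ => sq_nonneg _
        have hb : Real.sqrt (∑ i, ∑ k, A i k ^ 2) ≤ K₂ * (1 + ‖x‖ + M2 (m ⊗ₘ κ)) :=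
          (h₂ x _ u hρ).trans (by
            have : 0 ≤ M2 (m ⊗ₘ κ) := Real.sqrt_nonneg _
            gcongr
            exact le_max_left _ _)
        rw [← Real.sq_sqrt h0]
        gcongr
      have e : (A * A.transpose) i j = ∑ k, A i k * A j k := by
        simp [Matrix.mul_apply]
      rw [e]
      refine le_trans ?_ hfro
      calc |∑ k, A i k * A j k| ≤ ∑ k, |A i k * A j k| := Finset.abs_sum_le_sum_abs _ _
        _ ≤ ∑ k, (A i k ^ 2 / 2 + A j k ^ 2 / 2) := Finset.sum_le_sum fun k _ => by
          rw [abs_le]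
          constructor <;> nlinarith [sq_nonneg (A i k + A j k), sq_nonneg (A i k - A j k)]
        _ = (∑ k, A i k ^ 2) / 2 + (∑ k, A j k ^ 2) / 2 := by
          rw [Finset.sum_add_distrib, Finset.sum_div, Finset.sum_div]
        _ ≤ _ := by linarith [hrow i, hrow j]
    have := norm_integral_le_of_norm_le_const (μ := κ x)
      (f := fun u => (C.σ x (m ⊗ₘ κ) u * (C.σ x (m ⊗ₘ κ) u).transpose) i j)
      (Eventually.of_forall hσ)
    have hM' : 0 ≤ M2 (m ⊗ₘ κ) := Real.sqrt_nonneg _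
    calc |C.aHat x m κ i j| ≤ (K₂ * (1 + ‖x‖ + M2 (m ⊗ₘ κ))) ^ 2 := by
          simpa [Coefficients.aHat] using this
      _ ≤ (K₂ * ((1 + M) * (1 + ‖x‖))) ^ 2 := by gcongr
      _ = K₂ ^ 2 * (1 + M) ^ 2 * (1 + ‖x‖) ^ 2 := by ring
      _ ≤ K₂ ^ 2 * (1 + M) ^ 2 * (2 * (1 + ‖x‖ ^ 2)) := by
        gcongr
        nlinarith [sq_nonneg (‖x‖ - 1)]
      _ = 2 * K₂ ^ 2 * (1 + M) ^ 2 * (1 + ‖x‖ ^ 2) := by ring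
      _ ≤ _ := by
        gcongr
        exact le_max_right _ _

/-- The averaged coefficients along a flow define a flow with measurable coefficients. -/
theorem Coefficients.Regular.isFlow (hC : C.Regular lam) {m : Kernel ℝ (Rn n)}
    (hm : ∀ r, IsP2 (m r)) {R : ℝ} (hR : ∀ r, ∫ x, ‖x‖ ^ 2 ∂(m r) ≤ R)
    (hr : ∀ s, Tendsto (fun r => W2 (m r) (m s)) (𝓝[>] s) (𝓝 0)) (α : Kernel (ℝ × Rn n) U)
    [IsMarkovKernel α] : ∃ K, IsFlow m
      (fun r x => C.bHat x (m r) (α.sectR r) - ∫ z, C.γHat x (m r) (α.sectR r) z ∂lam)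
      (fun r x => C.aHat x (m r) (α.sectR r)) R K := by
  obtain ⟨K, -, hK⟩ := hC.exists_growth R
  have : IsMarkovKernel m := ⟨fun r => (hm r).1⟩
  -- The joint laws form a kernel in time, which is the measurability in `r` that quantization
  -- requires.
  have hρ : ∀ r, (m ⊗ₖ α) r = m r ⊗ₘ α.sectR r := fun r =>
    Kernel.compProd_apply_eq_compProd_sectR m α r
  have hρ2 : ∀ r, IsP2Joint ((m ⊗ₖ α) r) := fun r => by
    rw [hρ]
    exact isP2Joint_compProd (hm r) _
  have hb : Measurable fun q : ℝ × Rn n => C.bHat q.2 (m q.1) (α.sectR q.1) := by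
    -- A coefficient without mark is treated as one with a trivial mark space.
    have h1 := CoefContinuous.measurable_along (Z := Unit) (φ := fun x ρ u _ => C.b x ρ u)
      (fun _ => hC.continuous_b) (fun _ _ _ _ => measurable_const) (m ⊗ₖ α) hρ2
    have h2 : Measurable fun q : (ℝ × Rn n) × U => C.b q.1.2 ((m ⊗ₖ α) q.1.1) q.2 :=
      h1.comp (by fun_prop : Measurable fun q : (ℝ × Rn n) × U => (q.1.1, q.1.2, q.2, ()))
    have h3 := (h2.stronglyMeasurable.integral_kernel_prod_right' (κ := α)).measurable
    simp only [hρ] at h3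
    exact h3
  have hγ : Measurable fun q : ℝ × Rn n => ∫ z, C.γHat q.2 (m q.1) (α.sectR q.1) z ∂lam := by
    have h1 := CoefContinuous.measurable_along (φ := C.γ) hC.continuous_γ hC.measurable_γ
      (m ⊗ₖ α) hρ2
    have h2 : Measurable fun q : ((ℝ × Rn n) × Z) × U =>
        C.γ q.1.1.2 ((m ⊗ₖ α) q.1.1.1) q.2 q.1.2 :=
      h1.comp (by fun_prop : Measurable fun q : ((ℝ × Rn n) × Z) × U =>
        (q.1.1.1, q.1.1.2, q.2, q.1.2))
    have h3 := h2.stronglyMeasurable.integral_kernel_prod_right' (κ := α.prodMkRight Z)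
    have h4 := (h3.integral_prod_right' (ν := lam)).measurable
    simp only [hρ] at h4
    exact h4
  have ha : ∀ i j, Measurable fun q : ℝ × Rn n => C.aHat q.2 (m q.1) (α.sectR q.1) i j := by
    intro i j
    have hc : Continuous fun A : Matrix (Fin n) (Fin d) ℝ => (A * A.transpose) i j := by
      have : Continuous fun A : Matrix (Fin n) (Fin d) ℝ => A * A.transpose := by fun_prop
      exact this.matrix_elem i j
    have h1 := CoefContinuous.measurable_along (Z := Unit)
      (φ := fun x ρ u _ => (C.σ x ρ u * (C.σ x ρ u).transpose) i j)
      (fun _ => hC.continuous_σ.comp_continuous hc) (fun _ _ _ _ => measurable_const) (m ⊗ₖ α) hρ2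
    have h2 : Measurable fun q : (ℝ × Rn n) × U =>
        (C.σ q.1.2 ((m ⊗ₖ α) q.1.1) q.2 * (C.σ q.1.2 ((m ⊗ₖ α) q.1.1) q.2).transpose) i j :=
      h1.comp (by fun_prop : Measurable fun q : (ℝ × Rn n) × U => (q.1.1, q.1.2, q.2, ()))
    have h3 := (h2.stronglyMeasurable.integral_kernel_prod_right' (κ := α)).measurable
    simp only [hρ] at h3
    exact h3
  exact ⟨K, hm, hR, hb.sub hγ, ha, fun r x => (hK _ _ (hm r) (hR r) inferInstance x).1,
    fun r x => (hK _ _ (hm r) (hR r) inferInstance x).2, hr⟩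

end Averaged

/-! ### The atoms of the noise -/

section PoissonAtoms

variable {Ω Z : Type*} [MeasurableSpace Ω] [MeasurableSpace Z]

/-- A finite counting measure on `ℝ × Z` that has at most one atom at a time. -/
structure IsSimpleCounting (ν : Measure (ℝ × Z)) : Prop where
  finite : IsFiniteMeasure ν
  counting : ∀ A, MeasurableSet A → ∃ k : ℕ∞, ν A = (k : ℝ≥0∞)
  simple : ∀ s : ℝ, ν ({s} ×ˢ univ) ≤ 1

/-- From `exp (-a) ≥ 1 - a` one gets `1 - exp (-a) * (1 + a) ≤ a²`. A bound of second order is what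
survives summation over a fine partition. -/
theorem poissonMeasure_Ici_two_le (a : NNReal) :
    poissonMeasure a {k | 2 ≤ k} ≤ ENNReal.ofReal ((a : ℝ) ^ 2) := by
  have hc : ({k | 2 ≤ k} : Set ℕ) = ((({0, 1} : Finset ℕ) : Set ℕ))ᶜ := by
    ext k
    simp only [mem_ofPred_eq, Finset.coe_insert, Finset.coe_singleton, mem_compl_iff,
      mem_insert_iff, mem_singleton_iff]
    omega
  rw [← ofReal_measureReal]
  refine ENNReal.ofReal_le_ofReal ?_
  rw [hc, probReal_compl_eq_one_sub (Finset.measurableSet _), ← sum_measureReal_singleton,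
    Finset.sum_pair (by norm_num), poissonMeasure_real_singleton, poissonMeasure_real_singleton]
  have h := Real.add_one_le_exp (-(a : ℝ))
  have ha : 0 ≤ (a : ℝ) := a.2
  simp only [pow_zero, Nat.factorial_zero, Nat.cast_one, pow_one, Nat.factorial_one, div_one]
  nlinarith

namespace IsPoissonRandomMeasure

variable {S : Type*} [MeasurableSpace S] {P : Measure Ω} {N : Ω → Measure S} {ν : Measure S}

theorem ae_lt_top (h : IsPoissonRandomMeasure P N ν) {A : Set S} (hA : MeasurableSet A)
    (hν : ν A ≠ ∞) : ∀ᵐ ω ∂P, N ω A < ∞ := by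
  have hm := h.measurable A hA
  rw [ae_iff]
  have : P {ω | ¬N ω A < ∞} = (P.map fun ω => N ω A) {∞} := by
    rw [Measure.map_apply hm (measurableSet_singleton _)]
    congr 1
    ext ω
    simp
  rw [this, h.law A hA hν, Measure.map_apply (measurable_of_countable _) (measurableSet_singleton _)]
  have : (fun k : ℕ => (k : ℝ≥0∞)) ⁻¹' {∞} = ∅ := by
    ext k
    simp
  rw [this, measure_empty]

theorem measure_two_le (h : IsPoissonRandomMeasure P N ν) {A : Set S} (hA : MeasurableSet A)
    (hν : ν A ≠ ∞) : P {ω | 2 ≤ N ω A} ≤ ENNReal.ofReal ((ν A).toReal ^ 2) := by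
  have hm := h.measurable A hA
  have e : P {ω | 2 ≤ N ω A} = (P.map fun ω => N ω A) (Ici 2) := by
    rw [Measure.map_apply hm measurableSet_Ici]
    rfl
  rw [e, h.law A hA hν, Measure.map_apply (measurable_of_countable _) measurableSet_Ici]
  have : (fun k : ℕ => (k : ℝ≥0∞)) ⁻¹' Ici 2 = {k | 2 ≤ k} := by
    ext k
    simp only [mem_preimage, mem_Ici, mem_ofPred_eq]
    exact_mod_cast Iff.rfl
  rw [this]
  exact poissonMeasure_Ici_two_le _

end IsPoissonRandomMeasure

theorem two_le_of_not_le_one {x : ℝ≥0∞} (h : ∃ k : ℕ∞, x = (k : ℝ≥0∞)) (hx : ¬x ≤ 1) : 2 ≤ x := by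
  obtain ⟨k, rfl⟩ := h
  induction k using ENat.recTopCoe with
  | top => simp
  | coe k =>
    simp only [ENat.toENNReal_coe, not_le] at hx ⊢
    have : 1 < k := by exact_mod_cast hx
    exact_mod_cast this

/-- Almost every path of a Poisson random measure with intensity `ds λ(dz)` is simple. -/
theorem IsPoissonRandomMeasure.ae_isSimpleCounting {P : Measure Ω} {N : Ω → Measure (ℝ × Z)}
    {T : ℝ} (hT : 0 < T) {lam : Measure Z} [IsFiniteMeasure lam]
    (hN : IsPoissonRandomMeasure P N ((volume.restrict (Ioc 0 T)).prod lam)) :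
    ∀ᵐ ω ∂P, IsSimpleCounting ((N ω).restrict (Ioc 0 T ×ˢ univ)) := by
  have hS : MeasurableSet (Ioc 0 T ×ˢ (univ : Set Z)) := measurableSet_Ioc.prod MeasurableSet.univ
  have hfin := hN.ae_lt_top hS (by finiteness)
  have hsimple : ∀ᵐ ω ∂P, (∀ A, MeasurableSet A → ∃ k : ℕ∞, N ω A = (k : ℝ≥0∞)) →
      ∀ s ∈ Ioc 0 T, N ω ({s} ×ˢ univ) ≤ 1 := by
    rw [ae_iff]
    set bad := {ω | ¬((∀ A, MeasurableSet A → ∃ k : ℕ∞, N ω A = (k : ℝ≥0∞)) →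
      ∀ s ∈ Ioc 0 T, N ω ({s} ×ˢ univ) ≤ 1)} with hbad
    set c := T * lam.real univ with hc
    -- Cut `(0, T]` into `q = k + 1` cells of intensity at most `c / q`. Two atoms at the same time
    -- lie in one cell, which has probability at most `(c / q)²`; the sum over cells is `c² / q`.
    -- Only the outer measure of `bad` is estimated, so its measurability plays no role.
    have hbound : ∀ k : ℕ, P bad ≤ ENNReal.ofReal (c ^ 2 * (1 / ((k : ℝ) + 1))) := by
      intro k
      set q : ℝ := (k : ℝ) + 1 with hq
      have hq0 : 0 < q := by positivity
      set A : ℕ → Set (ℝ × Z) := fun i => Ioc (i * (T / q)) ((i + 1) * (T / q)) ×ˢ univ with hA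
      have hAm : ∀ i, MeasurableSet (A i) := fun i => measurableSet_Ioc.prod MeasurableSet.univ
      have hAν : ∀ i, ((volume.restrict (Ioc 0 T)).prod lam) (A i) ≤ ENNReal.ofReal (c / q) := by
        intro i
        rw [hA, Measure.prod_prod]
        calc _ ≤ volume (Ioc (i * (T / q)) ((i + 1) * (T / q))) * lam univ := by
              gcongr
              exact Measure.restrict_le_self
          _ = ENNReal.ofReal (T / q) * ENNReal.ofReal (lam.real univ) := by
              rw [Real.volume_Ioc, ofReal_measureReal]
              congr 2
              ring
          _ = ENNReal.ofReal (c / q) := by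
              rw [← ENNReal.ofReal_mul (by positivity), hc]
              congr 1
              ring
      have hsub : bad ⊆ ⋃ i ∈ Finset.range (k + 1), {ω | 2 ≤ N ω (A i)} := by
        intro ω hω
        rw [hbad, mem_ofPred_eq] at hω
        push Not at hω
        obtain ⟨hcount, s, hs, hgt⟩ := hω
        have h2 : 2 ≤ N ω ({s} ×ˢ univ) := two_le_of_not_le_one
          (hcount _ ((measurableSet_singleton s).prod MeasurableSet.univ)) (not_le.2 hgt)
        set y := s / (T / q) with hy
        have hTq : 0 < T / q := by positivity
        have hy0 : 0 < y := div_pos hs.1 hTq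
        have hyq : y ≤ q := by
          rw [hy, div_le_iff₀ hTq, mul_div_cancel₀ _ hq0.ne']
          exact hs.2
        -- The cells are open on the left, so the one containing `s` has index `⌈y⌉₊ - 1`;
        -- positivity makes the natural subtraction genuine.
        have hceil : 0 < ⌈y⌉₊ := Nat.ceil_pos.2 hy0
        have hcast : ((⌈y⌉₊ - 1 : ℕ) : ℝ) = (⌈y⌉₊ : ℝ) - 1 := by
          rw [Nat.cast_sub hceil, Nat.cast_one]
        refine mem_iUnion₂.2 ⟨⌈y⌉₊ - 1, ?_, h2.trans (measure_mono ?_)⟩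
        · have : ⌈y⌉₊ ≤ k + 1 := Nat.ceil_le.2 (by push_cast; exact hyq)
          rw [Finset.mem_range]
          omega
        · refine prod_mono (singleton_subset_iff.2 ?_) subset_rfl
          have hs' : s = y * (T / q) := by rw [hy, div_mul_cancel₀ _ hTq.ne']
          rw [hcast]
          constructor
          · rw [hs']
            gcongr
            linarith [Nat.ceil_lt_add_one hy0.le]
          · rw [hs']
            gcongr
            linarith [Nat.le_ceil y]
      calc P bad ≤ P (⋃ i ∈ Finset.range (k + 1), {ω | 2 ≤ N ω (A i)}) := measure_mono hsub
        _ ≤ ∑ i ∈ Finset.range (k + 1), P {ω | 2 ≤ N ω (A i)} := measure_biUnion_finset_le _ _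
        _ ≤ ∑ i ∈ Finset.range (k + 1), ENNReal.ofReal ((c / q) ^ 2) := by
          refine Finset.sum_le_sum fun i _ => (hN.measure_two_le (hAm i) ?_).trans ?_
          · exact ((hAν i).trans_lt ENNReal.ofReal_lt_top).ne
          · refine ENNReal.ofReal_le_ofReal ?_
            gcongr
            exact ENNReal.toReal_le_of_le_ofReal (by positivity) (hAν i)
        _ = ENNReal.ofReal (c ^ 2 * (1 / q)) := by
          rw [Finset.sum_const, Finset.card_range, nsmul_eq_mul, ← ENNReal.ofReal_natCast,
            ← ENNReal.ofReal_mul (by positivity)]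
          congr 1
          push_cast
          rw [← hq]
          field_simp
    have h0 := (tendsto_one_div_add_atTop_nhds_zero_nat (𝕜 := ℝ)).const_mul (c ^ 2)
    rw [mul_zero] at h0
    have h1 := ENNReal.tendsto_ofReal h0
    rw [ENNReal.ofReal_zero] at h1
    exact le_antisymm (ge_of_tendsto' h1 hbound) zero_le
  filter_upwards [hfin, hN.counting, hsimple] with ω h1 h2 h3
  refine ⟨⟨by rwa [Measure.restrict_apply_univ]⟩, fun A hA => ?_, fun s => ?_⟩
  · rw [Measure.restrict_apply hA]
    exact h2 _ (hA.inter hS)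
  · by_cases hs : s ∈ Ioc 0 T
    · exact (Measure.restrict_apply_le _ _).trans (h3 h2 s hs)
    · rw [Measure.restrict_apply ((measurableSet_singleton s).prod MeasurableSet.univ)]
      have : ({s} ×ˢ univ ∩ Ioc 0 T ×ˢ univ : Set (ℝ × Z)) = ∅ := by
        rw [prod_inter_prod, singleton_inter_eq_empty.2 hs, empty_prod]
      simp [this]

namespace IsSimpleCounting

variable {ν : Measure (ℝ × Z)}

theorem eq_zero_of_lt_one (h : IsSimpleCounting ν) {A : Set (ℝ × Z)} (hA : MeasurableSet A)
    (h1 : ν A < 1) : ν A = 0 := by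
  obtain ⟨k, hk⟩ := h.counting A hA
  rw [hk] at h1 ⊢
  have : k < 1 := by
    rw [← ENat.toENNReal_one] at h1
    exact ENat.toENNReal_lt.mp h1
  rw [Order.lt_one_iff.mp this]
  simp

/-- The sets decrease to the empty set and `ν` is finite, so their masses tend to 0; being integers,
they eventually vanish. This replaces an enumeration of the atoms. -/
theorem eventually_right (h : IsSimpleCounting ν) (s : ℝ) :
    ∀ᶠ s' in 𝓝[>] s, ν (Ioc s s' ×ˢ univ) = 0 := by
  have := h.finite
  have hlim := tendsto_measure_biInter_gt (μ := ν) (s := fun r => Ioc s r ×ˢ (univ : Set Z))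
    (a := s) (fun r _ => (measurableSet_Ioc.prod MeasurableSet.univ).nullMeasurableSet)
    (fun i j _ hij => prod_mono (Ioc_subset_Ioc_right hij) subset_rfl)
    ⟨s + 1, by simp, measure_ne_top _ _⟩
  have hempty : (⋂ r > s, Ioc s r ×ˢ (univ : Set Z)) = ∅ := by
    refine eq_empty_of_forall_notMem fun p hp => ?_
    simp only [mem_iInter] at hp
    have h1 : s < p.1 := (hp (s + 1) (by simp)).1.1
    have h2 := (hp ((s + p.1) / 2) (by simp only [gt_iff_lt]; linarith)).1.2
    linarith
  rw [hempty, measure_empty] at hlim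
  filter_upwards [hlim.eventually (gt_mem_nhds zero_lt_one)] with s' hs'
  exact h.eq_zero_of_lt_one (measurableSet_Ioc.prod MeasurableSet.univ) hs'

theorem eventually_left (h : IsSimpleCounting ν) (s : ℝ) :
    ∀ᶠ s' in 𝓝[<] s, ν (Ioo s' s ×ˢ univ) = 0 := by
  have := h.finite
  have hlim := tendsto_measure_biInter_gt (μ := ν) (s := fun r => Ioo (s - r) s ×ˢ (univ : Set Z))
    (a := 0) (fun r _ => (measurableSet_Ioo.prod MeasurableSet.univ).nullMeasurableSet)
    (fun i j _ hij => prod_mono (Ioo_subset_Ioo_left (by linarith)) subset_rfl)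
    ⟨1, by simp, measure_ne_top _ _⟩
  have hempty : (⋂ r > (0 : ℝ), Ioo (s - r) s ×ˢ (univ : Set Z)) = ∅ := by
    refine eq_empty_of_forall_notMem fun p hp => ?_
    simp only [mem_iInter] at hp
    have h1 : p.1 < s := (hp 1 (by simp)).1.2
    have h2 := (hp ((s - p.1) / 2) (by simp only [gt_iff_lt]; linarith)).1.1
    linarith
  rw [hempty, measure_empty] at hlim
  have hsub : Tendsto (fun s' => s - s') (𝓝[<] s) (𝓝[>] 0) := by
    refine tendsto_nhdsWithin_iff.2 ⟨?_, ?_⟩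
    · have : Continuous fun s' => s - s' := by fun_prop
      simpa using (this.tendsto s).mono_left nhdsWithin_le_nhds
    · filter_upwards [self_mem_nhdsWithin] with s' hs'
      simpa using hs'
  filter_upwards [(hlim.comp hsub).eventually (gt_mem_nhds zero_lt_one)] with s' hs'
  have e : s - (s - s') = s' := by ring
  simp only [Function.comp_apply, e] at hs'
  exact h.eq_zero_of_lt_one (measurableSet_Ioo.prod MeasurableSet.univ) hs'

/-- The law of the marks of the atoms at time `s`. -/
noncomputable def _root_.MFC.slice (ν : Measure (ℝ × Z)) (s : ℝ) : Measure Z :=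
  (ν.restrict ({s} ×ˢ univ)).map Prod.snd

theorem _root_.MFC.slice_apply (ν : Measure (ℝ × Z)) (s : ℝ) {A : Set Z} (hA : MeasurableSet A) :
    slice ν s A = ν ({s} ×ˢ A) := by
  rw [slice, Measure.map_apply measurable_snd hA, Measure.restrict_apply (measurable_snd hA)]
  congr 1
  ext p
  simp [and_comm]

/-- The slice is integer valued with total mass at most 1, hence takes only the values 0 and 1. A
function into a space with a countable separating family of measurable sets is then almost
everywhere constant, even if the slice is not a Dirac mass. -/
theorem exists_ae_slice_eq (h : IsSimpleCounting ν) (s : ℝ) {Y : Type*} [TopologicalSpace Y]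
    [T0Space Y] [SecondCountableTopology Y] [MeasurableSpace Y] [BorelSpace Y] [Nonempty Y]
    {f : Z → Y} (hf : Measurable f) : ∃ c, ∀ᵐ z ∂(slice ν s), f z = c := by
  have := h.finite
  refine exists_eventuallyEq_const_of_forall_separating (l := ae (slice ν s)) MeasurableSet
    fun V hV => ?_
  have hA := hf hV
  have hA' := hf hV.compl
  have hsum : slice ν s (f ⁻¹' V) + slice ν s (f ⁻¹' Vᶜ) ≤ 1 := by
    rw [preimage_compl, measure_add_measure_compl hA, slice_apply ν s MeasurableSet.univ]
    exact h.simple s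
  have hm : ∀ {A : Set Z}, MeasurableSet A → MeasurableSet (({s} : Set ℝ) ×ˢ A) := fun hA =>
    (measurableSet_singleton s).prod hA
  by_cases h1 : slice ν s (f ⁻¹' V) < 1
  · right
    rw [slice_apply ν s hA] at h1
    have := h.eq_zero_of_lt_one (hm hA) h1
    rw [← slice_apply ν s hA] at this
    exact measure_eq_zero_iff_ae_notMem.1 this
  · left
    have h2 : slice ν s (f ⁻¹' Vᶜ) = 0 := by
      by_contra h0
      have : 1 < slice ν s (f ⁻¹' V) + slice ν s (f ⁻¹' Vᶜ) :=
        calc 1 ≤ slice ν s (f ⁻¹' V) := not_lt.1 h1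
          _ < _ := ENNReal.lt_add_right (by
            rw [slice_apply ν s hA]
            exact measure_ne_top _ _) h0
      exact absurd hsum (not_le.2 this)
    filter_upwards [measure_eq_zero_iff_ae_notMem.1 h2] with z hz
    simpa using hz

/-- Almost everywhere constancy on the slice already gives integrability, so integrands such as
those built from `J` need no separate measurability proof. -/
theorem integral_slice (h : IsSimpleCounting ν) {s : ℝ} {Φ : ℝ × Z → ℝ} {c : ℝ}
    (hΦ : ∀ᵐ z ∂(slice ν s), Φ (s, z) = c) :
    IntegrableOn Φ ({s} ×ˢ univ) ν ∧
      ∫ p in {s} ×ˢ univ, Φ p ∂ν = ν.real ({s} ×ˢ univ) * c := by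
  have := h.finite
  have hae : Φ =ᵐ[ν.restrict ({s} ×ˢ univ)] fun _ => c := by
    have h1 := ae_of_ae_map measurable_snd.aemeasurable hΦ
    filter_upwards [h1, ae_restrict_mem ((measurableSet_singleton s).prod MeasurableSet.univ)]
      with p hp hps
    rw [← hp]
    congr 1
    exact Prod.ext hps.1 rfl
  refine ⟨(integrable_const c).congr hae.symm, ?_⟩
  rw [integral_congr_ae hae, integral_const, smul_eq_mul, measureReal_restrict_apply_univ]

/-- Every time has a neighbourhood in which only its own slice can carry mass; compactness of `[a,
b]` leaves finitely many of these. -/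
theorem integrableOn_of_slices (h : IsSimpleCounting ν) {a b : ℝ} {Φ : ℝ × Z → ℝ}
    (hΦ : ∀ s ∈ Ioc a b, IntegrableOn Φ ({s} ×ˢ univ) ν) : IntegrableOn Φ (Ioc a b ×ˢ univ) ν := by
  have hcomp : IntegrableOn Φ ((Icc a b ∩ Ioc a b) ×ˢ univ) ν := by
    refine isCompact_Icc.induction_on (p := fun A => IntegrableOn Φ ((A ∩ Ioc a b) ×ˢ univ) ν)
      (by simp) (fun A A' hAA hA => hA.mono_set (by gcongr)) (fun A A' hA hA' => ?_)
      fun s _ => ?_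
    · rw [union_inter_distrib_right, union_prod]
      exact hA.union hA'
    · obtain ⟨r, hr, hrs⟩ := ((h.eventually_right s).and self_mem_nhdsWithin).exists
      obtain ⟨l, hl, hls⟩ := ((h.eventually_left s).and self_mem_nhdsWithin).exists
      refine ⟨Ioo l r, mem_nhdsWithin_of_mem_nhds (Ioo_mem_nhds hls hrs), ?_⟩
      have h0 : IntegrableOn Φ ((({s} : Set ℝ) ∩ Ioc a b) ×ˢ univ) ν := by
        by_cases hs : s ∈ Ioc a b
        · rw [inter_eq_left.2 (singleton_subset_iff.2 hs)]
          exact hΦ s hs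
        · rw [singleton_inter_eq_empty.2 hs, empty_prod]
          exact integrableOn_empty
      have h1 : IntegrableOn Φ (Ioc s r ×ˢ univ) ν := by
        rw [IntegrableOn, Measure.restrict_eq_zero.2 hr]
        exact integrable_zero_measure
      have h2 : IntegrableOn Φ (Ioo l s ×ˢ univ) ν := by
        rw [IntegrableOn, Measure.restrict_eq_zero.2 hl]
        exact integrable_zero_measure
      refine ((h0.union h1).union h2).mono_set fun p hp => ?_
      rcases lt_trichotomy p.1 s with hlt | heq | hgt
      · exact Or.inr ⟨⟨hp.1.1.1, hlt⟩, trivial⟩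
      · exact Or.inl (Or.inl ⟨⟨heq, hp.1.2⟩, trivial⟩)
      · exact Or.inl (Or.inr ⟨⟨hgt, hp.1.1.2.le⟩, trivial⟩)
  rwa [inter_eq_right.2 Ioc_subset_Icc_self] at hcomp

/-- The range of `s'` does not depend on `Φ`. Hence the jump-free equation to the right of `s` holds
for all test functions on one common interval. -/
theorem eventually_integral_right (h : IsSimpleCounting ν) {t s : ℝ} (hts : t ≤ s) :
    ∀ᶠ s' in 𝓝[>] s, ∀ Φ : ℝ × Z → ℝ,
      ∫ p in Ioc t s' ×ˢ univ, Φ p ∂ν = ∫ p in Ioc t s ×ˢ univ, Φ p ∂ν := by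
  filter_upwards [h.eventually_right s, self_mem_nhdsWithin] with s' hs' hss Φ
  refine setIntegral_congr_set ?_
  have : Ioc t s' ×ˢ (univ : Set Z) = Ioc t s ×ˢ univ ∪ Ioc s s' ×ˢ univ := by
    rw [← union_prod, Ioc_union_Ioc_eq_Ioc hts (le_of_lt hss)]
  rw [this]
  exact union_ae_eq_left_of_ae_eq_empty (ae_eq_empty.2 hs')

theorem eventually_integral_left (h : IsSimpleCounting ν) {t s : ℝ} (hts : t < s) :
    ∀ᶠ s' in 𝓝[<] s, ∀ Φ : ℝ × Z → ℝ, IntegrableOn Φ (Ioc t s ×ˢ univ) ν →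
      ∫ p in Ioc t s ×ˢ univ, Φ p ∂ν
        = ∫ p in Ioc t s' ×ˢ univ, Φ p ∂ν + ∫ p in {s} ×ˢ univ, Φ p ∂ν := by
  filter_upwards [h.eventually_left s, Ioo_mem_nhdsLT hts] with s' hs' hss Φ hΦ
  have e1 : Ioc t s ×ˢ (univ : Set Z) = (Ioc t s' ×ˢ univ ∪ {s} ×ˢ univ) ∪ Ioo s' s ×ˢ univ := by
    rw [← union_prod, ← union_prod]
    congr 1
    ext r
    simp only [mem_union, mem_Ioc, mem_singleton_iff, mem_Ioo]
    have h1 := hss.1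
    have h2 := hss.2
    constructor
    · rintro ⟨h3, h4⟩
      rcases le_or_gt r s' with h5 | h5
      · exact Or.inl (Or.inl ⟨h3, h5⟩)
      · rcases h4.lt_or_eq with h6 | h6
        · exact Or.inr ⟨h5, h6⟩
        · exact Or.inl (Or.inr h6)
    · rintro ((⟨h3, h4⟩ | h3) | ⟨h3, h4⟩)
      · exact ⟨h3, h4.trans h2.le⟩
      · exact ⟨h3 ▸ h1.trans h2, h3.le⟩
      · exact ⟨h1.trans h3, h4.le⟩
  have e2 : ∫ p in Ioc t s ×ˢ univ, Φ p ∂ν = ∫ p in Ioc t s' ×ˢ univ ∪ {s} ×ˢ univ, Φ p ∂ν := by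
    refine setIntegral_congr_set ?_
    rw [e1]
    exact union_ae_eq_left_of_ae_eq_empty (ae_eq_empty.2 hs')
  rw [e2, setIntegral_union ?_ ((measurableSet_singleton s).prod MeasurableSet.univ)
    (hΦ.mono_set (prod_mono (Ioc_subset_Ioc_right hss.2.le) subset_rfl))
    (hΦ.mono_set (prod_mono (singleton_subset_iff.2 ⟨hts, le_rfl⟩) subset_rfl))]
  rw [disjoint_left]
  rintro p hp hp'
  have : p.1 = s := hp'.1
  linarith [hp.1.2, hss.2]

end IsSimpleCounting

end PoissonAtoms

/-! ### Càdlàg paths of measures -/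

section Cadlag

variable {n : ℕ} {t T : ℝ}

/-- Local bounds on both sides together with the value at the point, made uniform by compactness. No
limit of `g` itself is required. -/
theorem exists_bound_of_cadlag {g : ℝ → ℝ}
    (hr : ∀ s ∈ Ico t T, ∃ C, ∀ᶠ r in 𝓝[>] s, r ∈ Icc t T → |g r| ≤ C)
    (hl : ∀ s ∈ Ioc t T, ∃ C, ∀ᶠ r in 𝓝[<] s, r ∈ Icc t T → |g r| ≤ C) :
    ∃ C, ∀ r ∈ Icc t T, |g r| ≤ C := by
  refine isCompact_Icc.induction_on (p := fun A => ∃ C, ∀ r ∈ A, |g r| ≤ C) ⟨0, by simp⟩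
    (fun A A' hAA ⟨C, hC⟩ => ⟨C, fun r hr => hC r (hAA hr)⟩)
    (fun A A' ⟨C, hC⟩ ⟨C', hC'⟩ => ⟨max C C', fun r hr => ?_⟩) fun s hs => ?_
  · rcases hr with hr | hr
    · exact (hC r hr).trans (le_max_left _ _)
    · exact (hC' r hr).trans (le_max_right _ _)
  · have h1 : ∃ C, ∀ᶠ r in 𝓝[>] s, r ∈ Icc t T → |g r| ≤ C := by
      rcases hs.2.lt_or_eq with h | h
      · exact hr s ⟨hs.1, h⟩
      · refine ⟨0, ?_⟩
        filter_upwards [self_mem_nhdsWithin] with r hr' hrI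
        exact absurd hrI.2 (not_le.2 (h ▸ hr'))
    have h2 : ∃ C, ∀ᶠ r in 𝓝[<] s, r ∈ Icc t T → |g r| ≤ C := by
      rcases hs.1.lt_or_eq with h | h
      · exact hl s ⟨h, hs.2⟩
      · refine ⟨0, ?_⟩
        filter_upwards [self_mem_nhdsWithin] with r hr' hrI
        exact absurd hrI.1 (not_le.2 (h.symm ▸ hr'))
    obtain ⟨C₁, h1⟩ := h1
    obtain ⟨C₂, h2⟩ := h2
    refine ⟨{r | |g r| ≤ max (max C₁ C₂) |g s|}, ?_, max (max C₁ C₂) |g s|, fun r hr => hr⟩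
    rw [mem_nhdsWithin_iff_eventually, ← nhdsNE_sup_pure, ← nhdsLT_sup_nhdsGT, eventually_sup,
      eventually_sup]
    refine ⟨⟨?_, ?_⟩, ?_⟩
    · filter_upwards [h2] with r hr hrI
      exact (hr hrI).trans ((le_max_right _ _).trans (le_max_left _ _))
    · filter_upwards [h1] with r hr hrI
      exact (hr hrI).trans ((le_max_left _ _).trans (le_max_left _ _))
    · rw [eventually_pure]
      exact fun _ => (le_max_right _ _ : |g s| ≤ max (max C₁ C₂) |g s|)

theorem tendsto_integral_of_lipschitz {ι : Type*} {l : Filter ι} {m : Measure (Rn n)}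
    (hm : IsP2 m) {v : ι → Measure (Rn n)} (hv : ∀ᶠ i in l, IsP2 (v i))
    (hlim : Tendsto (fun i => W2 (v i) m) l (𝓝 0)) {f : Rn n → ℝ} {K : ℝ} (hK : 0 ≤ K)
    (hf : ∀ x y, |f x - f y| ≤ K * ‖x - y‖) {c : ℝ} (hc : ∀ x, |f x| ≤ c) :
    Tendsto (fun i => ∫ x, f x ∂(v i)) l (𝓝 (∫ x, f x ∂m)) := by
  have hfc : Continuous f := by
    refine (LipschitzWith.of_dist_le_mul (K := ⟨K, hK⟩) fun x y => ?_).continuous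
    rw [Real.dist_eq, dist_eq_norm]
    exact hf x y
  have hi : ∀ ν, IsP2 ν → Integrable f ν := fun ν hν => by
    have := hν.1
    exact Integrable.of_bound hfc.aestronglyMeasurable c (Eventually.of_forall hc)
  rw [Metric.tendsto_nhds]
  intro ε hε
  filter_upwards [hv, hlim.eventually (gt_mem_nhds (ENNReal.ofReal_pos.2
    (show 0 < ε / (K + 1) by positivity)))] with i h1 h2
  rw [Real.dist_eq]
  refine (abs_integral_sub_le_of_lipschitz hm hf hfc.measurable (hi _ h1) (hi _ hm) h2
    hK).trans_lt ?_
  rw [mul_div_assoc', div_lt_iff₀ (by positivity)]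
  nlinarith

/-- Right-continuous families of measures are measurable. -/
theorem measurable_of_tendsto_W2 {m : ℝ → Measure (Rn n)} (hm : ∀ r, IsP2 (m r))
    (hr : ∀ s, Tendsto (fun r => W2 (m r) (m s)) (𝓝[>] s) (𝓝 0)) : Measurable m := by
  have hprob : ∀ r, IsProbabilityMeasure (m r) := fun r => (hm r).1
  refine Measurable.measure_of_isPiSystem_of_isProbabilityMeasure
    (BorelSpace.measurable_eq (α := Rn n)) isPiSystem_isOpen fun G hGo => ?_
  have hG : IsOpen G := hGo
  -- `Metric.infDist` to the empty set is 0 by convention, so the whole space is treated apart.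
  by_cases hne : Gᶜ.Nonempty
  swap
  · rw [not_nonempty_iff_eq_empty, compl_empty_iff] at hne
    simp [hne]
  -- Bounded Lipschitz functions converging pointwise to the indicator of `G`; their integrals are
  -- right-continuous in time because Lipschitz integrals are continuous for `W₂`.
  set f : ℕ → Rn n → ℝ := fun k x => min 1 (k * Metric.infDist x Gᶜ) with hf
  have hf0 : ∀ k x, 0 ≤ f k x := fun k x =>
    le_min zero_le_one (mul_nonneg (Nat.cast_nonneg k) Metric.infDist_nonneg)
  have hf1 : ∀ k x, |f k x| ≤ 1 := fun k x => by
    rw [abs_of_nonneg (hf0 k x)]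
    exact min_le_left _ _
  have hlip : ∀ k x y, |f k x - f k y| ≤ (k : ℝ) * ‖x - y‖ := fun k x y => by
    have h1 := abs_min_sub_min_le_max 1 ((k : ℝ) * Metric.infDist x Gᶜ) 1
      (k * Metric.infDist y Gᶜ)
    have h2 : |Metric.infDist x Gᶜ - Metric.infDist y Gᶜ| ≤ ‖x - y‖ := by
      rw [← Real.dist_eq, ← dist_eq_norm]
      exact (Metric.lipschitz_infDist_pt Gᶜ).dist_le_mul x y |>.trans (by simp)
    refine h1.trans ?_
    rw [sub_self, abs_zero, ← mul_sub, abs_mul, Nat.abs_cast]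
    refine max_le (by positivity) (by gcongr)
  have hfc : ∀ k, Continuous (f k) := fun k =>
    continuous_const.min (continuous_const.mul (Metric.continuous_infDist_pt _))
  have hmeas : ∀ k, Measurable fun r => ∫ x, f k x ∂(m r) := fun k => by
    have := measurable_of_tendsto_right (X := Unit) (f := fun r _ => ∫ x, f k x ∂(m r))
      (fun r => measurable_const) fun r _ => tendsto_integral_of_lipschitz (hm r)
        (Eventually.of_forall hm) (hr r) (Nat.cast_nonneg k) (hlip k) (hf1 k)
    exact this.comp (by fun_prop : Measurable fun r : ℝ => (r, ()))
  have hlim : ∀ r, Tendsto (fun k => ∫ x, f k x ∂(m r)) atTop (𝓝 ((m r).real G)) := fun r => by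
    rw [← integral_indicator_one hG.measurableSet]
    refine tendsto_integral_of_dominated_convergence (fun _ => 1)
      (fun k => (hfc k).aestronglyMeasurable) (integrable_const 1)
      (fun k => Eventually.of_forall (hf1 k)) (Eventually.of_forall fun x => ?_)
    by_cases hx : x ∈ G
    · rw [indicator_of_mem hx]
      have hpos : 0 < Metric.infDist x Gᶜ :=
        (hG.isClosed_compl.notMem_iff_infDist_pos hne).1 (by simpa using hx)
      refine tendsto_const_nhds.congr' ?_
      obtain ⟨k₀, hk₀⟩ := exists_nat_ge (1 / Metric.infDist x Gᶜ)
      filter_upwards [eventually_ge_atTop k₀] with k hk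
      have : 1 ≤ (k : ℝ) * Metric.infDist x Gᶜ := by
        rw [← div_le_iff₀ hpos]
        exact hk₀.trans (by exact_mod_cast hk)
      simp [hf, min_eq_left this]
    · rw [indicator_of_notMem hx]
      have : Metric.infDist x Gᶜ = 0 := Metric.infDist_zero_of_mem hx
      simp [hf, this]
  have h1 : Measurable fun r => (m r).real G :=
    measurable_of_tendsto_metrizable hmeas (tendsto_pi_nhds.2 hlim)
  have h2 : (fun r => m r G) = fun r => ENNReal.ofReal ((m r).real G) :=
    funext fun r => (ofReal_measureReal (μ := m r) (s := G)).symm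
  rw [h2]
  exact h1.ennreal_ofReal

variable {μ μL : ℝ → Measure (Rn n)}

theorem exists_moment_bound (hmem : ∀ s ∈ Icc t T, IsP2 (μ s))
    (hright : ∀ s ∈ Ico t T, Tendsto (fun r => W2 (μ r) (μ s)) (𝓝[>] s) (𝓝 0))
    (hLmem : ∀ s ∈ Ioc t T, IsP2 (μL s))
    (hleft : ∀ s ∈ Ioc t T, Tendsto (fun r => W2 (μ r) (μL s)) (𝓝[<] s) (𝓝 0)) :
    ∃ R, ∀ s ∈ Icc t T, ∫ x, ‖x‖ ^ 2 ∂(μ s) ≤ R := by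
  have key : ∀ (m : Measure (Rn n)), IsP2 m → ∀ l : Filter ℝ,
      Tendsto (fun r => W2 (μ r) m) l (𝓝 0) →
      ∃ C, ∀ᶠ r in l, r ∈ Icc t T → |∫ x, ‖x‖ ^ 2 ∂(μ r)| ≤ C := by
    intro m hm l hl
    refine ⟨2 * ∫ x, ‖x‖ ^ 2 ∂m + 2 * 1 ^ 2, ?_⟩
    filter_upwards [hl.eventually (gt_mem_nhds (ENNReal.ofReal_pos.2 zero_lt_one))] with r hr hrI
    rw [abs_of_nonneg (integral_nonneg fun x => by positivity)]
    exact moment_le_of_W2_lt (hmem r hrI) hm hr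
  obtain ⟨C, hC⟩ := exists_bound_of_cadlag (g := fun r => ∫ x, ‖x‖ ^ 2 ∂(μ r))
    (fun s hs => key _ (hmem s (Ico_subset_Icc_self hs)) _ (hright s hs))
    (fun s hs => key _ (hLmem s hs) _ (hleft s hs))
  exact ⟨C, fun s hs => (le_abs_self _).trans (hC s hs)⟩

/-- Freezing the path outside `[t, T]` keeps it right-continuous and makes it a flow indexed by all
real times. -/
theorem tendsto_W2_clamp (htT : t ≤ T)
    (hright : ∀ s ∈ Ico t T, Tendsto (fun r => W2 (μ r) (μ s)) (𝓝[>] s) (𝓝 0)) (s : ℝ) :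
    Tendsto (fun r => W2 (μ (clamp t T r)) (μ (clamp t T s))) (𝓝[>] s) (𝓝 0) := by
  rcases lt_or_ge s t with h1 | h1
  · refine tendsto_const_nhds.congr' ?_
    filter_upwards [Ioo_mem_nhdsGT h1] with r hr
    have e1 : clamp t T r = t := by
      rw [clamp, max_eq_left ((min_le_right _ _).trans hr.2.le)]
    have e2 : clamp t T s = t := by
      rw [clamp, max_eq_left ((min_le_right _ _).trans h1.le)]
    rw [e1, e2, W2_self]
  rcases lt_or_ge s T with h2 | h2
  · rw [clamp_of_mem ⟨h1, h2.le⟩]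
    refine (hright s ⟨h1, h2⟩).congr' ?_
    filter_upwards [Ioo_mem_nhdsGT h2] with r hr
    rw [clamp_of_mem ⟨h1.trans hr.1.le, hr.2.le⟩]
  · refine tendsto_const_nhds.congr' ?_
    filter_upwards [self_mem_nhdsWithin] with r hr
    have e1 : clamp t T r = T := by
      rw [clamp, min_eq_left (h2.trans (le_of_lt hr)), max_eq_right htT]
    have e2 : clamp t T s = T := by
      rw [clamp, min_eq_left h2, max_eq_right htT]
    rw [e1, e2, W2_self]

end Cadlag

/-! ### Test functions and `W₂` limits -/

section TestFunctions

variable {n : ℕ}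

theorem exists_isQuadC2_of_contDiff {φ : Rn n → ℝ} (h : ContDiff ℝ (⊤ : ℕ∞) φ)
    (hc : HasCompactSupport φ) : ∃ c, IsQuadC2 φ (∇ φ) (fderiv ℝ (∇ φ)) c := by
  have hg := contDiff_gradient h
  have cg := hasCompactSupport_gradient hc
  have hH : Continuous (fderiv ℝ (∇ φ)) := (contDiff_infty_iff_fderiv.mp hg).2.continuous
  obtain ⟨c₀, h₀⟩ := hc.exists_bound_of_continuous h.continuous
  obtain ⟨c₁, h₁⟩ := cg.exists_bound_of_continuous hg.continuous
  obtain ⟨c₂, h₂⟩ := (cg.fderiv (𝕜 := ℝ)).exists_bound_of_continuous hH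
  have hc₀ : 0 ≤ c₀ := (norm_nonneg _).trans (h₀ 0)
  have hmax : 0 ≤ max c₀ (max c₁ c₂) := le_max_of_le_left hc₀
  refine ⟨max c₀ (max c₁ c₂), fun x => (h.differentiable (by simp) x).hasGradientAt,
    fun x => (hg.differentiable (by simp) x).hasFDerivAt, hH, fun x => ?_, fun x => ?_,
    fun x => ?_⟩
  · refine ((h₀ x).trans (le_max_left _ _)).trans (le_mul_of_one_le_right hmax ?_)
    nlinarith [sq_nonneg ‖x‖]
  · refine ((h₁ x).trans ((le_max_left _ _).trans (le_max_right _ _))).trans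
      (le_mul_of_one_le_right hmax ?_)
    linarith [norm_nonneg x]
  · exact (h₂ x).trans ((le_max_right _ _).trans (le_max_right _ _))

theorem tendsto_integral_of_contDiff {ι : Type*} {l : Filter ι} {m : Measure (Rn n)}
    (hm : IsP2 m) {v : ι → Measure (Rn n)} (hv : ∀ᶠ i in l, IsP2 (v i))
    (hlim : Tendsto (fun i => W2 (v i) m) l (𝓝 0)) {φ : Rn n → ℝ} (h : ContDiff ℝ (⊤ : ℕ∞) φ)
    (hc : HasCompactSupport φ) : Tendsto (fun i => ∫ x, φ x ∂(v i)) l (𝓝 (∫ x, φ x ∂m)) := by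
  obtain ⟨c, hb⟩ := hc.exists_bound_of_continuous h.continuous
  have h1 : ContDiff ℝ 1 φ := h.of_le (by exact_mod_cast le_top)
  obtain ⟨K, hK⟩ := h1.lipschitzWith_of_hasCompactSupport hc (by norm_num)
  refine tendsto_integral_of_lipschitz hm hv hlim K.2 (fun x y => ?_) hb
  rw [← Real.dist_eq, ← dist_eq_norm]
  exact hK.dist_le_mul x y

end TestFunctions

/-! ### The jumps of the flow -/

section Jumps

variable {n d : ℕ} {B : Type*} [NormedAddCommGroup B] [NormedSpace ℝ B] [MeasurableSpace B]
  [BorelSpace B] {U : Set B} {Z : Type*} [MeasurableSpace Z]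

theorem IsSimpleCounting.measureReal_eq_one {ν : Measure (ℝ × Z)} (h : IsSimpleCounting ν) {s : ℝ}
    (hs : ν ({s} ×ˢ univ) ≠ 0) : ν.real ({s} ×ˢ univ) = 1 := by
  have h1 : ν ({s} ×ˢ univ) = 1 := le_antisymm (h.simple s) (not_lt.1 fun hlt =>
    hs (h.eq_zero_of_lt_one ((measurableSet_singleton s).prod MeasurableSet.univ) hlt))
  simp [Measure.real, h1]

variable [CompactSpace U] {C : Coefficients n d U Z} {lam : Measure Z}

/-- The jump coefficient at an atom of the noise. -/
theorem Coefficients.Regular.exists_ae_slice_γ_eq (hC : C.Regular lam) {ν : Measure (ℝ × Z)}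
    (h : IsSimpleCounting ν) {s : ℝ} (hs : ν ({s} ×ˢ univ) ≠ 0) {ρ : Measure (Rn n × U)}
    (hρ : IsP2Joint ρ) : ∃ z₀, ∀ᵐ z ∂(slice ν s), ∀ x u, C.γ x ρ u z = C.γ x ρ u z₀ := by
  have := hρ.1
  have hne : Nonempty (Rn n × U) := ρ.nonempty_of_neZero
  have h0 : slice ν s ≠ 0 := fun h0 => hs (by
    rw [← slice_apply ν s MeasurableSet.univ, h0]
    rfl)
  have : NeBot (ae (slice ν s)) := ae_neBot.2 h0
  set e := TopologicalSpace.denseSeq (Rn n × U)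
  -- Constancy in the mark is obtained at countably many dense points `(x, u)` at once; `z₀` is any
  -- mark in the common set of full measure, and continuity in `(x, u)` covers the remaining points.
  choose c hc using fun k => h.exists_ae_slice_eq s (hC.measurable_γ (e k).1 ρ (e k).2 hρ)
  have hall := ae_all_iff.2 hc
  obtain ⟨z₀, hz₀⟩ := hall.exists
  refine ⟨z₀, ?_⟩
  filter_upwards [hall] with z hz x u
  have := (TopologicalSpace.denseRange_denseSeq (Rn n × U)).equalizer
    ((hC.continuous_γ z).continuous hρ) ((hC.continuous_γ z₀).continuous hρ)
    (funext fun k => (hz k).trans (hz₀ k).symm)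
  exact congrFun this (x, u)

theorem Coefficients.Regular.measurable_γ_joint (hC : C.Regular lam) {ρ : Measure (Rn n × U)}
    (hρ : IsP2Joint ρ) (z : Z) : Measurable fun p : Rn n × U => C.γ p.1 ρ p.2 z :=
  ((hC.continuous_γ z).continuous hρ).measurable

theorem Coefficients.Regular.isProbabilityMeasure_jumpAdj (hC : C.Regular lam)
    {m : Measure (Rn n)} (hm : IsP2 m) (κ : Kernel (Rn n) U) [IsMarkovKernel κ] (z : Z) :
    IsProbabilityMeasure (C.jumpAdj m κ z m) := by
  have := hm.1
  exact Measure.isProbabilityMeasure_map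
    (measurable_fst.add (hC.measurable_γ_joint (isP2Joint_compProd hm κ) z)).aemeasurable

theorem Coefficients.Regular.integral_jumpOp_sub (hC : C.Regular lam) {m : Measure (Rn n)}
    (hm : IsP2 m) (κ : Kernel (Rn n) U) [IsMarkovKernel κ] (z : Z) {φ : Rn n → ℝ}
    (hφ : Continuous φ) (hc : HasCompactSupport φ) :
    ∫ x, (C.jumpOp m κ z φ x - φ x) ∂m = ∫ x, φ x ∂(C.jumpAdj m κ z m) - ∫ x, φ x ∂m := by
  have := hm.1
  obtain ⟨c, hb⟩ := hc.exists_bound_of_continuous hφ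
  have hγ := hC.measurable_γ_joint (isP2Joint_compProd hm κ) z
  have hi : Integrable (fun p : Rn n × U => φ (p.1 + C.γ p.1 (m ⊗ₘ κ) p.2 z)) (m ⊗ₘ κ) :=
    Integrable.of_bound (hφ.measurable.comp (measurable_fst.add hγ)).aestronglyMeasurable c
      (Eventually.of_forall fun p => hb _)
  have hj : Integrable (C.jumpOp m κ z φ) m := hi.integral_compProd
  rw [integral_sub hj (Integrable.of_bound hφ.aestronglyMeasurable c (Eventually.of_forall hb))]
  congr 1
  exact (integral_jumpAdj C m m κ z hγ (BoundedContinuousFunction.ofNormedAddCommGroup φ hφ c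
    hb)).symm

end Jumps

/-! ### Itô's formula along a flow with jumps -/

section Ito

variable {n : ℕ} {Z : Type*} [MeasurableSpace Z] {T t : ℝ}
  {J Jt : ℝ → Measure (Rn n) → ℝ} {δJ : ℝ → Measure (Rn n) → Rn n → ℝ}
  {DJ : ℝ → Measure (Rn n) → Rn n → Rn n} {DDJ : ℝ → Measure (Rn n) → Rn n → Rn n →L[ℝ] Rn n}
  {m : Kernel ℝ (Rn n)} {β : ℝ → Rn n → Rn n} {a : ℝ → Rn n → Matrix (Fin n) (Fin n) ℝ}
  {R K : ℝ} {μL : ℝ → Measure (Rn n)} {ν : Measure (ℝ × Z)}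

theorem IsFlow.intervalIntegrable_secondOrder (h : IsFlow m β a R K) {ψ : Rn n → ℝ}
    {p : Rn n → Rn n} {H : Rn n → Rn n →L[ℝ] Rn n} {c : ℝ} (hψ : IsQuadC2 ψ p H c) (s s' : ℝ) :
    IntervalIntegrable (fun r => ∫ x, secondOrder (β r) (a r) p H x ∂(m r)) volume s s' := by
  have hmeas : Measurable fun r => ∫ x, secondOrder (β r) (a r) p H x ∂(m r) :=
    h.measurable_integral_secondOrder (hψ.continuous_grad.measurable.comp measurable_snd)
      (hψ.cont.measurable.comp measurable_snd)
  refine (intervalIntegrable_const (c := K * c * (2 + (n : ℝ) ^ 2) * (1 + R))).mono_fun'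
    hmeas.aestronglyMeasurable (Eventually.of_forall fun r => ?_)
  exact (h.coefGrowth r).abs_integral_secondOrder_le hψ.bound_grad hψ.bound_deriv (h.p2 r)
    (h.moment r)

/-- No growth bound is assumed on `Jt`. Its boundedness along the path follows from joint continuity
at the right values and at the left limits of the flow. -/
theorem IsFlow.intervalIntegrable_time_deriv (h : IsFlow m β a R K)
    (hJ : IsC111 T J Jt δJ DJ DDJ) (ht : 0 ≤ t) (htT : t ≤ T) (hLmem : ∀ s ∈ Ioc t T, IsP2 (μL s))
    (hleft : ∀ s ∈ Ioc t T, Tendsto (fun r => W2 (m r) (μL s)) (𝓝[<] s) (𝓝 0)) :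
    IntervalIntegrable (fun r => Jt r (m r)) volume t T := by
  have hT0 : 0 ≤ T := ht.trans htT
  have hsub : Icc t T ⊆ Icc 0 T := Icc_subset_Icc_left ht
  have key : ∀ s ∈ Icc t T, ∀ μ, IsP2 μ → ∀ l : Filter ℝ, l ≤ 𝓝 s →
      Tendsto (fun r => W2 (m r) μ) l (𝓝 0) →
      ∃ C, ∀ᶠ r in l, r ∈ Icc t T → |Jt r (m r)| ≤ C := by
    intro s hs μ hμ l hl hlim
    obtain ⟨δ, hδ, h1⟩ := hJ.time_expansion (hsub hs) hμ zero_lt_one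
    refine ⟨|Jt s μ| + 1, ?_⟩
    filter_upwards [hlim.eventually (gt_mem_nhds (ENNReal.ofReal_pos.2 hδ)),
      hl (Metric.ball_mem_nhds s hδ)] with r h2 h3 h4
    have h5 := (h1 _ (h.p2 r) h2 r (hsub h4) h3).1
    have h6 := abs_sub_abs_le_abs_sub (Jt r (m r)) (Jt s μ)
    linarith
  obtain ⟨C, hC⟩ := exists_bound_of_cadlag (t := t) (T := T) (g := fun r => Jt r (m r))
    (fun s hs => key s (Ico_subset_Icc_self hs) _ (h.p2 s) _ nhdsWithin_le_nhds (h.right s))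
    (fun s hs => key s (Ioc_subset_Icc_self hs) _ (hLmem s hs) _ nhdsWithin_le_nhds (hleft s hs))
  have hmeas : Measurable fun r => Jt (clamp 0 T r) (m r) :=
    (hJ.continuous_Jt.measurable_along hT0 h.p2 h.right).comp
      (by fun_prop : Measurable fun r : ℝ => (r, (0 : Rn n)))
  rw [intervalIntegrable_iff_integrableOn_Ioc_of_le htT]
  have hfin : IsFiniteMeasure (volume.restrict (Ioc t T)) := inferInstance
  refine (Integrable.of_bound (f := fun r => Jt (clamp 0 T r) (m r))
    hmeas.aestronglyMeasurable C ?_).congr ?_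
  · filter_upwards [ae_restrict_mem measurableSet_Ioc] with r hr
    have hr' := Ioc_subset_Icc_self hr
    rw [clamp_of_mem (hsub hr')]
    exact hC r hr'
  · filter_upwards [ae_restrict_mem measurableSet_Ioc] with r hr
    rw [clamp_of_mem (hsub (Ioc_subset_Icc_self hr))]

/-- Time and measure move together: the expansion in time is uniform over nearby measures, and
continuity of `J s` handles the rest. It supplies the left limit of `J` along the flow. -/
theorem IsC111.tendsto (hJ : IsC111 T J Jt δJ DJ DDJ) {s : ℝ} (hs : s ∈ Icc 0 T)
    {μ : Measure (Rn n)} (hμ : IsP2 μ) {l : Filter ℝ} (hl : l ≤ 𝓝 s) (hlT : ∀ᶠ r in l, r ∈ Icc 0 T)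
    {v : ℝ → Measure (Rn n)} (hv : ∀ r, IsP2 (v r))
    (hlim : Tendsto (fun r => W2 (v r) μ) l (𝓝 0)) :
    Tendsto (fun r => J r (v r)) l (𝓝 (J s μ)) := by
  rw [Metric.tendsto_nhds]
  intro ε hε
  obtain ⟨δ₁, hδ₁, h₁⟩ := hJ.time_expansion hs hμ zero_lt_one
  obtain ⟨δ₂, hδ₂, h₂⟩ := hJ.continuous_measure hs hμ (half_pos hε)
  have hη : 0 < min δ₁ (ε / (2 * (1 + |Jt s μ|))) := by positivity
  filter_upwards [hlT, hlim.eventually (gt_mem_nhds (ENNReal.ofReal_pos.2 hδ₁)),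
    hlim.eventually (gt_mem_nhds (ENNReal.ofReal_pos.2 hδ₂)),
    hl (Metric.ball_mem_nhds s hη)] with r hr h3 h4 h5
  have h5' : |r - s| < min δ₁ (ε / (2 * (1 + |Jt s μ|))) := h5
  have h6 := (h₁ _ (hv r) h3 r hr (h5'.trans_le (min_le_left _ _))).2
  have h7 := h₂ _ (hv r) h4
  have h8 : |r - s| * (1 + |Jt s μ|) < ε / 2 := by
    have := h5'.trans_le (min_le_right _ _)
    rw [lt_div_iff₀ (by positivity)] at this
    linarith
  rw [Real.dist_eq]
  have e : J r (v r) - J s μ = (J r (v r) - J s (v r) - (r - s) * Jt s μ)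
      + (r - s) * Jt s μ + (J s (v r) - J s μ) := by ring
  rw [e]
  refine (abs_add_three _ _ _).trans_lt ?_
  rw [abs_mul]
  linarith

section

variable {Φ : (Rn n → ℝ) → ℝ × Z → ℝ}

/-- The jump of the flow, seen by test functions. -/
theorem IsFlow.integral_jump (h : IsFlow m β a R K) (hν : IsSimpleCounting ν)
    (hΦ : ∀ φ, ContDiff ℝ (⊤ : ℕ∞) φ → HasCompactSupport φ → ∀ s ∈ Ioc t T,
      IntegrableOn (Φ φ) ({s} ×ˢ univ) ν)
    (heq : ∀ φ, ContDiff ℝ (⊤ : ℕ∞) φ → HasCompactSupport φ → ∀ s ∈ Icc t T,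
      ∫ x, φ x ∂(m s) = ∫ x, φ x ∂(m t)
        + (∫ r in t..s, ∫ x, secondOrder (β r) (a r) (∇ φ) (fderiv ℝ (∇ φ)) x ∂(m r))
        + ∫ p in Ioc t s ×ˢ univ, Φ φ p ∂ν)
    {s : ℝ} (hs : s ∈ Ioc t T) (hL : IsP2 (μL s))
    (hleft : Tendsto (fun r => W2 (m r) (μL s)) (𝓝[<] s) (𝓝 0)) {φ : Rn n → ℝ}
    (hφ : ContDiff ℝ (⊤ : ℕ∞) φ) (hc : HasCompactSupport φ) :
    ∫ x, φ x ∂(m s) = ∫ x, φ x ∂(μL s) + ∫ p in {s} ×ˢ univ, Φ φ p ∂ν := by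
  obtain ⟨c, hq⟩ := exists_isQuadC2_of_contDiff hφ hc
  have hint : IntegrableOn (Φ φ) (Ioc t s ×ˢ univ) ν :=
    hν.integrableOn_of_slices fun r hr => hΦ φ hφ hc r ⟨hr.1, hr.2.trans hs.2⟩
  have l1 := tendsto_integral_of_contDiff hL (Eventually.of_forall h.p2) hleft hφ hc
  set g := fun r => ∫ x, secondOrder (β r) (a r) (∇ φ) (fderiv ℝ (∇ φ)) x ∂(m r)
  have hcont : Continuous fun r => ∫ q in t..r, g q :=
    intervalIntegral.continuous_primitive (h.intervalIntegrable_secondOrder hq) t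
  -- Just before `s` the noise integral lacks exactly the slice at `s`, while the time integral is
  -- continuous; comparing this left limit with the equation at `s` isolates the jump.
  have l2 : Tendsto (fun r => ∫ x, φ x ∂(m t) + (∫ q in t..r, g q)
      + (∫ p in Ioc t s ×ˢ univ, Φ φ p ∂ν - ∫ p in {s} ×ˢ univ, Φ φ p ∂ν)) (𝓝[<] s)
      (𝓝 (∫ x, φ x ∂(m t) + (∫ q in t..s, g q)
      + (∫ p in Ioc t s ×ˢ univ, Φ φ p ∂ν - ∫ p in {s} ×ˢ univ, Φ φ p ∂ν))) :=
    (((hcont.tendsto s).mono_left nhdsWithin_le_nhds).const_add _).add_const _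
  have hev : (fun r => ∫ x, φ x ∂(m t) + (∫ q in t..r, g q)
      + (∫ p in Ioc t s ×ˢ univ, Φ φ p ∂ν - ∫ p in {s} ×ˢ univ, Φ φ p ∂ν))
      =ᶠ[𝓝[<] s] fun r => ∫ x, φ x ∂(m r) := by
    filter_upwards [hν.eventually_integral_left hs.1, Ioo_mem_nhdsLT hs.1] with r h1 h2
    rw [h1 _ hint, heq φ hφ hc r ⟨h2.1.le, h2.2.le.trans hs.2⟩]
    ring
  have huniq := tendsto_nhds_unique l1 (l2.congr' hev)
  rw [huniq, heq φ hφ hc s ⟨hs.1.le, hs.2⟩]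
  ring

/-- There are no atoms just after `s`, even if `s` is an atom time itself, since its own jump is
already contained in `m s`. -/
theorem IsFlow.integral_eq_right (h : IsFlow m β a R K) (hν : IsSimpleCounting ν)
    (heq : ∀ φ, ContDiff ℝ (⊤ : ℕ∞) φ → HasCompactSupport φ → ∀ s ∈ Icc t T,
      ∫ x, φ x ∂(m s) = ∫ x, φ x ∂(m t)
        + (∫ r in t..s, ∫ x, secondOrder (β r) (a r) (∇ φ) (fderiv ℝ (∇ φ)) x ∂(m r))
        + ∫ p in Ioc t s ×ˢ univ, Φ φ p ∂ν)
    {s : ℝ} (hs : s ∈ Ico t T) : ∀ᶠ s' in 𝓝[>] s, ∀ φ : Rn n → ℝ, ContDiff ℝ (⊤ : ℕ∞) φ →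
      HasCompactSupport φ → ∫ x, φ x ∂(m s') = ∫ x, φ x ∂(m s)
        + ∫ r in s..s', ∫ x, secondOrder (β r) (a r) (∇ φ) (fderiv ℝ (∇ φ)) x ∂(m r) := by
  filter_upwards [hν.eventually_integral_right hs.1, Ioo_mem_nhdsGT hs.2] with s' h1 h2 φ hφ hc
  obtain ⟨c, hq⟩ := exists_isQuadC2_of_contDiff hφ hc
  rw [heq φ hφ hc s' ⟨hs.1.trans h2.1.le, h2.2.le⟩, heq φ hφ hc s ⟨hs.1, hs.2.le⟩, h1,
    ← intervalIntegral.integral_add_adjacent_intervals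
      (h.intervalIntegrable_secondOrder hq t s) (h.intervalIntegrable_secondOrder hq s s')]
  ring

/-- A continuous function with vanishing right derivative is constant. Right differentiability comes
from the chain rule without jumps; continuity from the left at an atom holds because the jump of `J`
equals the slice integral of `Ψ`. -/
theorem IsFlow.ito (h : IsFlow m β a R K) (hJ : IsC111 T J Jt δJ DJ DDJ) (ht : 0 ≤ t)
    (htT : t ≤ T) (hν : IsSimpleCounting ν) (hLmem : ∀ s ∈ Ioc t T, IsP2 (μL s))
    (hleft : ∀ s ∈ Ioc t T, Tendsto (fun r => W2 (m r) (μL s)) (𝓝[<] s) (𝓝 0))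
    (heq : ∀ φ, ContDiff ℝ (⊤ : ℕ∞) φ → HasCompactSupport φ → ∀ s ∈ Icc t T,
      ∫ x, φ x ∂(m s) = ∫ x, φ x ∂(m t)
        + (∫ r in t..s, ∫ x, secondOrder (β r) (a r) (∇ φ) (fderiv ℝ (∇ φ)) x ∂(m r))
        + ∫ p in Ioc t s ×ˢ univ, Φ φ p ∂ν)
    {Ψ : ℝ × Z → ℝ} (hΨ : ∀ s ∈ Ioc t T, IntegrableOn Ψ ({s} ×ˢ univ) ν ∧
      J s (m s) = J s (μL s) + ∫ p in {s} ×ˢ univ, Ψ p ∂ν) :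
    IntervalIntegrable (fun r => Jt r (m r)
      + ∫ x, secondOrder (β r) (a r) (DJ r (m r)) (DDJ r (m r)) x ∂(m r)) volume t T ∧
    IntegrableOn Ψ (Ioc t T ×ˢ univ) ν ∧
    ∀ s ∈ Icc t T, J s (m s) = J t (m t)
      + (∫ r in t..s, (Jt r (m r)
        + ∫ x, secondOrder (β r) (a r) (DJ r (m r)) (DDJ r (m r)) x ∂(m r)))
      + ∫ p in Ioc t s ×ˢ univ, Ψ p ∂ν := by
  have hint1 := h.intervalIntegrable_time_deriv hJ ht htT hLmem hleft
  have hint := hint1.add (h.intervalIntegrable_generator hJ ht htT le_rfl)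
  have hintΨ : IntegrableOn Ψ (Ioc t T ×ˢ univ) ν :=
    hν.integrableOn_of_slices fun s hs => (hΨ s hs).1
  refine ⟨hint, hintΨ, fun s hs => ?_⟩
  set G := fun r => Jt r (m r)
      + ∫ x, secondOrder (β r) (a r) (DJ r (m r)) (DDJ r (m r)) x ∂(m r) with hG
  have hintG : ∀ r ∈ Icc t T, ∀ r' ∈ Icc t T, IntervalIntegrable G volume r r' :=
    fun r hr r' hr' => hint.mono_set (by
      rw [uIcc_of_le htT]
      exact uIcc_subset_Icc hr hr')
  have hsub : Icc t T ⊆ Icc 0 T := Icc_subset_Icc_left ht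
  set F : ℝ → ℝ := fun s => J s (m s) - (∫ r in t..s, G r) - ∫ p in Ioc t s ×ˢ univ, Ψ p ∂ν
    with hF
  have hder : ∀ s ∈ Ico t T, HasDerivWithinAt F 0 (Ici s) s := by
    intro s hs
    rw [← hasDerivWithinAt_Ioi_iff_Ici, hasDerivWithinAt_iff_isLittleO, Asymptotics.isLittleO_iff]
    intro ε hε
    have hch := h.chain_rule_right hJ ⟨ht.trans hs.1, hs.2⟩ (fun s' hs' => hint1.mono_set (by
      rw [uIcc_of_le htT]
      exact uIcc_subset_Icc ⟨hs.1, hs.2.le⟩ ⟨hs.1.trans hs'.1, hs'.2⟩))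
      (h.integral_eq_right hν heq hs) hε
    filter_upwards [hch, hν.eventually_integral_right hs.1, Ioo_mem_nhdsGT hs.2]
      with s' h1 h2 h3
    have e : F s' - F s - (s' - s) • (0 : ℝ) = J s' (m s') - J s (m s) - ∫ r in s..s', G r := by
      have := intervalIntegral.integral_add_adjacent_intervals
        (hintG t (left_mem_Icc.2 htT) s ⟨hs.1, hs.2.le⟩)
        (hintG s ⟨hs.1, hs.2.le⟩ s' ⟨hs.1.trans h3.1.le, h3.2.le⟩)
      simp only [hF, h2, smul_zero, ← this]
      ring
    rw [e, Real.norm_eq_abs, Real.norm_of_nonneg (sub_nonneg.2 h3.1.le)]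
    exact h1
  have hcont : ContinuousOn F (Icc t T) := by
    intro s hs
    have hleftc : ContinuousWithinAt F (Icc t s) s := by
      rcases hs.1.eq_or_lt with rfl | hts
      · rw [Icc_self]
        exact continuousWithinAt_singleton
      have hsI : s ∈ Ioc t T := ⟨hts, hs.2⟩
      refine ContinuousWithinAt.mono (t := Iic s) ?_ Icc_subset_Iic_self
      rw [← continuousWithinAt_Iio_iff_Iic, ContinuousWithinAt]
      have l1 := hJ.tendsto (hsub hs) (hLmem s hsI) (nhdsWithin_le_nhds (s := Iio s)) (by
        filter_upwards [Ioo_mem_nhdsLT hts] with r hr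
        exact hsub ⟨hr.1.le, hr.2.le.trans hs.2⟩) h.p2 (hleft s hsI)
      have l2 : Tendsto (fun r => ∫ q in t..r, G q) (𝓝[<] s) (𝓝 (∫ q in t..s, G q)) := by
        have := intervalIntegral.continuousOn_primitive_interval' hint left_mem_uIcc s
          (by rwa [uIcc_of_le htT])
        refine this.mono_left ?_
        rw [uIcc_of_le htT]
        refine nhdsWithin_le_of_mem ?_
        filter_upwards [Ioo_mem_nhdsLT hts] with r hr
        exact ⟨hr.1.le, hr.2.le.trans hs.2⟩
      have hΨs := hintΨ.mono_set (prod_mono (Ioc_subset_Ioc_right hs.2) subset_rfl)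
      have l3 := (l1.sub l2).sub_const
        (∫ p in Ioc t s ×ˢ univ, Ψ p ∂ν - ∫ p in {s} ×ˢ univ, Ψ p ∂ν)
      -- The slice term taken off the noise integral is the jump of `J` at `s`, so the left limit of
      -- `F` is its value.
      have e : J s (μL s) - (∫ q in t..s, G q)
          - (∫ p in Ioc t s ×ˢ univ, Ψ p ∂ν - ∫ p in {s} ×ˢ univ, Ψ p ∂ν) = F s := by
        simp only [hF, (hΨ s hsI).2]
        ring
      rw [e] at l3
      refine l3.congr' ?_
      filter_upwards [hν.eventually_integral_left hts] with r hr
      simp only [hF, hr Ψ hΨs]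
      ring
    have hrightc : ContinuousWithinAt F (Icc s T) s := by
      rcases hs.2.eq_or_lt with rfl | hsT
      · rw [Icc_self]
        exact continuousWithinAt_singleton
      exact (hder s ⟨hs.1, hsT⟩).continuousWithinAt.mono Icc_subset_Ici_self
    have := hleftc.union hrightc
    rwa [Icc_union_Icc_eq_Icc hs.1 hs.2] at this
  have := constant_of_has_deriv_right_zero hcont hder s hs
  simp only [hF, intervalIntegral.integral_same, Ioc_self, empty_prod, setIntegral_empty,
    sub_zero] at this
  linarith

end

end Ito

/-! ### Itô's formula along a path -/

section Path

variable {n d : ℕ} {B : Type*} [NormedAddCommGroup B] [NormedSpace ℝ B] [MeasurableSpace B]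
  [BorelSpace B] {U : Set B} {Z : Type*} [MeasurableSpace Z]

/-- A path of the stochastic Fokker-Planck equation driven by the counting measure `ν`. -/
structure IsFokkerPlanckPath (C : Coefficients n d U Z) (lam : Measure Z) (ν : Measure (ℝ × Z))
    (T t : ℝ) (μ μL : ℝ → Measure (Rn n)) (α αL : ℝ → Kernel (Rn n) U) : Prop where
  mem : ∀ s ∈ Icc t T, IsP2 (μ s)
  right : ∀ s ∈ Ico t T, Tendsto (fun r => W2 (μ r) (μ s)) (𝓝[>] s) (𝓝 0)
  left_mem : ∀ s ∈ Ioc t T, IsP2 (μL s)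
  left : ∀ s ∈ Ioc t T, Tendsto (fun r => W2 (μ r) (μL s)) (𝓝[<] s) (𝓝 0)
  markov : ∀ s, IsMarkovKernel (α s)
  measurable : Measurable fun p : ℝ × Rn n => α p.1 p.2
  markov_left : ∀ s ∈ Ioc t T, ν ({s} ×ˢ univ) ≠ 0 → IsMarkovKernel (αL s)
  eq : ∀ φ : Rn n → ℝ, ContDiff ℝ (⊤ : ℕ∞) φ → HasCompactSupport φ → ∀ s ∈ Icc t T,
    ∫ x, φ x ∂(μ s) = ∫ x, φ x ∂(μ t)
      + (∫ r in t..s, ∫ x, C.drift lam (μ r) (α r) (∇ φ) (fderiv ℝ (∇ φ)) x ∂(μ r))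
      + ∫ p in Ioc t s ×ˢ univ,
          (∫ x, (C.jumpOp (μL p.1) (αL p.1) p.2 φ x - φ x) ∂(μL p.1)) ∂ν

namespace IsFokkerPlanckPath

variable [CompactSpace U] {C : Coefficients n d U Z} {lam : Measure Z}
  {ν : Measure (ℝ × Z)} {T t : ℝ} {μ μL : ℝ → Measure (Rn n)} {α αL : ℝ → Kernel (Rn n) U}

/-- The jumps of the test function integrals and of `J` are constant in the mark almost
everywhere. -/
theorem exists_jump (h : IsFokkerPlanckPath C lam ν T t μ μL α αL) (hC : C.Regular lam)
    (hν : IsSimpleCounting ν) {s : ℝ} (hs : s ∈ Ioc t T) (hatom : ν ({s} ×ˢ univ) ≠ 0) :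
    ∃ m' : Measure (Rn n), IsProbabilityMeasure m' ∧
      (∀ᵐ z ∂(slice ν s), C.jumpAdj (μL s) (αL s) z (μL s) = m') ∧
      ∀ φ : Rn n → ℝ, Continuous φ → HasCompactSupport φ → ∀ᵐ z ∂(slice ν s),
        ∫ x, (C.jumpOp (μL s) (αL s) z φ x - φ x) ∂(μL s) = ∫ x, φ x ∂m' - ∫ x, φ x ∂(μL s) := by
  have := h.markov_left s hs hatom
  have hL := h.left_mem s hs
  obtain ⟨z₀, hz₀⟩ := hC.exists_ae_slice_γ_eq hν hatom (isP2Joint_compProd hL (αL s))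
  have hadj : ∀ᵐ z ∂(slice ν s),
      C.jumpAdj (μL s) (αL s) z (μL s) = C.jumpAdj (μL s) (αL s) z₀ (μL s) := by
    filter_upwards [hz₀] with z hz
    simp only [Coefficients.jumpAdj, hz]
  refine ⟨C.jumpAdj (μL s) (αL s) z₀ (μL s), hC.isProbabilityMeasure_jumpAdj hL (αL s) z₀, hadj,
    fun φ hφ hc => ?_⟩
  filter_upwards [hadj] with z hz
  rw [hC.integral_jumpOp_sub hL (αL s) z hφ hc, hz]

theorem integrableOn_jump (h : IsFokkerPlanckPath C lam ν T t μ μL α αL) (hC : C.Regular lam)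
    (hν : IsSimpleCounting ν) {φ : Rn n → ℝ} (hφ : ContDiff ℝ (⊤ : ℕ∞) φ)
    (hc : HasCompactSupport φ) {s : ℝ} (hs : s ∈ Ioc t T) :
    IntegrableOn (fun p : ℝ × Z => ∫ x, (C.jumpOp (μL p.1) (αL p.1) p.2 φ x - φ x) ∂(μL p.1))
      ({s} ×ˢ univ) ν := by
  by_cases hatom : ν ({s} ×ˢ univ) = 0
  · rw [IntegrableOn, Measure.restrict_eq_zero.2 hatom]
    exact integrable_zero_measure
  obtain ⟨m', -, -, hm'⟩ := h.exists_jump hC hν hs hatom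
  exact (hν.integral_slice (hm' φ hφ.continuous hc)).1

/-- The jump of `J` along the path. -/
theorem jump_eq (h : IsFokkerPlanckPath C lam ν T t μ μL α αL) (hC : C.Regular lam)
    (hν : IsSimpleCounting ν) (J : ℝ → Measure (Rn n) → ℝ) {s : ℝ} (hs : s ∈ Ioc t T)
    (heq : ∀ φ : Rn n → ℝ, ContDiff ℝ (⊤ : ℕ∞) φ → HasCompactSupport φ →
      ∫ x, φ x ∂(μ s) = ∫ x, φ x ∂(μL s) + ∫ p in {s} ×ˢ univ,
        (∫ x, (C.jumpOp (μL p.1) (αL p.1) p.2 φ x - φ x) ∂(μL p.1)) ∂ν) :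
    IntegrableOn (fun p : ℝ × Z =>
        J p.1 (C.jumpAdj (μL p.1) (αL p.1) p.2 (μL p.1)) - J p.1 (μL p.1)) ({s} ×ˢ univ) ν ∧
      J s (μ s) = J s (μL s) + ∫ p in {s} ×ˢ univ,
        (J p.1 (C.jumpAdj (μL p.1) (αL p.1) p.2 (μL p.1)) - J p.1 (μL p.1)) ∂ν := by
  have := (h.mem s (Ioc_subset_Icc_self hs)).1
  have := (h.left_mem s hs).1
  by_cases hatom : ν ({s} ×ˢ univ) = 0
  · have h0 := Measure.restrict_eq_zero.2 hatom
    simp only [h0, integral_zero_measure, add_zero] at heq ⊢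
    refine ⟨by rw [IntegrableOn, h0]; exact integrable_zero_measure, ?_⟩
    rw [ext_of_forall_integral_contDiff heq]
  obtain ⟨m', hprob, hadj, hm'⟩ := h.exists_jump hC hν hs hatom
  -- The slice has mass 1, so the weak jump relation says that `μ s` and `m'` integrate all test
  -- functions alike.
  have h1 : μ s = m' := ext_of_forall_integral_contDiff fun φ hφ hc => by
    rw [heq φ hφ hc, (hν.integral_slice (hm' φ hφ.continuous hc)).2,
      hν.measureReal_eq_one hatom]
    ring
  have h2 := hν.integral_slice (s := s) (Φ := fun p : ℝ × Z =>
    J p.1 (C.jumpAdj (μL p.1) (αL p.1) p.2 (μL p.1)) - J p.1 (μL p.1))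
    (c := J s m' - J s (μL s)) (by
      filter_upwards [hadj] with z hz
      rw [hz])
  refine ⟨h2.1, ?_⟩
  rw [h2.2, hν.measureReal_eq_one hatom, h1]
  ring

variable [IsFiniteMeasure lam]

/-- Flows are indexed by the whole line, with bounds at every time; the path is made constant in
time outside `[t, T]`, and all conclusions are read off inside. -/
theorem exists_flow (h : IsFokkerPlanckPath C lam ν T t μ μL α αL) (hC : C.Regular lam)
    (htT : t ≤ T) : ∃ (m : Kernel ℝ (Rn n)) (R K : ℝ),
      IsFlow m (fun r x => C.bHat x (m r) (α r) - ∫ z, C.γHat x (m r) (α r) z ∂lam)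
        (fun r x => C.aHat x (m r) (α r)) R K ∧ ∀ r ∈ Icc t T, m r = μ r := by
  have hp2 : ∀ r, IsP2 (μ (clamp t T r)) := fun r => h.mem _ (clamp_mem htT r)
  have hr := tendsto_W2_clamp htT h.right
  let m : Kernel ℝ (Rn n) := ⟨fun r => μ (clamp t T r), measurable_of_tendsto_W2 hp2 hr⟩
  let α' : Kernel (ℝ × Rn n) U := ⟨fun p => α p.1 p.2, h.measurable⟩
  have hα' : IsMarkovKernel α' := ⟨fun p => (h.markov p.1).isProbabilityMeasure p.2⟩
  obtain ⟨R, hR⟩ := exists_moment_bound h.mem h.right h.left_mem h.left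
  obtain ⟨K, hK⟩ := hC.isFlow (m := m) hp2 (fun r => hR _ (clamp_mem htT r)) hr α'
  have hsect : ∀ r, α'.sectR r = α r := fun r => by
    ext x : 1
    rw [Kernel.sectR_apply]
    rfl
  simp only [hsect] at hK
  refine ⟨m, R, K, hK, fun r hr => ?_⟩
  show μ (clamp t T r) = μ r
  rw [clamp_of_mem hr]

theorem ito (h : IsFokkerPlanckPath C lam ν T t μ μL α αL) (hC : C.Regular lam)
    (hν : IsSimpleCounting ν) (ht : t ∈ Icc 0 T) {J Jt : ℝ → Measure (Rn n) → ℝ}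
    {δJ : ℝ → Measure (Rn n) → Rn n → ℝ} {DJ : ℝ → Measure (Rn n) → Rn n → Rn n}
    {DDJ : ℝ → Measure (Rn n) → Rn n → Rn n →L[ℝ] Rn n} (hJ : IsC111 T J Jt δJ DJ DDJ) :
    (∀ r ∈ Icc t T, Integrable
      (C.drift lam (μ r) (α r) (DJ r (μ r)) (DDJ r (μ r))) (μ r)) ∧
    IntervalIntegrable (fun r => Jt r (μ r)
      + ∫ x, C.drift lam (μ r) (α r) (DJ r (μ r)) (DDJ r (μ r)) x ∂(μ r)) volume t T ∧
    IntegrableOn (fun p : ℝ × Z =>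
      J p.1 (C.jumpAdj (μL p.1) (αL p.1) p.2 (μL p.1)) - J p.1 (μL p.1)) (Ioc t T ×ˢ univ) ν ∧
    ∀ s ∈ Icc t T, J s (μ s) = J t (μ t)
      + (∫ r in t..s, (Jt r (μ r)
          + ∫ x, C.drift lam (μ r) (α r) (DJ r (μ r)) (DDJ r (μ r)) x ∂(μ r)))
      + ∫ p in Ioc t s ×ˢ univ,
          (J p.1 (C.jumpAdj (μL p.1) (αL p.1) p.2 (μL p.1)) - J p.1 (μL p.1)) ∂ν := by
  obtain ⟨m, R, K, hm, hmμ⟩ := h.exists_flow hC ht.2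
  set β := fun r x => C.bHat x (m r) (α r) - ∫ z, C.γHat x (m r) (α r) z ∂lam
  set a := fun r x => C.aHat x (m r) (α r)
  have hdrift : ∀ r ∈ Icc t T, ∀ p H, C.drift lam (μ r) (α r) p H
      = secondOrder (β r) (a r) p H := fun r hr p H => by
    rw [← hmμ r hr]
    rfl
  have hsub : Icc t T ⊆ Icc 0 T := Icc_subset_Icc_left ht.1
  have huIcc : ∀ s ∈ Icc t T, ∀ r ∈ uIcc t s, r ∈ Icc t T := fun s hs r hr => by
    rw [uIcc_of_le hs.1] at hr
    exact ⟨hr.1, hr.2.trans hs.2⟩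
  have htI := left_mem_Icc.2 ht.2
  have hleft : ∀ s ∈ Ioc t T, Tendsto (fun r => W2 (m r) (μL s)) (𝓝[<] s) (𝓝 0) := fun s hs => by
    refine (h.left s hs).congr' ?_
    filter_upwards [Ioo_mem_nhdsLT hs.1] with r hr
    rw [hmμ r ⟨hr.1.le, hr.2.le.trans hs.2⟩]
  have heq : ∀ φ, ContDiff ℝ (⊤ : ℕ∞) φ → HasCompactSupport φ → ∀ s ∈ Icc t T,
      ∫ x, φ x ∂(m s) = ∫ x, φ x ∂(m t)
        + (∫ r in t..s, ∫ x, secondOrder (β r) (a r) (∇ φ) (fderiv ℝ (∇ φ)) x ∂(m r))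
        + ∫ p in Ioc t s ×ˢ univ,
          (∫ x, (C.jumpOp (μL p.1) (αL p.1) p.2 φ x - φ x) ∂(μL p.1)) ∂ν := by
    intro φ hφ hc s hs
    rw [hmμ s hs, hmμ t htI, h.eq φ hφ hc s hs]
    congr 2
    refine intervalIntegral.integral_congr fun r hr => ?_
    have hr' := huIcc s hs r hr
    simp only [hdrift r hr', hmμ r hr']
  have hΨ : ∀ s ∈ Ioc t T, IntegrableOn (fun p : ℝ × Z =>
        J p.1 (C.jumpAdj (μL p.1) (αL p.1) p.2 (μL p.1)) - J p.1 (μL p.1)) ({s} ×ˢ univ) ν ∧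
      J s (m s) = J s (μL s) + ∫ p in {s} ×ˢ univ,
        (J p.1 (C.jumpAdj (μL p.1) (αL p.1) p.2 (μL p.1)) - J p.1 (μL p.1)) ∂ν := by
    intro s hs
    rw [hmμ s (Ioc_subset_Icc_self hs)]
    refine h.jump_eq hC hν J hs fun φ hφ hc => ?_
    rw [← hmμ s (Ioc_subset_Icc_self hs)]
    exact hm.integral_jump (Φ := fun φ p =>
      ∫ x, (C.jumpOp (μL p.1) (αL p.1) p.2 φ x - φ x) ∂(μL p.1)) hν
      (fun φ hφ hc r hr => h.integrableOn_jump hC hν hφ hc hr) heq hs (h.left_mem s hs)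
      (hleft s hs) hφ hc
  obtain ⟨h1, h2, h3⟩ := hm.ito hJ ht.1 ht.2 hν h.left_mem hleft (Φ := fun φ p =>
      ∫ x, (C.jumpOp (μL p.1) (αL p.1) p.2 φ x - φ x) ∂(μL p.1)) heq hΨ
  have hG : ∀ r ∈ Icc t T, Jt r (m r)
      + ∫ x, secondOrder (β r) (a r) (DJ r (m r)) (DDJ r (m r)) x ∂(m r)
      = Jt r (μ r) + ∫ x, C.drift lam (μ r) (α r) (DJ r (μ r)) (DDJ r (μ r)) x ∂(μ r) :=
    fun r hr => by rw [hdrift r hr, hmμ r hr]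
  refine ⟨fun r hr => ?_, h1.congr fun r hr => hG r ?_, h2, fun s hs => ?_⟩
  · obtain ⟨c, hc⟩ := hJ.growth (∫ x, ‖x‖ ^ 2 ∂(μ r))
    have hp2 := h.mem r hr
    have hb := hc r (hsub hr) _ hp2 le_rfl
    rw [hdrift r hr]
    exact (hm.coefGrowth r).integrable_secondOrder (hJ.continuous_DJ.continuous (hsub hr) hp2)
      (hJ.continuous_DDJ.continuous (hsub hr) hp2) (fun x => (hb x).1) (fun x => (hb x).2) hp2
  · exact huIcc T (right_mem_Icc.2 ht.2) r (uIoc_subset_uIcc hr)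
  · rw [← hmμ s hs, ← hmμ t htI, h3 s hs]
    congr 2
    exact intervalIntegral.integral_congr fun r hr => hG r (huIcc s hs r hr)

end IsFokkerPlanckPath

end Path

end MFC

theorem mainTheorem11 {n d : ℕ} {B : Type*} [NormedAddCommGroup B] [NormedSpace ℝ B]
    [MeasurableSpace B] [BorelSpace B] (U : Set B) (hU : IsCompact U)
    {Z : Type*} [MeasurableSpace Z] (lam : Measure Z) [IsFiniteMeasure lam]
    (C : MFC.Coefficients n d U Z) (hC : C.Regular lam)
    {Ω : Type*} [MeasurableSpace Ω] (P : Measure Ω) [IsProbabilityMeasure P]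
    (T : ℝ) (hT : 0 < T) (t : ℝ) (ht : t ∈ Icc 0 T)
    (N : Ω → Measure (ℝ × Z))
    (hN : MFC.IsPoissonRandomMeasure P N ((volume.restrict (Ioc 0 T)).prod lam))
    (α αL : ℝ → Ω → Kernel (MFC.Rn n) U) (hα : MFC.IsRelaxedControl P N T t α)
    (μ μL : ℝ → Ω → Measure (MFC.Rn n)) (hμ : MFC.IsCadlagFlow P N T t μ μL)
    (hαL : MFC.IsLeftLimitControl P N T t μ μL α αL)
    (hFP : MFC.SolvesFokkerPlanck C lam P N T t α αL μ μL)
    (J Jt : ℝ → Measure (MFC.Rn n) → ℝ) (δJ : ℝ → Measure (MFC.Rn n) → MFC.Rn n → ℝ)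
    (DJ : ℝ → Measure (MFC.Rn n) → MFC.Rn n → MFC.Rn n)
    (DDJ : ℝ → Measure (MFC.Rn n) → MFC.Rn n → MFC.Rn n →L[ℝ] MFC.Rn n)
    (hJ : MFC.IsC111 T J Jt δJ DJ DDJ) :
    ∀ᵐ ω ∂P,
      (∀ r ∈ Icc t T, Integrable
        (C.drift lam (μ r ω) (α r ω) (DJ r (μ r ω)) (DDJ r (μ r ω))) (μ r ω)) ∧
      IntervalIntegrable (fun r => Jt r (μ r ω)
        + ∫ x, C.drift lam (μ r ω) (α r ω) (DJ r (μ r ω)) (DDJ r (μ r ω)) x ∂(μ r ω))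
        volume t T ∧
      IntegrableOn (fun p : ℝ × Z =>
        J p.1 (C.jumpAdj (μL p.1 ω) (αL p.1 ω) p.2 (μL p.1 ω)) - J p.1 (μL p.1 ω))
        (Ioc t T ×ˢ univ) (N ω) ∧
      ∀ s ∈ Icc t T,
        J s (μ s ω) = J t (μ t ω)
          + (∫ r in t..s, (Jt r (μ r ω)
              + ∫ x, C.drift lam (μ r ω) (α r ω) (DJ r (μ r ω)) (DDJ r (μ r ω)) x ∂(μ r ω)))
          + ∫ p in Ioc t s ×ˢ univ,
              (J p.1 (C.jumpAdj (μL p.1 ω) (αL p.1 ω) p.2 (μL p.1 ω)) - J p.1 (μL p.1 ω))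
                ∂(N ω) := by
  have : CompactSpace U := isCompact_iff_compactSpace.mp hU
  filter_upwards [hN.ae_isSimpleCounting hT, hα.measurable_paths, hμ.mem, hμ.right, hμ.left_mem,
    hμ.left, hαL, hFP] with ω hν hmeas hmem hright hLmem hleft hL heq
  have hsub : ∀ s ∈ Icc t T, Ioc t s ×ˢ (univ : Set Z) ⊆ Ioc 0 T ×ˢ univ := fun s hs =>
    prod_mono (Ioc_subset_Ioc ht.1 hs.2) subset_rfl
  -- The path argument runs with the noise restricted to `(0, T] × Z`, where it is finite and
  -- simple; on `(t, s]` the restriction changes no integral.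
  have hres : ∀ s ∈ Icc t T, ((N ω).restrict (Ioc 0 T ×ˢ univ)).restrict (Ioc t s ×ˢ univ)
      = (N ω).restrict (Ioc t s ×ˢ univ) := fun s hs =>
    Measure.restrict_restrict_of_subset (hsub s hs)
  have hpath : MFC.IsFokkerPlanckPath C lam ((N ω).restrict (Ioc 0 T ×ˢ univ)) T t
      (fun s => μ s ω) (fun s => μL s ω) (fun s => α s ω) (fun s => αL s ω) := by
    refine ⟨hmem, hright, hLmem, hleft, fun s => hα.markov s ω, hmeas, fun s hs hatom => ?_,
      fun φ hφ hc s hs => ?_⟩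
    · exact (hL s hs fun h0 => hatom (Measure.absolutelyContinuous_of_le
        Measure.restrict_le_self h0)).1
    · rw [hres s hs]
      exact heq φ hφ hc s hs
  obtain ⟨h1, h2, h3, h4⟩ := hpath.ito hC hν ht hJ
  refine ⟨h1, h2, ?_, fun s hs => ?_⟩
  · rw [IntegrableOn, hres T (right_mem_Icc.2 ht.2)] at h3
    exact h3
  · have := h4 s hs
    rwa [hres s hs] at this
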